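/- Let $(X,\mathscr B)$ be a standard Borel space, $\mu$ a probability measure on it, and $f:X\to X$ a measurable map preserving $\mu$. Let $\pi:\mathcal E\to X$ be a measurable vector bundle of rank $d$ with a measurable Euclidean norm $\|\cdot\|$ (i.e. a measurable family of inner products on the fibres), and let $F:\mathcal E\to\mathcal E$ be a measurable linear bundle morphism covering $f$, i.e. $F_x:\mathcal E_x\to\mathcal E_{f(x)}$ is linear (possibly not invertible) for every $x$. Put $F^n_x=F_{f^{n-1}(x)}\circ\cdots\circ F_x$ and assume $\int\log^+\|F_x\|\,d\mu(x)<\infty$. Throughout $\log 0=-\infty$, and integrals of functions with integrable positive part take values in $[-\infty,\infty)$. For $1\le i\le d$ the pointwise Lyapunov exponents $$\lambda_i(x)=\lim_{n\to\infty}\tfrac1n\log\sigma_i(F^n_x)\in[-\infty,\infty)$$ exist for $\mu$-a.e. $x$, where $\sigma_1\ge\sigma_2\ge\dots$ denote singular values; set $\lambda_i(\mu)=\int\lambda_i(x)\,d\mu(x)$. If $f$ is ergodic with respect to $\mu$, then $\lambda_i(x)=\lambda_i(\mu)$ for $\mu$-a.e. $x$. For $1\le k\le d$ let $\mathrm G_k(\mathcal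 E)$ be the bundle of $k$-dimensional subspaces of the fibres of $\mathcal E$, and let $\hat{\mathrm G}_k=\mathrm G_k(\mathcal E)\sqcup\Delta$, where $\Delta=\bigsqcup_{x\in X}\{\Delta_x\}$ is a cemetery section, with projection $\pi_{G_k}:\hat{\mathrm G}_k\to X$. Define $\hat F_{G_k}(x,W)=(f(x),F_xW)$ if $\dim F_xW=k$, and $\hat F_{G_k}(x,W)=\Delta_{f(x)}$ if $\dim F_xW<k$; also $\hat F_{G_k}(\Delta_x)=\Delta_{f(x)}$. Define $\hat\phi_{G_k}(x,W)=\log\mathrm{Jac}_k(F_x|_W)$ with $\mathrm{Jac}_k(F_x|_W)=\|\wedge^k(F_x|_W)\|$ (so $\hat\phi_{G_k}(x,W)=-\infty$ if $\dim F_xW<k$), and $\hat\phi_{G_k}=-\infty$ on $\Delta$. Then for every $k=1,\dots,d$ $$\sum_{i=1}^k\lambda_i(\mu)=\sup\Big\{\int\hat\phi_{G_k}\,d\nu:\ \nu \text{ a probability measure on } \hat{\mathrm G}_k,\ \hat F_{G_k}\text{-invariant},\ (\pi_{G_k})_*\nu=\mu\Big\},$$ and the supremum is attained. If $f$ is ergodic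 with respect to $\mu$, it is attained on an ergodic $\hat F_{G_k}$-invariant lift $\nu$ of $\mu$. If every $F_x$ is invertible, the maximizing lifts in both assertions can be chosen with $\nu(\Delta)=0$, so that the cemetery section need not be adjoined. -/

import Mathlib

open MeasureTheory Filter Topology

universe u v

noncomputable section

/-- The integral in `[-∞, ∞]` of an extended real valued function: the integral of the positive
part minus the integral of the negative part. It is used only for functions whose positive part
has a finite integral. -/
def extIntegral {α : Type u} [MeasurableSpace α] (ν : Measure α) (φ : α → EReal) : EReal :=
  ((∫⁻ a, (φ a).toENNReal ∂ν : ENNReal) : EReal) - ((∫⁻ a, (-φ a).toENNReal ∂ν : ENNReal) : EReal)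

/-- The logarithm of a nonnegative real number, with `log 0 = -∞`. -/
def extLog (t : ℝ) : EReal := ENNReal.log (ENNReal.ofReal t)

/-- The total space of a family of fibres. -/
structure BundleTotal {X : Type u} (E : X → Type v) where
  base : X
  vec : E base

section VectorBundle

variable {X : Type u} [MeasurableSpace X] (E : X → Type v)
  [∀ x, NormedAddCommGroup (E x)] [∀ x, InnerProductSpace ℝ (E x)]
  [MeasurableSpace (BundleTotal E)]

/-- `E` is a measurable vector bundle of rank `d` with a measurable Euclidean norm: the measurable
structure of the total space is given by fibrewise linear trivializations over the members of a
countable measurable cover of the base, and the norm is measurable on the total space. -/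
structure IsMeasurableEuclideanBundle (d : ℕ) : Prop where
  exists_trivialization : ∃ (U : ℕ → Set X) (e : ∀ n, ∀ x : U n, E x ≃ₗ[ℝ] (Fin d → ℝ)),
    (∀ n, MeasurableSet (U n)) ∧ (⋃ n, U n) = Set.univ ∧
    ∀ n, MeasurableEmbedding fun p : U n × (Fin d → ℝ) ↦
      (⟨p.1, (e n p.1).symm p.2⟩ : BundleTotal E)
  measurable_norm : Measurable fun p : BundleTotal E ↦ ‖p.vec‖

/-- Ordered `k`-frames (linearly independent `k`-tuples) in the fibres of `E`. -/
structure FrameBundle (k : ℕ) where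
  base : X
  vec : Fin k → E base
  linearIndependent : LinearIndependent ℝ vec

/-- The frame bundle as a subset of the `k`-fold fibre product of `E` over `X`. -/
instance FrameBundle.instMeasurableSpace (k : ℕ) : MeasurableSpace (FrameBundle E k) :=
  MeasurableSpace.comap FrameBundle.base inferInstance ⊔
    ⨆ i : Fin k, MeasurableSpace.comap
      (fun p : FrameBundle E k ↦ (⟨p.base, p.vec i⟩ : BundleTotal E)) inferInstance

/-- The bundle of `k`-dimensional subspaces of the fibres of `E`, with a cemetery point adjoined to
each fibre. -/
inductive GrassmannBundle (k : ℕ) : Type (max u v)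
  | subspace (x : X) (W : Submodule ℝ (E x)) (hW : Module.finrank ℝ W = k) : GrassmannBundle k
  | cemetery (x : X) : GrassmannBundle k

variable {E}

/-- The subspace spanned by a frame. -/
def FrameBundle.span {k : ℕ} (p : FrameBundle E k) : GrassmannBundle E k :=
  .subspace p.base (Submodule.span ℝ (Set.range p.vec))
    (by simpa using finrank_span_eq_card p.linearIndependent)

/-- The Grassmann bundle carries the quotient measurable structure of the frame bundle, and the
cemetery section, which is a measurable subset, carries the measurable structure of `X`. -/
instance GrassmannBundle.instMeasurableSpace (k : ℕ) : MeasurableSpace (GrassmannBundle E k) :=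
  MeasurableSpace.map (FrameBundle.span : FrameBundle E k → GrassmannBundle E k)
      inferInstance ⊓
    MeasurableSpace.map (GrassmannBundle.cemetery : X → GrassmannBundle E k) inferInstance

/-- The bundle projection. -/
def GrassmannBundle.base {k : ℕ} : GrassmannBundle E k → X
  | .subspace x _ _ => x
  | .cemetery x => x

variable {f : X → X} (F : ∀ x, E x →L[ℝ] E (f x))

/-- The iterates `F_x^n = F_{f^{n-1} x} ∘ ⋯ ∘ F_x`. -/
def bundleIterate : ∀ (n : ℕ) (x : X), E x →L[ℝ] E (f^[n] x)
  | 0, x => ContinuousLinearMap.id ℝ (E x)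
  | n + 1, x => (bundleIterate n (f x)).comp (F x)

end VectorBundle

section Exponents

variable {X : Type u} {E : X → Type v}
  [∀ x, NormedAddCommGroup (E x)] [∀ x, InnerProductSpace ℝ (E x)]
  [∀ x, FiniteDimensional ℝ (E x)]
  {f : X → X} (F : ∀ x, E x →L[ℝ] E (f x))

/-- `(1 / n) log σ_{i+1}(F_x^n)`; singular values are indexed from `0`, in decreasing order. -/
def singularGrowth (i n : ℕ) (x : X) : EReal :=
  ((n : ℝ)⁻¹ : ℝ) * extLog ((bundleIterate F n x : E x →ₗ[ℝ] E (f^[n] x)).singularValues i)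

/-- The pointwise Lyapunov exponent `λ_{i+1}(x)`, the growth rate of `σ_{i+1}(F_x^n)`. -/
def pointwiseExponent (i : ℕ) (x : X) : EReal :=
  limsup (fun n ↦ singularGrowth F i n x) atTop

/-- The Lyapunov exponent `λ_{i+1}(μ)`, the mean of the pointwise exponent `λ_{i+1}(x)`; if the
base map is ergodic, this is the almost sure value of the pointwise exponent. -/
def lyapunovExponent [MeasurableSpace X] (μ : Measure X) (i : ℕ) : EReal :=
  extIntegral μ (pointwiseExponent F i)

/-- `‖⋀^k L‖`, the operator norm for the Euclidean norms induced on the exterior powers. -/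
def wedgeNorm {V : Type*} {V' : Type*} [NormedAddCommGroup V] [InnerProductSpace ℝ V]
    [FiniteDimensional ℝ V] [NormedAddCommGroup V'] [InnerProductSpace ℝ V']
    [FiniteDimensional ℝ V'] (k : ℕ) (L : V →ₗ[ℝ] V') : ℝ :=
  ‖(exteriorPower.map k L).toContinuousLinearMap‖

/-- `Jac_k(L|_W) = ‖⋀^k (L|_W)‖`. -/
def jacobian {V : Type*} {V' : Type*} [NormedAddCommGroup V] [InnerProductSpace ℝ V]
    [FiniteDimensional ℝ V] [NormedAddCommGroup V'] [InnerProductSpace ℝ V']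
    [FiniteDimensional ℝ V'] (k : ℕ) (L : V →ₗ[ℝ] V') (W : Submodule ℝ V) : ℝ :=
  wedgeNorm k (L.domRestrict W)

variable {k : ℕ}

open Classical in
/-- The map induced by `F` on the Grassmann bundle; degenerate subspaces are sent to the cemetery
section, which is equivariant. -/
def grassmannMap : GrassmannBundle E k → GrassmannBundle E k
  | .subspace x W _ =>
      if h : Module.finrank ℝ (W.map (F x : E x →ₗ[ℝ] E (f x))) = k then
        .subspace (f x) (W.map (F x : E x →ₗ[ℝ] E (f x))) h
      else .cemetery (f x)
  | .cemetery x => .cemetery (f x)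

/-- The potential `log Jac_k(F_x|_W)`, equal to `-∞` on the cemetery section (and at the degenerate
subspaces, where the Jacobian vanishes). -/
def grassmannPotential : GrassmannBundle E k → EReal
  | .subspace x W _ => extLog (jacobian k (F x : E x →ₗ[ℝ] E (f x)) W)
  | .cemetery _ => ⊥

/-- `ν` is an invariant lift of `μ` to the Grassmann bundle with cemetery. -/
structure IsInvariantLift [MeasurableSpace X] [MeasurableSpace (BundleTotal E)]
    (μ : Measure X) (ν : Measure (GrassmannBundle E k)) : Prop where
  invariant : MeasurePreserving (grassmannMap F) ν ν
  lifts : MeasurePreserving GrassmannBundle.base ν μ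

end Exponents

end

/-! ### The superadditive ergodic theorem in `[0, ∞]`. -/

section SuperadditiveErgodic

open scoped ENNReal

/-! Everything is renormalized so that it takes values in `[0, ∞]`. Let `Sₙ` be the Birkhoff sum of
`log⁺ ‖F‖`. Then `‖⋀^k F^n‖ ≤ exp (k Sₙ)`, and the cost `k Sₙ - log ‖⋀^k F^n‖` (`wedgeCost`) is
nonnegative, possibly infinite, and superadditive along orbits. A superadditive ergodic theorem
without any integrability hypothesis (`IsSuperadditive.exists_tendsto`) gives its growth rate almost
everywhere, with integral `rate = sup (1/n) ∫ costₙ`. Since `‖⋀^k L‖` is the product of the first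
`k` singular values, differences in `k` give the individual exponents, and their sum up to `k` is `k
∫ log⁺ ‖F‖ - rate` (`lyapunovExponent_spec`).

On the Grassmann bundle the potential is `k log⁺ ‖F‖` minus a nonnegative cost, infinite on
degenerate subspaces and on the cemetery. The first term has the same integral for all lifts of `μ`,
so the theorem says that the least integral of the cost over invariant lifts is `rate`.

Lower bound: the cost summed along an orbit over `W` computes the contraction of one unit
`k`-vector, hence dominates the cost of the operator norm (`wedgeCost_le_sum_grassmannCost`);
integrate and divide by `n`.

Attainment: in a measurable orthonormal trivialization the dynamics acts on `X × Stiefel` by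
Gram–Schmidt. Start from measurable frames expanded by `F^n` at least half as much as possible,
average over `n` iterates, and take a weak limit (`exists_lintegral_cocycleCost_le`). The action is
discontinuous at degenerate frames, but there the continuous cost is infinite; if `rate` is finite,
lower semicontinuity makes them null for the limit, which is therefore invariant. If all `F x` are
injective there are no degenerate frames. In the remaining case `rate = ∞` and the cemetery section
carries a maximizing lift. The measure on frames is finally pushed to the Grassmann bundle by taking
spans, so that bundle needs no topology.

Ergodicity: minimizing lifts form a compact set of measures, and Krein–Milman gives an extreme one.
If it splits into invariant measures, these lift `μ` because `μ` is extreme, and they are minimizing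
because the cost is affine; so the splitting is trivial (`exists_ergodic_invariantLift`). -/

lemma ENNReal.tendsto_natCast_div_natCast_add (N : ℕ) :
    Tendsto (fun m : ℕ ↦ (m : ℝ≥0∞) / ((m + N : ℕ) : ℝ≥0∞)) atTop (𝓝 1) := by
  have h1 : Tendsto (fun m : ℕ ↦ (m : ℝ) / (m + N)) atTop (𝓝 1) :=
    tendsto_natCast_div_add_atTop (N : ℝ)
  have h2 := (ENNReal.continuous_ofReal.tendsto 1).comp h1
  rw [ENNReal.ofReal_one] at h2
  refine h2.congr' ?_
  filter_upwards [eventually_gt_atTop 0] with m hm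
  have hm' : (0 : ℝ) < m := by exact_mod_cast hm
  rw [Function.comp_apply, ENNReal.ofReal_div_of_pos (by positivity), ENNReal.ofReal_natCast]
  congr 1
  rw [← Nat.cast_add, ENNReal.ofReal_natCast]

lemma ENNReal.div_natCast_mul_div {a : ℝ≥0∞} {m : ℕ} (hm : 0 < m) (N : ℕ) :
    a / m * (m / ((m + N : ℕ) : ℝ≥0∞)) = a / ((m + N : ℕ) : ℝ≥0∞) := by
  rw [div_eq_mul_inv, div_eq_mul_inv, div_eq_mul_inv, mul_assoc, ← mul_assoc _ (m : ℝ≥0∞),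
    ENNReal.inv_mul_cancel (by exact_mod_cast hm.ne') (ENNReal.natCast_ne_top m), one_mul]

lemma ENNReal.natCast_mul_div_cancel_left {a : ℝ≥0∞} {n : ℕ} (hn : 0 < n) : n * a / n = a := by
  rw [mul_comm]
  exact ENNReal.mul_div_cancel_right (by simp; omega) (by simp)

/-- The shift by `N` changes the denominator by the factor `m / (m + N)`, which tends to `1`. -/
lemma ENNReal.limsup_div_le_of_le_add {u v : ℕ → ℝ≥0∞} {N : ℕ} (h : ∀ m, u m ≤ v (m + N)) :
    limsup (fun m ↦ u m / m) atTop ≤ limsup (fun n ↦ v n / n) atTop := by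
  have h1 := (ENNReal.tendsto_natCast_div_natCast_add N).liminf_eq
  calc limsup (fun m ↦ u m / m) atTop
      = limsup (fun m ↦ u m / m) atTop
          * liminf (fun m : ℕ ↦ (m : ℝ≥0∞) / ((m + N : ℕ) : ℝ≥0∞)) atTop := by rw [h1, mul_one]
    _ ≤ limsup ((fun m ↦ u m / m) * fun m : ℕ ↦ (m : ℝ≥0∞) / ((m + N : ℕ) : ℝ≥0∞)) atTop :=
        ENNReal.le_limsup_mul
    _ ≤ limsup (fun m ↦ v (m + N) / ((m + N : ℕ) : ℝ≥0∞)) atTop := by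
        refine limsup_le_limsup ?_
        filter_upwards [eventually_gt_atTop 0] with m hm
        rw [Pi.mul_apply, ENNReal.div_natCast_mul_div hm]
        exact ENNReal.div_le_div_right (h m) _
    _ = limsup (fun n ↦ v n / n) atTop := limsup_nat_add (fun n ↦ v n / (n : ℝ≥0∞)) N

lemma ENNReal.liminf_div_le_of_le_add {u v : ℕ → ℝ≥0∞} {N : ℕ} (h : ∀ m, u m ≤ v (m + N)) :
    liminf (fun m ↦ u m / m) atTop ≤ liminf (fun n ↦ v n / n) atTop := by
  have h1 := (ENNReal.tendsto_natCast_div_natCast_add N).liminf_eq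
  calc liminf (fun m ↦ u m / m) atTop
      = liminf (fun m ↦ u m / m) atTop
          * liminf (fun m : ℕ ↦ (m : ℝ≥0∞) / ((m + N : ℕ) : ℝ≥0∞)) atTop := by rw [h1, mul_one]
    _ ≤ liminf ((fun m ↦ u m / m) * fun m : ℕ ↦ (m : ℝ≥0∞) / ((m + N : ℕ) : ℝ≥0∞)) atTop :=
        ENNReal.le_liminf_mul
    _ ≤ liminf (fun m ↦ v (m + N) / ((m + N : ℕ) : ℝ≥0∞)) atTop := by
        refine liminf_le_liminf ?_
        filter_upwards [eventually_gt_atTop 0] with m hm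
        rw [Pi.mul_apply, ENNReal.div_natCast_mul_div hm]
        exact ENNReal.div_le_div_right (h m) _
    _ = liminf (fun n ↦ v n / n) atTop := liminf_nat_add (fun n ↦ v n / (n : ℝ≥0∞)) N

variable {X : Type*} {f : X → X}

lemma MeasureTheory.MeasurePreserving.lintegral_sum_range [MeasurableSpace X]
    {μ : Measure X} (hf : MeasurePreserving f μ μ) {w : X → ℝ≥0∞} (hw : Measurable w) (n : ℕ) :
    ∫⁻ x, ∑ j ∈ Finset.range n, w (f^[j] x) ∂μ = n * ∫⁻ x, w x ∂μ := by
  rw [lintegral_finsetSum (f := fun j x ↦ w (f^[j] x)) _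
    fun j _ ↦ hw.comp (hf.iterate j).measurable]
  simp only [(hf.iterate _).lintegral_comp hw, Finset.sum_const, Finset.card_range, nsmul_eq_mul]

/-- A sequence of nonnegative extended functions that is superadditive along the orbits of `f`. -/
def IsSuperadditive (f : X → X) (h : ℕ → X → ℝ≥0∞) : Prop :=
  ∀ m n x, h m x + h n (f^[m] x) ≤ h (m + n) x

namespace IsSuperadditive

variable {h : ℕ → X → ℝ≥0∞}

lemma comp_le_succ (hh : IsSuperadditive f h) (n : ℕ) (x : X) : h n (f x) ≤ h (n + 1) x := by
  have := hh 1 n x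
  rw [add_comm 1 n] at this
  exact le_add_self.trans this

lemma comp_iterate_le (hh : IsSuperadditive f h) (n r : ℕ) (x : X) :
    h n (f^[r] x) ≤ h (n + r) x := by
  have := hh r n x
  rw [add_comm r n] at this
  exact le_add_self.trans this

lemma limsup_comp_le (hh : IsSuperadditive f h) (x : X) :
    limsup (fun n ↦ h n (f x) / n) atTop ≤ limsup (fun n ↦ h n x / n) atTop :=
  ENNReal.limsup_div_le_of_le_add (u := fun n ↦ h n (f x)) (v := fun n ↦ h n x) (N := 1)
    fun m ↦ hh.comp_le_succ m x

/-- A stopping-time covering of the orbit. At a point of `E` jump `j ≤ N` steps: `h j` pays for the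
whole block because `a` does not increase along orbits. Off `E` move one step, where the indicator
contributes nothing. The last `N` terms are dropped because the final jump may overshoot. -/
lemma sum_indicator_le (hh : IsSuperadditive f h) {a : X → ℝ≥0∞} (ha : ∀ x, a (f x) ≤ a x)
    {E : Set X} {N : ℕ} (hE : ∀ x ∈ E, ∃ j, 1 ≤ j ∧ j ≤ N ∧ j * a x ≤ h j x) (n : ℕ) (x : X) :
    ∑ j ∈ Finset.range (n - N), E.indicator a (f^[j] x) ≤ h n x := by
  induction n using Nat.strong_induction_on generalizing x with
  | _ n ih =>
    rcases le_or_gt n N with hn | hn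
    · simp [Nat.sub_eq_zero_of_le hn]
    by_cases hx : x ∈ E
    · obtain ⟨j, hj1, hjN, hj⟩ := hE x hx
      have ha' : ∀ i, a (f^[i] x) ≤ a x := by
        intro i
        induction i with
        | zero => simp
        | succ i IH => rw [Function.iterate_succ_apply']; exact (ha _).trans IH
      have hsub : n - N ≤ j + ((n - j) - N) := by omega
      calc ∑ i ∈ Finset.range (n - N), E.indicator a (f^[i] x)
          ≤ ∑ i ∈ Finset.range (j + ((n - j) - N)), E.indicator a (f^[i] x) :=
            Finset.sum_le_sum_of_subset (Finset.range_mono hsub)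
        _ = ∑ i ∈ Finset.range j, E.indicator a (f^[i] x)
            + ∑ i ∈ Finset.range ((n - j) - N), E.indicator a (f^[i] (f^[j] x)) := by
            rw [Finset.sum_range_add]
            congr 1
            refine Finset.sum_congr rfl fun i _ ↦ ?_
            rw [← Function.iterate_add_apply, add_comm]
        _ ≤ ∑ i ∈ Finset.range j, a x + h (n - j) (f^[j] x) := by
            gcongr with i hi
            · exact (Set.indicator_le_self _ _ _).trans (ha' i)
            · exact ih _ (by omega) _
        _ ≤ h j x + h (n - j) (f^[j] x) := by
            gcongr
            simpa using hj
        _ ≤ h n x := by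
            have := hh j (n - j) x
            rwa [Nat.add_sub_cancel' (by omega)] at this
    · obtain ⟨m, rfl⟩ : ∃ m, n = m + 1 := ⟨n - 1, by omega⟩
      have hm : m + 1 - N = (m - N) + 1 := by omega
      rw [hm, Finset.sum_range_succ']
      simp only [Function.iterate_zero, id, Set.indicator_of_notMem hx, add_zero,
        Function.iterate_succ_apply]
      exact (ih m (by omega) (f x)).trans (hh.comp_le_succ m x)

/-- Split the times `j < n` into residue classes modulo `N`; within a class the blocks of length `N`
are adjacent and superadditivity merges them into one. In the induction the new first block is glued
to the last class of the orbit of `f x`, which starts exactly where that block ends. -/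
lemma sum_block_le (hh : IsSuperadditive f h) {N : ℕ} (hN : 0 < N) (n : ℕ) (x : X) :
    ∑ j ∈ Finset.range n, h N (f^[j] x) ≤ ∑ r ∈ Finset.range N, h (n + N - r) (f^[r] x) := by
  induction n generalizing x with
  | zero => simp
  | succ n ih =>
    rw [Finset.sum_range_succ']
    obtain ⟨M, rfl⟩ : ∃ M, N = M + 1 := ⟨N - 1, by omega⟩
    rw [Finset.sum_range_succ' (fun r ↦ h (n + 1 + (M + 1) - r) (f^[r] x))]
    have h1 := ih (f x)
    rw [Finset.sum_range_succ] at h1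
    have h2 := hh (M + 1) (n + 1) x
    simp only [Function.iterate_succ_apply, Function.iterate_zero, id] at h1 h2 ⊢
    calc ∑ k ∈ Finset.range n, h (M + 1) (f^[k] (f x)) + h (M + 1) x
        ≤ (∑ r ∈ Finset.range M, h (n + (M + 1) - r) (f^[r] (f x))
          + h (n + (M + 1) - M) (f^[M] (f x))) + h (M + 1) x := by gcongr
      _ = ∑ r ∈ Finset.range M, h (n + (M + 1) - r) (f^[r] (f x))
          + (h (M + 1) x + h (n + 1) (f^[M] (f x))) := by
          rw [show n + (M + 1) - M = n + 1 by omega]; ring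
      _ ≤ _ := by
          refine add_le_add (le_of_eq ?_) (h2.trans (le_of_eq ?_))
          · refine Finset.sum_congr rfl fun r _ ↦ ?_
            rw [show n + 1 + (M + 1) - (r + 1) = n + (M + 1) - r by omega]
          · rw [show n + 1 + (M + 1) - 0 = M + 1 + (n + 1) by omega]

/-- Truncation at linear growth makes all integrals finite while preserving superadditivity. -/
lemma min_natCast_mul (hh : IsSuperadditive f h) (M : ℕ) :
    IsSuperadditive f fun n x ↦ min (h n x) (n * M) := by
  intro m n x
  refine le_min ((add_le_add (min_le_left _ _) (min_le_left _ _)).trans (hh m n x)) ?_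
  refine (add_le_add (min_le_right _ _) (min_le_right _ _)).trans (le_of_eq ?_)
  push_cast
  ring

variable [MeasurableSpace X] {μ : Measure X}

/-- The mean growth rate `sup_n (1 / n) ∫ h_n`. -/
noncomputable def rate (μ : Measure X) (h : ℕ → X → ℝ≥0∞) : ℝ≥0∞ :=
  ⨆ n : ℕ, (∫⁻ x, h (n + 1) x ∂μ) / ((n + 1 : ℕ) : ℝ≥0∞)

lemma lintegral_le_mul_rate (n : ℕ) (hn : 0 < n) : ∫⁻ x, h n x ∂μ ≤ n * rate μ h := by
  obtain ⟨m, rfl⟩ : ∃ m, n = m + 1 := ⟨n - 1, by omega⟩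
  have := le_iSup (fun n : ℕ ↦ (∫⁻ x, h (n + 1) x ∂μ) / ((n + 1 : ℕ) : ℝ≥0∞)) m
  rw [mul_comm]
  exact (ENNReal.div_le_iff_le_mul (by simp) (by simp)).1 this

/-- A maximal inequality. On the set `E N` of points with stopping time at most `N`, integrating
`sum_indicator_le` gives `m ∫_{E N} a ≤ (m + N) rate`; let `m → ∞`, then `N → ∞`. -/
lemma lintegral_le_rate_of_forall_exists (hh : IsSuperadditive f h)
    (hf : MeasurePreserving f μ μ) (hm : ∀ n, Measurable (h n)) {a : X → ℝ≥0∞}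
    (hma : Measurable a) (ha : ∀ x, a (f x) ≤ a x)
    (hex : ∀ x, ∃ j : ℕ, 1 ≤ j ∧ j * a x ≤ h j x) :
    ∫⁻ x, a x ∂μ ≤ rate μ h := by
  set E : ℕ → Set X := fun N ↦ ⋃ j ∈ Finset.Icc 1 N, {x | (j : ℝ≥0∞) * a x ≤ h j x} with hEdef
  have hE : ∀ N, ∀ x ∈ E N, ∃ j, 1 ≤ j ∧ j ≤ N ∧ j * a x ≤ h j x := by
    intro N x hx
    simp only [hEdef, Set.mem_iUnion, Finset.mem_Icc, Set.mem_ofPred_eq] at hx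
    obtain ⟨j, hj, hjx⟩ := hx
    exact ⟨j, hj.1, hj.2, hjx⟩
  have hEm : ∀ N, MeasurableSet (E N) := fun N ↦
    Finset.measurableSet_biUnion _ fun j _ ↦ measurableSet_le (hma.const_mul _) (hm j)
  have hmono : Monotone E := by
    intro N M hNM
    exact Set.biUnion_subset_biUnion_left
      fun j hj ↦ Finset.mem_coe.2 (Finset.Icc_subset_Icc_right hNM hj)
  have hstep : ∀ N, ∫⁻ x, (E N).indicator a x ∂μ ≤ rate μ h := by
    intro N
    have hmi : Measurable ((E N).indicator a) := hma.indicator (hEm N)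
    have key : ∀ m : ℕ, 0 < m →
        (∫⁻ x, (E N).indicator a x ∂μ) * (m / ((m + N : ℕ) : ℝ≥0∞)) ≤ rate μ h := by
      intro m hmpos
      have h1 : ∫⁻ x, ∑ j ∈ Finset.range m, (E N).indicator a (f^[j] x) ∂μ
          ≤ ((m + N : ℕ) : ℝ≥0∞) * rate μ h := by
        refine le_trans (lintegral_mono fun x ↦ ?_)
          (lintegral_le_mul_rate (h := h) (m + N) (by omega))
        have := hh.sum_indicator_le ha (hE N) (m + N) x
        rwa [Nat.add_sub_cancel] at this
      rw [hf.lintegral_sum_range hmi] at h1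
      rw [← mul_div_assoc, mul_comm]
      exact (ENNReal.div_le_iff_le_mul (by simp; omega) (by simp)).2 (by rwa [mul_comm (rate μ h)])
    have hlim : Tendsto (fun m : ℕ ↦
        (∫⁻ x, (E N).indicator a x ∂μ) * (m / ((m + N : ℕ) : ℝ≥0∞))) atTop
        (𝓝 ((∫⁻ x, (E N).indicator a x ∂μ) * 1)) :=
      ENNReal.Tendsto.const_mul (ENNReal.tendsto_natCast_div_natCast_add N) (.inl one_ne_zero)
    rw [mul_one] at hlim
    exact le_of_tendsto hlim ((eventually_gt_atTop 0).mono key)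
  have hsup : ∀ x, ⨆ N, (E N).indicator a x = a x := by
    intro x
    apply le_antisymm (iSup_le fun N ↦ Set.indicator_le_self _ _ _)
    obtain ⟨j, hj1, hj⟩ := hex x
    refine le_iSup_of_le j ?_
    rw [Set.indicator_of_mem]
    exact Set.mem_biUnion (x := j) (by simpa using hj1) hj
  calc ∫⁻ x, a x ∂μ = ∫⁻ x, ⨆ N, (E N).indicator a x ∂μ := by simp_rw [hsup]
    _ = ⨆ N, ∫⁻ x, (E N).indicator a x ∂μ :=
      lintegral_iSup (fun N ↦ hma.indicator (hEm N)) fun N M hNM x ↦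
        Set.indicator_le_indicator_of_subset (hmono hNM) (fun _ ↦ zero_le) x
    _ ≤ rate μ h := iSup_le hstep

/-- Apply the maximal inequality to `c * min limsup M` with `c < 1`. Finiteness and `c < 1` make
this strictly smaller than the limsup where it is nonzero, so some average exceeds it. -/
lemma lintegral_limsup_le_rate (hh : IsSuperadditive f h)
    (hf : MeasurePreserving f μ μ) (hm : ∀ n, Measurable (h n)) :
    ∫⁻ x, limsup (fun n ↦ h n x / n) atTop ∂μ ≤ rate μ h := by
  set hs : X → ℝ≥0∞ := fun x ↦ limsup (fun n ↦ h n x / n) atTop with hhs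
  have hms : Measurable hs := .limsup fun n ↦ (hm n).div_const _
  have h1 : ∀ (M : ℕ) (c : ℝ≥0∞), c < 1 → ∫⁻ x, c * min (hs x) M ∂μ ≤ rate μ h := by
    intro M c hc
    refine hh.lintegral_le_rate_of_forall_exists hf hm
      ((hms.min measurable_const).const_mul c)
      (fun x ↦ by gcongr; exact hh.limsup_comp_le x) fun x ↦ ?_
    rcases eq_or_ne (min (hs x) M) 0 with h0 | h0
    · exact ⟨1, le_rfl, by simp [h0]⟩
    have hlt : c * min (hs x) M < hs x := by
      have hfin : min (hs x) M ≠ ⊤ := ne_top_of_le_ne_top (by simp) (min_le_right _ _)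
      calc c * min (hs x) M < 1 * min (hs x) M := by
            exact (ENNReal.mul_lt_mul_iff_left h0 hfin).2 hc
        _ ≤ hs x := by rw [one_mul]; exact min_le_left _ _
    have hfreq := frequently_lt_of_lt_limsup (by isBoundedDefault) hlt
    obtain ⟨j, hj, hj1⟩ := (hfreq.and_eventually (eventually_ge_atTop 1)).exists
    refine ⟨j, hj1, ?_⟩
    rw [mul_comm]
    exact (ENNReal.le_div_iff_mul_le (by simp; omega) (by simp)).1 hj.le
  have h2 : ∀ M : ℕ, ∫⁻ x, min (hs x) M ∂μ ≤ rate μ h := by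
    intro M
    have h3 : ∀ c < (1 : ℝ≥0∞), c * ∫⁻ x, min (hs x) M ∂μ ≤ rate μ h := fun c hc ↦ by
      rw [← lintegral_const_mul _ (hms.min measurable_const)]
      exact h1 M c hc
    have hlim := ENNReal.Tendsto.mul_const (b := ∫⁻ x, min (hs x) M ∂μ)
      (ENNReal.tendsto_natCast_div_natCast_add 1) (.inl one_ne_zero)
    rw [one_mul] at hlim
    refine le_of_tendsto' hlim fun m ↦ h3 _ ?_
    rw [ENNReal.div_lt_iff (by simp) (by simp), one_mul]
    exact_mod_cast Nat.lt_succ_self m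
  calc ∫⁻ x, hs x ∂μ = ∫⁻ x, ⨆ M : ℕ, min (hs x) M ∂μ := by
        congr 1
        ext x
        rw [← inf_iSup_eq, ENNReal.iSup_natCast, inf_top_eq]
    _ = ⨆ M : ℕ, ∫⁻ x, min (hs x) M ∂μ :=
      lintegral_iSup (fun M ↦ hms.min measurable_const) fun M N hMN x ↦ by
        dsimp only; gcongr
    _ ≤ rate μ h := iSup_le h2

/-- Apply the bound on the limsup to the Birkhoff sums of `C - w`; boundedness is what lets the
subtraction exchange limsup and liminf. -/
lemma lintegral_le_lintegral_liminf_birkhoffSum_of_le [IsProbabilityMeasure μ]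
    (hf : MeasurePreserving f μ μ)
    {w : X → ℝ≥0∞} (hw : Measurable w) {C : ℕ} (hC : ∀ x, w x ≤ C) :
    ∫⁻ x, w x ∂μ ≤ ∫⁻ x, liminf (fun n ↦ birkhoffSum f w n x / n) atTop ∂μ := by
  have hmw : ∀ n, Measurable (birkhoffSum f w n) := fun n ↦
    Finset.measurable_sum _ fun j _ ↦ hw.comp (hf.iterate j).measurable
  set g : X → ℝ≥0∞ := fun x ↦ C - w x with hg
  have hmg : Measurable g := measurable_const.sub hw
  have hmG : ∀ n, Measurable (birkhoffSum f g n) := fun n ↦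
    Finset.measurable_sum _ fun j _ ↦ hmg.comp (hf.iterate j).measurable
  have hsup : IsSuperadditive f (birkhoffSum f g) := fun m n x ↦ (birkhoffSum_add f g m n x).ge
  have hadd : ∀ n x, birkhoffSum f g n x + birkhoffSum f w n x = n * C := by
    intro n x
    simp only [birkhoffSum, ← Finset.sum_add_distrib, hg]
    simp [tsub_add_cancel_of_le (hC _)]
  have hrate : rate μ (birkhoffSum f g) = ∫⁻ x, g x ∂μ := by
    have : ∀ n : ℕ, ∫⁻ x, birkhoffSum f g (n + 1) x ∂μ = ((n + 1 : ℕ) : ℝ≥0∞) * ∫⁻ x, g x ∂μ := by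
      exact fun n ↦ hf.lintegral_sum_range hmg (n + 1)
    simp only [rate, this]
    have : ∀ n : ℕ, ((n + 1 : ℕ) : ℝ≥0∞) * (∫⁻ x, g x ∂μ) / ((n + 1 : ℕ) : ℝ≥0∞)
        = ∫⁻ x, g x ∂μ := fun n ↦ ENNReal.natCast_mul_div_cancel_left n.succ_pos
    simp only [this, ciSup_const]
  have hwn : ∀ n x, birkhoffSum f w n x ≤ n * C := fun n x ↦ (hadd n x) ▸ le_add_self
  have hle := hsup.lintegral_limsup_le_rate hf hmG
  rw [hrate] at hle
  have hls : ∀ x, limsup (fun n ↦ birkhoffSum f g n x / n) atTop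
      = C - liminf (fun n ↦ birkhoffSum f w n x / n) atTop := by
    intro x
    rw [← ENNReal.limsup_const_sub _ _ (ENNReal.natCast_ne_top C)]
    refine limsup_congr ?_
    filter_upwards [eventually_gt_atTop 0] with n hn
    have hfin : birkhoffSum f w n x ≠ ⊤ := ne_top_of_le_ne_top (by finiteness) (hwn n x)
    rw [ENNReal.eq_sub_of_add_eq hfin (hadd n x), ENNReal.sub_div (by simp; omega)]
    rw [ENNReal.natCast_mul_div_cancel_left hn]
  have hli : ∀ x, liminf (fun n ↦ birkhoffSum f w n x / n) atTop ≤ C := fun x ↦ by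
    refine le_trans liminf_le_limsup (limsup_le_of_le (h := ?_))
    filter_upwards [eventually_gt_atTop 0] with n hn
    exact ENNReal.div_le_of_le_mul' (hwn n x)
  simp only [hls] at hle
  have hml : Measurable fun x ↦ liminf (fun n ↦ birkhoffSum f w n x / n) atTop :=
    .liminf fun n ↦ (hmw n).div_const _
  have e1 : ∫⁻ x, g x ∂μ + ∫⁻ x, w x ∂μ = C := by
    rw [← lintegral_add_left hmg]
    simp [hg, tsub_add_cancel_of_le (hC _)]
  have e2 : ∫⁻ x, (C - liminf (fun n ↦ birkhoffSum f w n x / n) atTop) ∂μ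
      + ∫⁻ x, liminf (fun n ↦ birkhoffSum f w n x / n) atTop ∂μ = C := by
    rw [← lintegral_add_right _ hml]
    simp [tsub_add_cancel_of_le (hli _)]
  have hfin : ∫⁻ x, g x ∂μ ≠ ⊤ := ne_top_of_le_ne_top (ENNReal.natCast_ne_top C) (e1 ▸ le_self_add)
  by_contra! hcon
  have : ∫⁻ x, (C - liminf (fun n ↦ birkhoffSum f w n x / n) atTop) ∂μ
      + ∫⁻ x, liminf (fun n ↦ birkhoffSum f w n x / n) atTop ∂μ <
      ∫⁻ x, g x ∂μ + ∫⁻ x, w x ∂μ := ENNReal.add_lt_add_of_le_of_lt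
        (ne_top_of_le_ne_top hfin hle) hle hcon
  rw [e1, e2] at this
  exact lt_irrefl _ this

lemma lintegral_le_lintegral_liminf_birkhoffSum [IsProbabilityMeasure μ]
    (hf : MeasurePreserving f μ μ)
    {w : X → ℝ≥0∞} (hw : Measurable w) :
    ∫⁻ x, w x ∂μ ≤ ∫⁻ x, liminf (fun n ↦ birkhoffSum f w n x / n) atTop ∂μ := by
  calc ∫⁻ x, w x ∂μ = ∫⁻ x, ⨆ M : ℕ, min (w x) M ∂μ := by
        congr 1
        ext x
        rw [← inf_iSup_eq, ENNReal.iSup_natCast, inf_top_eq]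
    _ = ⨆ M : ℕ, ∫⁻ x, min (w x) M ∂μ :=
      lintegral_iSup (fun M ↦ hw.min measurable_const) fun M N hMN x ↦ by
        dsimp only; gcongr
    _ ≤ _ := iSup_le fun M ↦ by
      refine (lintegral_le_lintegral_liminf_birkhoffSum_of_le hf
        (hw.min measurable_const) (C := M) fun x ↦ min_le_right _ _).trans
        (lintegral_mono fun x ↦ liminf_le_liminf (.of_forall fun n ↦ ?_))
      refine ENNReal.div_le_div_right (Finset.sum_le_sum fun j _ ↦ min_le_left _ _) _

/-- For fixed `N`, `sum_block_le` bounds the Birkhoff sums of `h N` by `N` times `h (m + N)`, one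
copy per residue class. Dividing by `m` reduces the claim to the additive case. -/
lemma rate_le_lintegral_liminf [IsProbabilityMeasure μ] (hh : IsSuperadditive f h)
    (hf : MeasurePreserving f μ μ) (hm : ∀ n, Measurable (h n)) :
    rate μ h ≤ ∫⁻ x, liminf (fun n ↦ h n x / n) atTop ∂μ := by
  refine iSup_le fun n ↦ ?_
  set N := n + 1 with hN
  have hN0 : (N : ℝ≥0∞) ≠ 0 := by simp [hN]
  refine ENNReal.div_le_of_le_mul' ?_
  have hml : Measurable fun x ↦ liminf (fun n ↦ h n x / n) atTop :=
    .liminf fun n ↦ (hm n).div_const _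
  rw [← lintegral_const_mul _ hml]
  refine (lintegral_le_lintegral_liminf_birkhoffSum hf (hm N)).trans (lintegral_mono fun x ↦ ?_)
  have hb : ∀ m, birkhoffSum f (h N) m x ≤ N * h (m + N) x := by
    intro m
    refine (hh.sum_block_le (by omega) m x).trans ?_
    calc ∑ r ∈ Finset.range N, h (m + N - r) (f^[r] x)
        ≤ ∑ r ∈ Finset.range N, h (m + N) x := by
          refine Finset.sum_le_sum fun r hr ↦ ?_
          have := hh.comp_iterate_le (m + N - r) r x
          rwa [Nat.sub_add_cancel (by have := Finset.mem_range.1 hr; omega)] at this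
      _ = N * h (m + N) x := by simp
  refine (ENNReal.liminf_div_le_of_le_add (v := fun n ↦ N * h n x) (N := N) hb).trans ?_
  simp only [mul_div_assoc]
  rw [ENNReal.liminf_const_mul_of_ne_top (ENNReal.natCast_ne_top N)]

/-- The superadditive ergodic theorem for nonnegative functions. -/
theorem exists_tendsto [IsProbabilityMeasure μ] (hh : IsSuperadditive f h)
    (hf : MeasurePreserving f μ μ) (hm : ∀ n, Measurable (h n)) :
    ∃ H : X → ℝ≥0∞, Measurable H ∧ (∀ᵐ x ∂μ, Tendsto (fun n ↦ h n x / n) atTop (𝓝 (H x))) ∧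
      ∫⁻ x, H x ∂μ = rate μ h := by
  have hmi : Measurable fun x ↦ liminf (fun n ↦ h n x / n) atTop :=
    .liminf fun n ↦ (hm n).div_const _
  have hms : Measurable fun x ↦ limsup (fun n ↦ h n x / n) atTop :=
    .limsup fun n ↦ (hm n).div_const _
  have hle : ∀ x, liminf (fun n ↦ h n x / n) atTop ≤ limsup (fun n ↦ h n x / n) atTop :=
    fun x ↦ liminf_le_limsup
  refine ⟨fun x ↦ liminf (fun n ↦ h n x / n) atTop, hmi, ?_,
    le_antisymm ((lintegral_mono hle).trans (hh.lintegral_limsup_le_rate hf hm))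
      (hh.rate_le_lintegral_liminf hf hm)⟩
  -- The rate may be infinite, so equality of the integrals of liminf and limsup proves nothing
  -- directly. For the truncated process both integrals are finite, and the truncations are
  -- recombined by a supremum over `M`.
  have key : ∀ M : ℕ, ∀ᵐ x ∂μ, min (liminf (fun n ↦ h n x / n) atTop) M
      = min (limsup (fun n ↦ h n x / n) atTop) M := by
    intro M
    have hmono : Monotone fun t : ℝ≥0∞ ↦ min t M := fun _ _ h ↦ min_le_min_right _ h
    have hcont : Continuous fun t : ℝ≥0∞ ↦ min t M := by fun_prop
    have heq : ∀ x, (fun n : ℕ ↦ min (h n x) (n * M) / (n : ℝ≥0∞)) =ᶠ[atTop]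
        ((fun t ↦ min t (M : ℝ≥0∞)) ∘ fun n ↦ h n x / n) := by
      intro x
      filter_upwards [eventually_gt_atTop 0] with n hn
      have hdiv : Monotone fun t : ℝ≥0∞ ↦ t / n := fun _ _ h ↦ ENNReal.div_le_div_right h _
      rw [Function.comp_apply, hdiv.map_min]
      rw [ENNReal.natCast_mul_div_cancel_left hn]
    have e1 : ∀ x, limsup (fun n : ℕ ↦ min (h n x) (n * M) / (n : ℝ≥0∞)) atTop
        = min (limsup (fun n ↦ h n x / n) atTop) M := fun x ↦ by
      rw [limsup_congr (heq x)]
      exact (hmono.map_limsup_of_continuousAt _ hcont.continuousAt).symm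
    have e2 : ∀ x, liminf (fun n : ℕ ↦ min (h n x) (n * M) / (n : ℝ≥0∞)) atTop
        = min (liminf (fun n ↦ h n x / n) atTop) M := fun x ↦ by
      rw [liminf_congr (heq x)]
      exact (hmono.map_liminf_of_continuousAt _ hcont.continuousAt).symm
    have hm' : ∀ n : ℕ, Measurable fun x ↦ min (h n x) (n * M) :=
      fun n ↦ (hm n).min measurable_const
    have h1 := (hh.min_natCast_mul M).lintegral_limsup_le_rate hf hm'
    have h2 := (hh.min_natCast_mul M).rate_le_lintegral_liminf hf hm'
    simp only [e1] at h1
    simp only [e2] at h2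
    refine ae_eq_of_ae_le_of_lintegral_le (.of_forall fun x ↦ hmono (hle x)) ?_
      (hms.min measurable_const).aemeasurable (h1.trans h2)
    refine ne_top_of_le_ne_top (ENNReal.natCast_ne_top M) ?_
    calc _ ≤ ∫⁻ _, (M : ℝ≥0∞) ∂μ := lintegral_mono fun x ↦ min_le_right _ _
      _ = M := by simp
  filter_upwards [ae_all_iff.2 key] with x hx
  have : limsup (fun n ↦ h n x / n) atTop = liminf (fun n ↦ h n x / n) atTop := by
    calc limsup (fun n ↦ h n x / n) atTop
        = ⨆ M : ℕ, min (limsup (fun n ↦ h n x / n) atTop) M := by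
          rw [← inf_iSup_eq, ENNReal.iSup_natCast, inf_top_eq]
      _ = ⨆ M : ℕ, min (liminf (fun n ↦ h n x / n) atTop) M := by simp_rw [hx]
      _ = _ := by rw [← inf_iSup_eq, ENNReal.iSup_natCast, inf_top_eq]
  exact tendsto_of_liminf_eq_limsup rfl this

end IsSuperadditive

end SuperadditiveErgodic

/-! ### Exterior powers, volumes and singular values. -/

section WedgeNorm

open Module exteriorPower

variable {V : Type*} [NormedAddCommGroup V] [InnerProductSpace ℝ V] [FiniteDimensional ℝ V]
  {V' : Type*} [NormedAddCommGroup V'] [InnerProductSpace ℝ V'] [FiniteDimensional ℝ V']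
  {V'' : Type*} [NormedAddCommGroup V''] [InnerProductSpace ℝ V''] [FiniteDimensional ℝ V'']
  {k : ℕ}

/-- The `k`-dimensional volume of the parallelepiped spanned by `k` vectors. -/
noncomputable def wedgeVolume (v : Fin k → V) : ℝ := ‖ιMulti ℝ k v‖

lemma wedgeVolume_nonneg (v : Fin k → V) : 0 ≤ wedgeVolume v := norm_nonneg _

lemma wedgeVolume_sq (v : Fin k → V) : wedgeVolume v ^ 2 = (Matrix.gram ℝ v).det := by
  rw [wedgeVolume, ← real_inner_self_eq_norm_sq, inner_ιMulti_self]

lemma wedgeVolume_eq_sqrt (v : Fin k → V) : wedgeVolume v = √(Matrix.gram ℝ v).det := by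
  rw [← wedgeVolume_sq, Real.sqrt_sq (wedgeVolume_nonneg v)]

lemma wedgeVolume_congr {v : Fin k → V} {w : Fin k → V'}
    (h : ∀ i j, inner ℝ (v i) (v j) = inner ℝ (w i) (w j)) : wedgeVolume v = wedgeVolume w := by
  rw [wedgeVolume_eq_sqrt, wedgeVolume_eq_sqrt]
  congr 2
  ext i j
  exact h i j

lemma Orthonormal.wedgeVolume_eq_one {v : Fin k → V} (hv : Orthonormal ℝ v) :
    wedgeVolume v = 1 := by
  rw [wedgeVolume_eq_sqrt, Matrix.gram_eq_one_iff_orthonormal.2 hv, Matrix.det_one, Real.sqrt_one]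

lemma wedgeVolume_ne_zero_iff {v : Fin k → V} : wedgeVolume v ≠ 0 ↔ LinearIndependent ℝ v := by
  rw [← Matrix.det_gram_ne_zero_iff_linearIndependent (𝕜 := ℝ), ← wedgeVolume_sq]
  simp

lemma wedgeVolume_pos_iff {v : Fin k → V} : 0 < wedgeVolume v ↔ LinearIndependent ℝ v := by
  rw [← wedgeVolume_ne_zero_iff, (wedgeVolume_nonneg v).lt_iff_ne']

lemma wedgeNorm_nonneg (k : ℕ) (L : V →ₗ[ℝ] V') : 0 ≤ wedgeNorm k L := by
  rw [wedgeNorm]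
  exact norm_nonneg (exteriorPower.map k L).toContinuousLinearMap

lemma wedgeVolume_comp_le (L : V →ₗ[ℝ] V') (v : Fin k → V) :
    wedgeVolume (L ∘ v) ≤ wedgeNorm k L * wedgeVolume v := by
  have := (exteriorPower.map k L).toContinuousLinearMap.le_opNorm (ιMulti ℝ k v)
  rw [LinearMap.coe_toContinuousLinearMap', map_apply_ιMulti] at this
  exact this

lemma wedgeNorm_comp_le (k : ℕ) (L' : V' →ₗ[ℝ] V'') (L : V →ₗ[ℝ] V') :
    wedgeNorm k (L' ∘ₗ L) ≤ wedgeNorm k L' * wedgeNorm k L := by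
  have := (exteriorPower.map k L').toContinuousLinearMap.opNorm_comp_le
    (exteriorPower.map k L).toContinuousLinearMap
  rw [wedgeNorm, map_comp]
  exact this

lemma Fin.le_val_of_strictMono {n : ℕ} {s : Fin k → Fin n} (hs : StrictMono s) (j : Fin k) :
    (j : ℕ) ≤ s j := by
  obtain ⟨j, hj⟩ := j
  induction j with
  | zero => exact Nat.zero_le _
  | succ j ih =>
    have h1 := ih (by omega)
    have h2 : s ⟨j, by omega⟩ < s ⟨j + 1, hj⟩ := hs (by simp)
    simp only at h1 ⊢
    omega

/-- An orthonormal basis of right singular vectors. -/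
lemma LinearMap.exists_orthonormalBasis_inner_eq {n : ℕ} (hn : finrank ℝ V = n)
    (L : V →ₗ[ℝ] V') : ∃ b : OrthonormalBasis (Fin n) ℝ V, ∀ i j,
      inner ℝ (L (b i)) (L (b j)) = if i = j then L.singularValues i ^ 2 else 0 := by
  refine ⟨L.isSymmetric_adjoint_comp_self.eigenvectorBasis hn, fun i j ↦ ?_⟩
  rw [← LinearMap.adjoint_inner_right, ← LinearMap.comp_apply,
    LinearMap.IsSymmetric.apply_eigenvectorBasis, inner_smul_right,
    OrthonormalBasis.inner_eq_ite]
  split_ifs with h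
  · subst h
    simp [L.sq_singularValues_fin hn]
  · simp

/-- If an index of one set is missing from the other, the mixed Gram matrix has a zero row; for
equal sets it is diagonal. -/
lemma inner_ιMulti_comp_eq {U : Type*} [AddCommGroup U] [Module ℝ U] {n : ℕ}
    {L : U →ₗ[ℝ] V'} {b : Fin n → U} {σ : ℕ → ℝ}
    (hb : ∀ i j, inner ℝ (L (b i)) (L (b j)) = if i = j then σ i ^ 2 else 0)
    (S T : Set.powersetCard (Fin n) k) :
    inner ℝ (ιMulti_family ℝ k (L ∘ b) S) (ιMulti_family ℝ k (L ∘ b) T) =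
      if S = T then (∏ j : Fin k, σ (Set.powersetCard.ofFinEmbEquiv.symm S j)) ^ 2 else 0 := by
  simp only [ιMulti_family]
  rw [inner_ιMulti_ιMulti]
  split_ifs with h
  · subst h
    rw [show (Matrix.of fun i j ↦ inner ℝ
        (((L ∘ b) ∘ (Set.powersetCard.ofFinEmbEquiv.symm S)) j)
        (((L ∘ b) ∘ (Set.powersetCard.ofFinEmbEquiv.symm S)) i)) =
        Matrix.diagonal fun j ↦ σ (Set.powersetCard.ofFinEmbEquiv.symm S j) ^ 2 by
      ext i j
      simp only [Matrix.of_apply, Function.comp_apply, hb, Matrix.diagonal_apply,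
        EmbeddingLike.apply_eq_iff_eq, eq_comm (a := j)]
      split_ifs with hij <;> simp_all]
    rw [Matrix.det_diagonal, Finset.prod_pow]
  · obtain ⟨x, hxt, hxs⟩ := (Set.powersetCard.exists_mem_notMem_iff_ne T S).mp (.symm h)
    simp only [Set.mem_range, not_exists,
      ← Set.powersetCard.mem_range_ofFinEmbEquiv_symm_iff_mem] at hxs hxt
    obtain ⟨i, rfl⟩ := hxt
    refine Matrix.det_eq_zero_of_row_eq_zero i fun j ↦ ?_
    simp only [Matrix.of_apply, Function.comp_apply, hb]
    rw [if_neg (hxs j)]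

/-- In the basis of `k`-vectors built from right singular vectors, the images are orthogonal with
lengths the products of `k` singular values. The largest product uses the first `k`, because the
`j`-th member of an increasing index family is at least `j`. -/
lemma wedgeNorm_le_prod_singularValues (k : ℕ) (L : V →ₗ[ℝ] V') :
    wedgeNorm k L ≤ ∏ i ∈ Finset.range k, L.singularValues i := by
  obtain ⟨b, hb⟩ := L.exists_orthonormalBasis_inner_eq rfl
  set B := b.exteriorPower k with hB
  have hBS : ∀ S, B S = ιMulti_family ℝ k b S := fun S ↦ by
    rw [hB, ← OrthonormalBasis.coe_toBasis, OrthonormalBasis.toBasis_exteriorPower,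
      exteriorPower.coe_basis, OrthonormalBasis.coe_toBasis]
  have hpos : 0 ≤ ∏ i ∈ Finset.range k, L.singularValues i :=
    Finset.prod_nonneg fun i _ ↦ L.singularValues_nonneg i
  refine ContinuousLinearMap.opNorm_le_bound _ hpos fun x ↦ ?_
  refine le_of_sq_le_sq ?_ (mul_nonneg hpos (norm_nonneg x))
  rw [mul_pow, LinearMap.coe_toContinuousLinearMap', ← real_inner_self_eq_norm_sq]
  have hx : exteriorPower.map k L x = ∑ S, B.repr x S • ιMulti_family ℝ k (L ∘ b) S := by
    conv_lhs => rw [← B.sum_repr x]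
    rw [map_sum]
    refine Finset.sum_congr rfl fun S _ ↦ ?_
    rw [map_smul, hBS, map_apply_ιMulti_family]
  have hnx : ‖x‖ ^ 2 = ∑ S, B.repr x S ^ 2 := by
    rw [← B.sum_sq_norm_inner_right x]
    refine Finset.sum_congr rfl fun S _ ↦ ?_
    rw [← B.repr_apply_apply, Real.norm_eq_abs, sq_abs]
  rw [hx, hnx, sum_inner, Finset.mul_sum]
  refine Finset.sum_le_sum fun S _ ↦ ?_
  rw [inner_sum]
  simp only [inner_smul_left, inner_smul_right, inner_ιMulti_comp_eq hb]
  simp only [mul_ite, mul_zero, Finset.sum_ite_eq, Finset.mem_univ, if_true]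
  have hle : (∏ j : Fin k, L.singularValues (Set.powersetCard.ofFinEmbEquiv.symm S j))
      ≤ ∏ i ∈ Finset.range k, L.singularValues i := by
    rw [Finset.prod_range]
    refine Finset.prod_le_prod (fun j _ ↦ L.singularValues_nonneg _) fun j _ ↦ ?_
    exact L.singularValues_antitone
      (Fin.le_val_of_strictMono (Set.powersetCard.ofFinEmbEquiv.symm S).strictMono j)
  have hsq := pow_le_pow_left₀ (Finset.prod_nonneg fun j _ ↦ L.singularValues_nonneg
    (Set.powersetCard.ofFinEmbEquiv.symm S j)) hle 2
  calc _ = B.repr x S ^ 2 * (∏ j : Fin k, L.singularValues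
        (Set.powersetCard.ofFinEmbEquiv.symm S j)) ^ 2 := by
        simp only [conj_trivial]; ring
    _ ≤ B.repr x S ^ 2 * (∏ i ∈ Finset.range k, L.singularValues i) ^ 2 := by gcongr
    _ = _ := by ring

/-- The first `k` right singular vectors do this. -/
lemma exists_orthonormal_wedgeVolume_comp_eq (hk : k ≤ finrank ℝ V) (L : V →ₗ[ℝ] V') :
    ∃ v : Fin k → V, Orthonormal ℝ v ∧
      wedgeVolume (L ∘ v) = ∏ i ∈ Finset.range k, L.singularValues i := by
  obtain ⟨b, hb⟩ := L.exists_orthonormalBasis_inner_eq rfl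
  have hinj : Function.Injective (Fin.castLE hk) := Fin.castLE_injective hk
  refine ⟨b ∘ Fin.castLE hk, b.orthonormal.comp _ hinj, ?_⟩
  refine (pow_left_inj₀ (wedgeVolume_nonneg _)
    (Finset.prod_nonneg fun i _ ↦ L.singularValues_nonneg i) two_ne_zero).1 ?_
  · rw [wedgeVolume_sq, show Matrix.gram ℝ (L ∘ b ∘ Fin.castLE hk) =
        Matrix.diagonal fun j : Fin k ↦ L.singularValues j ^ 2 by
      ext i j
      simp only [Matrix.gram_apply, Function.comp_apply, hb, Matrix.diagonal_apply, hinj.eq_iff]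
      rfl]
    rw [Matrix.det_diagonal, Finset.prod_range, Finset.prod_pow]

lemma wedgeNorm_eq_prod_singularValues (hk : k ≤ finrank ℝ V) (L : V →ₗ[ℝ] V') :
    wedgeNorm k L = ∏ i ∈ Finset.range k, L.singularValues i := by
  refine le_antisymm (wedgeNorm_le_prod_singularValues k L) ?_
  obtain ⟨v, hv, hvL⟩ := exists_orthonormal_wedgeVolume_comp_eq hk L
  rw [← hvL]
  simpa [hv.wedgeVolume_eq_one] using wedgeVolume_comp_le L v

lemma singularValues_le_opNorm (L : V →L[ℝ] V') (i : ℕ) :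
    (L : V →ₗ[ℝ] V').singularValues i ≤ ‖L‖ := by
  rcases lt_or_ge i (finrank ℝ V) with hi | hi
  · obtain ⟨b, hb⟩ := (L : V →ₗ[ℝ] V').exists_orthonormalBasis_inner_eq rfl
    have h1 := hb ⟨i, hi⟩ ⟨i, hi⟩
    rw [if_pos rfl, real_inner_self_eq_norm_sq] at h1
    have h2 := L.le_opNorm (b ⟨i, hi⟩)
    rw [b.norm_eq_one, mul_one] at h2
    refine le_of_eq_of_le ?_ h2
    exact ((pow_left_inj₀ (norm_nonneg _) (LinearMap.singularValues_nonneg _ _)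
      two_ne_zero).1 h1).symm
  · rw [LinearMap.singularValues_of_finrank_le _ hi]
    exact norm_nonneg _

lemma wedgeNorm_le_opNorm_pow (k : ℕ) (L : V →L[ℝ] V') :
    wedgeNorm k (L : V →ₗ[ℝ] V') ≤ ‖L‖ ^ k := by
  refine (wedgeNorm_le_prod_singularValues k _).trans ?_
  calc ∏ i ∈ Finset.range k, (L : V →ₗ[ℝ] V').singularValues i
      ≤ ∏ _i ∈ Finset.range k, ‖L‖ := Finset.prod_le_prod
        (fun i _ ↦ LinearMap.singularValues_nonneg _ i) fun i _ ↦ singularValues_le_opNorm L i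
    _ = ‖L‖ ^ k := by simp

/-- A `k`-tuple in the span of a `k`-frame has a proportional exterior product. -/
lemma exists_ιMulti_eq_smul {U : Type*} [AddCommGroup U] [Module ℝ U] {v w : Fin k → U}
    (h : ∀ i, v i ∈ Submodule.span ℝ (Set.range w)) : ∃ c : ℝ, ιMulti ℝ k v = c • ιMulti ℝ k w := by
  -- Both tuples are pulled back to `ℝ^k`, whose `k`-th exterior power is a line; `w` need not be
  -- independent.
  let e : OrthonormalBasis (Fin k) ℝ (EuclideanSpace ℝ (Fin k)) := EuclideanSpace.basisFun _ ℝ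
  let g : EuclideanSpace ℝ (Fin k) →ₗ[ℝ] U := e.toBasis.constr ℝ w
  have hge : g ∘ e = w := by
    ext i
    rw [← e.coe_toBasis]
    exact e.toBasis.constr_basis ℝ w i
  have hr : ∀ i, ∃ r, g r = v i := by
    intro i
    have : Submodule.span ℝ (Set.range w) = LinearMap.range g := by
      rw [e.toBasis.constr_range]
    have h1 := h i
    rw [this] at h1
    exact h1
  choose r hr using hr
  have hgr : g ∘ r = v := funext hr
  have h1 : finrank ℝ (⋀[ℝ]^k (EuclideanSpace ℝ (Fin k))) = 1 := by
    rw [exteriorPower.finrank_eq]; simp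
  have hne : ιMulti ℝ k e ≠ 0 := by
    have := e.orthonormal.wedgeVolume_eq_one
    rw [wedgeVolume] at this
    intro h0
    rw [h0, norm_zero] at this
    exact zero_ne_one this
  obtain ⟨c, hc⟩ := (finrank_eq_one_iff_of_nonzero' _ hne).1 h1 (ιMulti ℝ k r)
  refine ⟨c, ?_⟩
  rw [← hgr, ← hge, ← map_apply_ιMulti, ← map_apply_ιMulti, ← hc, map_smul]

/-- Change of frame: volumes of images scale by the ratio of volumes. -/
lemma wedgeVolume_comp_mul {v w : Fin k → V}
    (h : ∀ i, v i ∈ Submodule.span ℝ (Set.range w)) (L : V →ₗ[ℝ] V') :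
    wedgeVolume (L ∘ v) * wedgeVolume w = wedgeVolume (L ∘ w) * wedgeVolume v := by
  obtain ⟨c, hc⟩ := exists_ιMulti_eq_smul h
  simp only [wedgeVolume, ← map_apply_ιMulti]
  rw [hc, map_smul, norm_smul, norm_smul]
  ring

/-- The `k`-th exterior power of a `k`-dimensional space is a line, so the operator norm is the
ratio of norms at any nonzero vector. -/
lemma jacobian_mul_wedgeVolume (L : V →ₗ[ℝ] V') {v : Fin k → V} (hv : LinearIndependent ℝ v) :
    jacobian k L (Submodule.span ℝ (Set.range v)) * wedgeVolume v = wedgeVolume (L ∘ v) := by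
  set W := Submodule.span ℝ (Set.range v) with hW
  let v' : Fin k → W := fun i ↦ ⟨v i, Submodule.subset_span (Set.mem_range_self i)⟩
  have hvol : wedgeVolume v' = wedgeVolume v := wedgeVolume_congr fun i j ↦ rfl
  have hLv : (L.domRestrict W) ∘ v' = L ∘ v := rfl
  have hfr : finrank ℝ W = k := by simpa using finrank_span_eq_card hv
  have h1 : finrank ℝ (⋀[ℝ]^k W) = 1 := by
    rw [exteriorPower.finrank_eq, hfr, Nat.choose_self]
  have hpos : 0 < wedgeVolume v' := by rw [hvol]; exact wedgeVolume_pos_iff.2 hv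
  have hne : ιMulti ℝ k v' ≠ 0 := norm_pos_iff.1 hpos
  rw [← hvol, ← hLv]
  refine le_antisymm ?_ (wedgeVolume_comp_le _ _)
  rw [← le_div_iff₀ hpos]
  refine ContinuousLinearMap.opNorm_le_bound _
    (div_nonneg (wedgeVolume_nonneg _) (wedgeVolume_nonneg _)) fun x ↦ ?_
  obtain ⟨c, hc⟩ := (finrank_eq_one_iff_of_nonzero' _ hne).1 h1 x
  rw [← hc, LinearMap.coe_toContinuousLinearMap', map_smul, map_apply_ιMulti, norm_smul, norm_smul]
  change ‖c‖ * wedgeVolume _ ≤ _ / _ * (‖c‖ * wedgeVolume v')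
  rw [div_mul_eq_mul_div, le_div_iff₀ hpos]
  exact le_of_eq (by ring)

end WedgeNorm

/-! ### Weak limits: lower semicontinuity, invariance, extreme points and compactness. -/

section WeakLimits

open scoped ENNReal BoundedContinuousFunction

section Topological

variable {Z : Type*} [TopologicalSpace Z] [TopologicalSpace.MetrizableSpace Z]
  [MeasurableSpace Z] [BorelSpace Z]
  {Y : Type*} [TopologicalSpace Y] [TopologicalSpace.MetrizableSpace Y]
  [MeasurableSpace Y] [BorelSpace Y]

lemma lintegral_le_liminf_of_tendsto {c : Z → ℝ≥0∞} (hc : Continuous c)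
    {m : ℕ → ProbabilityMeasure Z} {m₀ : ProbabilityMeasure Z} (hm : Tendsto m atTop (𝓝 m₀)) :
    ∫⁻ z, c z ∂(m₀ : Measure Z) ≤ liminf (fun n ↦ ∫⁻ z, c z ∂(m n : Measure Z)) atTop := by
  have key : ∀ M : ℕ, ∫⁻ z, min (c z) M ∂(m₀ : Measure Z)
      ≤ liminf (fun n ↦ ∫⁻ z, c z ∂(m n : Measure Z)) atTop := by
    intro M
    have hcont : Continuous fun z ↦ (min (c z) M).toReal :=
      ENNReal.continuousOn_toReal.comp_continuous (by fun_prop)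
        fun z ↦ ne_top_of_le_ne_top (ENNReal.natCast_ne_top M) (min_le_right _ _)
    have h1 := lintegral_le_liminf_lintegral_of_forall_isOpen_measure_le_liminf_measure
      (μ := (m₀ : Measure Z)) (μs := fun n ↦ (m n : Measure Z)) hcont
      (fun z ↦ ENNReal.toReal_nonneg)
      fun G hG ↦ ProbabilityMeasure.le_liminf_measure_open_of_tendsto hm hG
    have h2 : ∀ z, ENNReal.ofReal (min (c z) M).toReal = min (c z) M := fun z ↦
      ENNReal.ofReal_toReal (ne_top_of_le_ne_top (ENNReal.natCast_ne_top M) (min_le_right _ _))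
    simp only [h2] at h1
    exact h1.trans (liminf_le_liminf (.of_forall fun n ↦ lintegral_mono fun z ↦ min_le_left _ _))
  calc ∫⁻ z, c z ∂(m₀ : Measure Z) = ∫⁻ z, ⨆ M : ℕ, min (c z) M ∂(m₀ : Measure Z) := by
        congr 1
        ext x
        rw [← inf_iSup_eq, ENNReal.iSup_natCast, inf_top_eq]
    _ = ⨆ M : ℕ, ∫⁻ z, min (c z) M ∂(m₀ : Measure Z) :=
      lintegral_iSup (fun M ↦ hc.measurable.min measurable_const) fun M N hMN x ↦ by
        dsimp only; gcongr
    _ ≤ _ := iSup_le key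

/-- A weak limit of asymptotically invariant measures is invariant if the discontinuities of the
map are negligible for the limit. -/
lemma map_eq_of_tendsto_of_continuousOn {T : Z → Z} (hT : Measurable T) {j : Z → Y}
    (hj : Continuous j) (hjm : MeasurableEmbedding j) {U : Set Z} (hU : IsOpen U)
    (hTU : ContinuousOn (j ∘ T) U)
    {m : ℕ → ProbabilityMeasure Z} {m₀ : ProbabilityMeasure Z} (hm : Tendsto m atTop (𝓝 m₀))
    (hm₀ : (m₀ : Measure Z) Uᶜ = 0) {ε : ℕ → ℝ≥0∞} (hε : Tendsto ε atTop (𝓝 0))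
    (hinv : ∀ n s, MeasurableSet s → (m n : Measure Z) s ≤ (m n : Measure Z) (T ⁻¹' s) + ε n) :
    (m₀ : Measure Z).map T = m₀ := by
  -- The pushforwards of `m n` under `j` converge to those of `m₀` under `j` and under `j ∘ T`, so
  -- these agree. Through `j` the continuity of `T` is only needed for a possibly coarser topology
  -- on the target.
  have hjT : Measurable (j ∘ T) := hj.measurable.comp hT
  have h1 : Tendsto (fun n ↦ (m n).map hj.measurable.aemeasurable) atTop
      (𝓝 (m₀.map hj.measurable.aemeasurable)) :=
    ProbabilityMeasure.tendsto_map_of_tendsto_of_continuous m m₀ hm hj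
  have h2 : Tendsto (fun n ↦ (m n).map hj.measurable.aemeasurable) atTop
      (𝓝 (m₀.map hjT.aemeasurable)) := by
    refine tendsto_of_forall_isClosed_limsup_le' fun C hC ↦ ?_
    -- The preimage of `C` itself need not be closed, but adding `Uᶜ` closes it and adds nothing to
    -- its `m₀`-measure.
    have hC1 : IsClosed (Uᶜ ∪ (j ∘ T) ⁻¹' C) := by
      rw [← isOpen_compl_iff, Set.compl_union, compl_compl, ← Set.preimage_compl]
      exact hTU.isOpen_inter_preimage hU hC.isOpen_compl
    have e1 : ((m₀.map hjT.aemeasurable : ProbabilityMeasure Y) : Measure Y) C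
        = (m₀ : Measure Z) ((j ∘ T) ⁻¹' C) := by
      rw [ProbabilityMeasure.toMeasure_map, Measure.map_apply hjT hC.measurableSet]
    have e2 : ∀ n, (((m n).map hj.measurable.aemeasurable : ProbabilityMeasure Y) : Measure Y) C
        ≤ (m n : Measure Z) (Uᶜ ∪ (j ∘ T) ⁻¹' C) + ε n := fun n ↦ by
      rw [ProbabilityMeasure.toMeasure_map, Measure.map_apply hj.measurable hC.measurableSet]
      refine (hinv n _ (hj.measurable hC.measurableSet)).trans ?_
      gcongr
      exact Set.subset_union_right
    rw [e1]
    calc limsup (fun n ↦ (((m n).map hj.measurable.aemeasurable : ProbabilityMeasure Y) :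
          Measure Y) C) atTop
        ≤ limsup ((fun n ↦ (m n : Measure Z) (Uᶜ ∪ (j ∘ T) ⁻¹' C)) + ε) atTop :=
          limsup_le_limsup (.of_forall e2)
      _ = limsup (fun n ↦ (m n : Measure Z) (Uᶜ ∪ (j ∘ T) ⁻¹' C)) atTop :=
          ENNReal.limsup_add_of_right_tendsto_zero hε _
      _ ≤ (m₀ : Measure Z) (Uᶜ ∪ (j ∘ T) ⁻¹' C) :=
          ProbabilityMeasure.limsup_measure_closed_le_of_tendsto hm hC1
      _ ≤ (m₀ : Measure Z) Uᶜ + (m₀ : Measure Z) ((j ∘ T) ⁻¹' C) := measure_union_le _ _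
      _ = (m₀ : Measure Z) ((j ∘ T) ⁻¹' C) := by rw [hm₀, zero_add]
  have h3 := congrArg (fun p : ProbabilityMeasure Y ↦ (p : Measure Y)) (tendsto_nhds_unique h2 h1)
  simp only [ProbabilityMeasure.toMeasure_map] at h3
  rw [← Measure.map_map hj.measurable hT] at h3
  have h4 := congrArg (Measure.comap j) h3
  rwa [hjm.comap_map, hjm.comap_map] at h4

/-- A nonempty compact set of probability measures has a member that is not a proper convex
combination of two others. -/
lemma exists_mem_forall_eq_of_isCompact [TopologicalSpace.SeparableSpace Z]
    {K : Set (ProbabilityMeasure Z)} (hK : IsCompact K) (hne : K.Nonempty) :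
    ∃ m ∈ K, ∀ m₁ ∈ K, ∀ m₂ ∈ K, ∀ a b : ℝ≥0∞, 0 < a → 0 < b → a + b = 1 →
      (m : Measure Z) = a • (m₁ : Measure Z) + b • (m₂ : Measure Z) → m₁ = m := by
  -- `Φ` is a continuous injection, affine in the measure, into a locally convex product space,
  -- where Krein–Milman provides extreme points.
  let Φ : ProbabilityMeasure Z → (Z →ᵇ ℝ) → ℝ := fun m g ↦ ∫ z, g z ∂(m : Measure Z)
  have hΦ : Continuous Φ := continuous_pi fun g ↦ continuous_iff_continuousAt.2 fun m ↦
    (ProbabilityMeasure.tendsto_iff_forall_integral_tendsto.1 tendsto_id) g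
  have hinj : Function.Injective Φ := by
    intro m₁ m₂ h
    have : Tendsto (fun _ : ℕ ↦ m₁) atTop (𝓝 m₂) :=
      ProbabilityMeasure.tendsto_iff_forall_integral_tendsto.2 fun g ↦ by
        have : Φ m₁ g = Φ m₂ g := congrFun h g
        simp only [Φ] at this
        rw [this]
        exact tendsto_const_nhds
    exact tendsto_nhds_unique tendsto_const_nhds this
  obtain ⟨e, he⟩ := (hK.image hΦ).extremePoints_nonempty (hne.image Φ)
  obtain ⟨m, hmK, rfl⟩ := he.1
  refine ⟨m, hmK, fun m₁ hm₁ m₂ hm₂ a b ha hb hab hm ↦ ?_⟩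
  have ha' : a ≠ ⊤ := ne_top_of_le_ne_top ENNReal.one_ne_top (hab ▸ le_self_add)
  have hb' : b ≠ ⊤ := ne_top_of_le_ne_top ENNReal.one_ne_top (hab ▸ le_add_self)
  refine hinj ((mem_extremePoints_iff_left.1 he).2 _ ⟨m₁, hm₁, rfl⟩ _ ⟨m₂, hm₂, rfl⟩ ?_)
  refine ⟨a.toReal, b.toReal, ENNReal.toReal_pos ha.ne' ha', ENNReal.toReal_pos hb.ne' hb', ?_, ?_⟩
  · rw [← ENNReal.toReal_add ha' hb', hab, ENNReal.toReal_one]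
  · ext g
    have hg : ∀ p : ProbabilityMeasure Z, Integrable g (p : Measure Z) := fun p ↦ g.integrable _
    simp only [Φ, Pi.add_apply, Pi.smul_apply, hm]
    rw [integral_add_measure ((hg m₁).smul_measure ha') ((hg m₂).smul_measure hb'),
      integral_smul_measure, integral_smul_measure]

variable {X : Type*} [MeasurableSpace X] {S : Type*} [TopologicalSpace S] [CompactSpace S]
  [TopologicalSpace.MetrizableSpace S] [MeasurableSpace S] [BorelSpace S]

/-- Prokhorov: the first marginal is a single measure on a Polish space and the second factor is
compact, so the family is tight. -/
lemma isCompact_setOf_map_fst_eq [TopologicalSpace X] [PolishSpace X] [BorelSpace X]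
    (μ : Measure X) [IsProbabilityMeasure μ] :
    IsCompact {m : ProbabilityMeasure (X × S) | (m : Measure (X × S)).map Prod.fst = μ} := by
  set K := {m : ProbabilityMeasure (X × S) | (m : Measure (X × S)).map Prod.fst = μ} with hK
  let μ' : ProbabilityMeasure X := ⟨μ, inferInstance⟩
  have hclosed : IsClosed K := by
    have hc := ProbabilityMeasure.continuous_map (Ω := X × S) (Ω' := X) continuous_fst
    have : K = (fun m : ProbabilityMeasure (X × S) ↦
        m.map continuous_fst.measurable.aemeasurable) ⁻¹' {μ'} := by
      ext m
      rw [Set.mem_preimage, Set.mem_singleton_iff]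
      rw [← ProbabilityMeasure.toMeasure_injective.eq_iff]
      rfl
    rw [this]
    exact isClosed_singleton.preimage hc
  rw [← hclosed.closure_eq]
  refine isCompact_closure_of_isTightMeasureSet (IsTightMeasureSet.prodMk ?_ .of_compactSpace)
  refine (isTightMeasureSet_singleton (μ := μ)).subset ?_
  rintro _ ⟨_, ⟨m, hm, rfl⟩, rfl⟩
  exact hm

end Topological

/-! ### Invariant lifts for skew products with compact fibres. -/

section SkewProduct

lemma isProbabilityMeasure_of_measurePreserving {Z X : Type*} [MeasurableSpace Z]
    [MeasurableSpace X] {g : Z → X} {m : Measure Z} {μ : Measure X} [IsProbabilityMeasure μ]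
    (h : MeasurePreserving g m μ) : IsProbabilityMeasure m :=
  ⟨by rw [← Set.preimage_univ (f := g), h.measure_preimage nullMeasurableSet_univ, measure_univ]⟩

lemma exists_polishSpace_continuous {X : Type*} [MeasurableSpace X] [StandardBorelSpace X]
    {Y : Type*} [TopologicalSpace Y]
    [SecondCountableTopology Y] [MeasurableSpace Y] [OpensMeasurableSpace Y] {g : X → Y}
    (hg : Measurable g) :
    ∃ τ : TopologicalSpace X, @PolishSpace X τ ∧ @BorelSpace X τ _ ∧ @Continuous X Y τ _ g := by
  let t := (upgradeStandardBorel X).toTopologicalSpace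
  have hp : PolishSpace X := (upgradeStandardBorel X).toPolishSpace
  have hb : BorelSpace X := (upgradeStandardBorel X).toBorelSpace
  obtain ⟨τ, hle, hcont, hpol⟩ := hg.exists_continuous
  refine ⟨τ, hpol, ⟨?_⟩, hcont⟩
  rw [borel_eq_borel_of_le hpol hp hle]
  exact eq_borel_upgradeStandardBorel X

variable {X : Type*} [MeasurableSpace X]
  {P : Type*} [TopologicalSpace P] [MeasurableSpace P]
  {S : Type*} [TopologicalSpace S] [MeasurableSpace S]

/-- The skew product over `f` whose fibre maps depend on the base point through `π`. -/
def skewMap (f : X → X) (π : X → P) (t : P × S → S) (z : X × S) : X × S :=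
  (f z.1, t (π z.1, z.2))

/-- A skew product whose fibre maps are continuous on an open set, and a continuous cost function
that is infinite off this set. -/
structure IsContinuousSkewProduct (f : X → X) (π : X → P) (t : P × S → S) (U : Set (P × S))
    (c : P × S → ℝ≥0∞) : Prop where
  measurable_base : Measurable f
  measurable_param : Measurable π
  measurable_fiber : Measurable t
  isOpen : IsOpen U
  continuousOn : ContinuousOn t U
  continuous_cost : Continuous c
  cost_eq_top : ∀ z ∉ U, c z = ⊤

/-- The lifts of `μ` to `X × S` that are invariant under `T`. -/
def invariantLifts (μ : Measure X) (T : X × S → X × S) : Set (Measure (X × S)) :=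
  {m | MeasurePreserving T m m ∧ MeasurePreserving Prod.fst m μ}

namespace IsContinuousSkewProduct

variable {f : X → X} {π : X → P} {t : P × S → S} {U : Set (P × S)} {c : P × S → ℝ≥0∞}

lemma measurable_skewMap (h : IsContinuousSkewProduct f π t U c) : Measurable (skewMap f π t) :=
  (h.measurable_base.comp measurable_fst).prodMk
    (h.measurable_fiber.comp ((h.measurable_param.comp measurable_fst).prodMk measurable_snd))

/-- Refining the topology changes the source of `f` but not the target `ℝ` of `i ∘ f`. So one
refinement suffices, whereas continuity of `f` from `X` to itself would have to hold for the refined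
topology on both sides. -/
lemma exists_continuous_structure [StandardBorelSpace X] [BorelSpace P]
    [SecondCountableTopology P] (h : IsContinuousSkewProduct f π t U c) :
    ∃ (i : X → ℝ) (τ : TopologicalSpace X), MeasurableEmbedding i ∧ @PolishSpace X τ ∧
      @BorelSpace X τ _ ∧ @Continuous X ℝ τ _ i ∧ @Continuous X ℝ τ _ (i ∘ f) ∧
      @Continuous X P τ _ π := by
  obtain ⟨i, hi⟩ := exists_measurableEmbedding_real X
  obtain ⟨τ, h1, h2, h3⟩ := exists_polishSpace_continuous (X := X)
    (g := fun x ↦ (i x, i (f x), π x))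
    (hi.measurable.prodMk ((hi.measurable.comp h.measurable_base).prodMk h.measurable_param))
  exact ⟨i, τ, hi, h1, h2, continuous_fst.comp h3, continuous_fst.comp (continuous_snd.comp h3),
    continuous_snd.comp (continuous_snd.comp h3)⟩

variable [SecondCountableTopology S] [BorelSpace S] [TopologicalSpace.MetrizableSpace S]

/-- The cost is lower semicontinuous under weak limits and infinite off `U`; a finite limiting bound
therefore makes the discontinuities null. -/
lemma invariant_of_tendsto
    (h : IsContinuousSkewProduct f π t U c) [TopologicalSpace X] [PolishSpace X] [BorelSpace X]
    {i : X → ℝ} (hi : Continuous i) (hie : MeasurableEmbedding i) (hif : Continuous (i ∘ f))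
    (hπ : Continuous π) {m : ℕ → ProbabilityMeasure (X × S)} {m₀ : ProbabilityMeasure (X × S)}
    (hm : Tendsto m atTop (𝓝 m₀)) {ε : ℕ → ℝ≥0∞} (hε : Tendsto ε atTop (𝓝 0))
    (hinv : ∀ n s, MeasurableSet s →
      (m n : Measure (X × S)) s ≤ (m n : Measure (X × S)) (skewMap f π t ⁻¹' s) + ε n)
    {H : ℕ → ℝ≥0∞} {H₀ : ℝ≥0∞} (hH : Tendsto H atTop (𝓝 H₀))
    (hcost : ∀ n, ∫⁻ z, c (π z.1, z.2) ∂(m n : Measure (X × S)) ≤ H n)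
    (hfin : H₀ ≠ ⊤ ∨ ∀ z : X × S, (π z.1, z.2) ∈ U) :
    MeasurePreserving (skewMap f π t) (m₀ : Measure (X × S)) m₀ ∧
      ∫⁻ z, c (π z.1, z.2) ∂(m₀ : Measure (X × S)) ≤ H₀ := by
  have hp : Continuous fun z : X × S ↦ (π z.1, z.2) := by fun_prop
  have hc : Continuous fun z : X × S ↦ c (π z.1, z.2) := h.continuous_cost.comp hp
  have hle : ∫⁻ z, c (π z.1, z.2) ∂(m₀ : Measure (X × S)) ≤ H₀ :=
    (lintegral_le_liminf_of_tendsto hc hm).trans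
      ((liminf_le_liminf (.of_forall hcost)).trans hH.liminf_eq.le)
  refine ⟨⟨h.measurable_skewMap, ?_⟩, hle⟩
  have hcont : ContinuousOn (Prod.map i id ∘ skewMap f π t)
      ((fun z : X × S ↦ (π z.1, z.2)) ⁻¹' U) := by
    refine ContinuousOn.prodMk (f := fun z : X × S ↦ (i ∘ f) z.1)
      (g := fun z : X × S ↦ t (π z.1, z.2))
      (hif.comp continuous_fst).continuousOn ?_
    exact h.continuousOn.comp hp.continuousOn fun z hz ↦ hz
  refine map_eq_of_tendsto_of_continuousOn h.measurable_skewMap (j := Prod.map i id)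
    (by fun_prop) (hie.prodMap .id) (h.isOpen.preimage hp) hcont hm ?_ hε hinv
  rcases hfin with hfin | hfin
  · have hae := ae_lt_top (μ := (m₀ : Measure (X × S))) hc.measurable
      (ne_top_of_le_ne_top hfin hle)
    refine measure_mono_null ?_ (ae_iff.1 hae)
    intro z hz
    simp only [Set.mem_compl_iff, Set.mem_preimage] at hz
    simp [h.cost_eq_top _ hz]
  · rw [Set.eq_univ_of_forall (s := (fun z : X × S ↦ (π z.1, z.2)) ⁻¹' U) hfin]
    simp

variable [BorelSpace P] [SecondCountableTopology P] [StandardBorelSpace X] [CompactSpace S]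

/-- Krylov–Bogoliubov: asymptotically invariant lifts yield an invariant lift. -/
theorem exists_invariantLift (h : IsContinuousSkewProduct f π t U c)
    {μ : Measure X} [IsProbabilityMeasure μ] {m : ℕ → Measure (X × S)}
    (hm : ∀ n, MeasurePreserving Prod.fst (m n) μ) {ε : ℕ → ℝ≥0∞} (hε : Tendsto ε atTop (𝓝 0))
    (hinv : ∀ n s, MeasurableSet s → m n s ≤ m n (skewMap f π t ⁻¹' s) + ε n)
    {H : ℕ → ℝ≥0∞} {H₀ : ℝ≥0∞} (hH : Tendsto H atTop (𝓝 H₀))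
    (hcost : ∀ n, ∫⁻ z, c (π z.1, z.2) ∂(m n) ≤ H n)
    (hfin : H₀ ≠ ⊤ ∨ ∀ z : X × S, (π z.1, z.2) ∈ U) :
    ∃ m₀ ∈ invariantLifts μ (skewMap f π t), ∫⁻ z, c (π z.1, z.2) ∂m₀ ≤ H₀ := by
  obtain ⟨i, τ, hie, hpol, hbor, hi, hif, hπ⟩ := h.exists_continuous_structure
  have hprob : ∀ n, IsProbabilityMeasure (m n) := fun n ↦
    isProbabilityMeasure_of_measurePreserving (hm n)
  let m' : ℕ → ProbabilityMeasure (X × S) := fun n ↦ ⟨m n, hprob n⟩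
  obtain ⟨m₀, hm₀, φ, hφ, hlim⟩ := (isCompact_setOf_map_fst_eq (S := S) μ).tendsto_subseq
    (x := m') fun n ↦ (hm n).map_eq
  have := h.invariant_of_tendsto hi hie hif hπ hlim (hε.comp hφ.tendsto_atTop)
    (fun n ↦ hinv (φ n)) (hH.comp hφ.tendsto_atTop) (fun n ↦ hcost (φ n)) hfin
  exact ⟨m₀, ⟨this.1, ⟨measurable_fst, hm₀⟩⟩, this.2⟩

/-- If the base is ergodic, then the least cost of an invariant lift is attained at an ergodic
lift. -/
theorem exists_ergodic_invariantLift (h : IsContinuousSkewProduct f π t U c)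
    {μ : Measure X} [IsProbabilityMeasure μ] (hμ : Ergodic f μ) {H₀ : ℝ≥0∞}
    (hmin : ∀ m ∈ invariantLifts μ (skewMap f π t), H₀ ≤ ∫⁻ z, c (π z.1, z.2) ∂m)
    (hfin : H₀ ≠ ⊤ ∨ ∀ z : X × S, (π z.1, z.2) ∈ U)
    (hex : ∃ m ∈ invariantLifts μ (skewMap f π t), ∫⁻ z, c (π z.1, z.2) ∂m ≤ H₀) :
    ∃ m ∈ invariantLifts μ (skewMap f π t), Ergodic (skewMap f π t) m ∧
      ∫⁻ z, c (π z.1, z.2) ∂m ≤ H₀ := by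
  obtain ⟨i, τ, hie, hpol, hbor, hi, hif, hπ⟩ := h.exists_continuous_structure
  set T := skewMap f π t with hT
  have hmc : Measurable fun z : X × S ↦ c (π z.1, z.2) := h.continuous_cost.measurable.comp
    ((h.measurable_param.comp measurable_fst).prodMk measurable_snd)
  -- The minimizing lifts. The set is closed by `invariant_of_tendsto` with error zero.
  let K : Set (ProbabilityMeasure (X × S)) := {m | (m : Measure (X × S)) ∈ invariantLifts μ T ∧
    ∫⁻ z, c (π z.1, z.2) ∂(m : Measure (X × S)) ≤ H₀}
  have hprob : ∀ m ∈ invariantLifts μ T, IsProbabilityMeasure m := fun m hm ↦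
    isProbabilityMeasure_of_measurePreserving hm.2
  have hKc : IsCompact K := by
    refine (isCompact_setOf_map_fst_eq (S := S) μ).of_isClosed_subset ?_ fun m hm ↦ hm.1.2.map_eq
    refine IsSeqClosed.isClosed fun m m₀ hm hlim ↦ ?_
    have h1 := h.invariant_of_tendsto hi hie hif hπ hlim (ε := fun _ ↦ 0) tendsto_const_nhds
      (fun n s hs ↦ by rw [(hm n).1.1.measure_preimage hs.nullMeasurableSet, add_zero])
      (H := fun _ ↦ H₀) tendsto_const_nhds (fun n ↦ (hm n).2) hfin
    refine ⟨⟨h1.1, ⟨measurable_fst, ?_⟩⟩, h1.2⟩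
    exact (isCompact_setOf_map_fst_eq (S := S) μ).isClosed.mem_of_tendsto hlim
      (.of_forall fun n ↦ (hm n).1.2.map_eq)
  have hKn : K.Nonempty := by
    obtain ⟨m, hm, hmc⟩ := hex
    exact ⟨⟨m, hprob m hm⟩, hm, hmc⟩
  obtain ⟨m, hmK, hext⟩ := exists_mem_forall_eq_of_isCompact hKc hKn
  refine ⟨m, hmK.1, Ergodic.of_mem_extremePoints
    (mem_extremePoints_iff_left.2 ⟨⟨hmK.1.1, inferInstance⟩, ?_⟩), hmK.2⟩
  have hsemi : ∀ z : X × S, (T z).1 = f z.1 := fun z ↦ rfl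
  have hproj : ∀ p : Measure (X × S), MeasurePreserving T p p →
      MeasurePreserving f (p.map Prod.fst) (p.map Prod.fst) := by
    intro p hp
    refine ⟨h.measurable_base, ?_⟩
    rw [Measure.map_map h.measurable_base measurable_fst]
    conv_rhs => rw [← hp.map_eq, Measure.map_map measurable_fst hp.measurable]
    rfl
  rintro m₁ ⟨hm₁, hm₁p⟩ m₂ ⟨hm₂, hm₂p⟩ ⟨a, b, ha, hb, hab, hm⟩
  -- An ergodic measure is extreme among invariant probability measures, so both components of a
  -- splitting of `m` project to `μ`.
  have hμext := mem_extremePoints.1 hμ.mem_extremePoints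
  have hmap : a • m₁.map Prod.fst + b • m₂.map Prod.fst = μ := by
    rw [← hmK.1.2.map_eq, ← hm, Measure.map_add _ _ measurable_fst, Measure.map_smul,
      Measure.map_smul]
  obtain ⟨hμ₁, hμ₂⟩ := hμext.2 (m₁.map Prod.fst)
    ⟨hproj m₁ hm₁, Measure.isProbabilityMeasure_map measurable_fst.aemeasurable⟩
    (m₂.map Prod.fst)
    ⟨hproj m₂ hm₂, Measure.isProbabilityMeasure_map measurable_fst.aemeasurable⟩
    ⟨a, b, ha, hb, hab, hmap⟩
  have hl₁ : m₁ ∈ invariantLifts μ T := ⟨hm₁, measurable_fst, hμ₁⟩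
  have hl₂ : m₂ ∈ invariantLifts μ T := ⟨hm₂, measurable_fst, hμ₂⟩
  have hsum : a * ∫⁻ z, c (π z.1, z.2) ∂m₁ + b * ∫⁻ z, c (π z.1, z.2) ∂m₂ ≤ H₀ := by
    have := hmK.2
    rwa [← hm, lintegral_add_measure, lintegral_smul_measure, lintegral_smul_measure] at this
  have ha' : a ≠ ⊤ := ne_top_of_le_ne_top ENNReal.one_ne_top (hab ▸ le_self_add)
  have hb' : b ≠ ⊤ := ne_top_of_le_ne_top ENNReal.one_ne_top (hab ▸ le_add_self)
  -- An average of two numbers at least `H₀` can only be at most `H₀` if both equal `H₀`. Thus the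
  -- components lie in `K` again, where `m` is extreme.
  have key : ∀ (a b I J : ℝ≥0∞), a ≠ ⊤ → b ≠ ⊤ → 0 < a → a + b = 1 → H₀ ≤ I → H₀ ≤ J →
      a * I + b * J ≤ H₀ → I ≤ H₀ := by
    intro a b I J ha hb ha0 hab hI hJ hle
    by_contra! hlt
    have hH : H₀ ≠ ⊤ := ne_top_of_lt hlt
    have h1 : a * H₀ < a * I := (ENNReal.mul_lt_mul_iff_right ha0.ne' ha).2 hlt
    have h2 : a * H₀ + b * H₀ < a * I + b * J :=
      ENNReal.add_lt_add_of_lt_of_le (ENNReal.mul_ne_top hb hH) h1 (by gcongr)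
    rw [← add_mul, hab, one_mul] at h2
    exact absurd hle (not_le.2 h2)
  have hK₁ : (⟨m₁, hm₁p⟩ : ProbabilityMeasure (X × S)) ∈ K :=
    ⟨hl₁, key a b _ _ ha' hb' ha hab (hmin m₁ hl₁) (hmin m₂ hl₂) hsum⟩
  have hK₂ : (⟨m₂, hm₂p⟩ : ProbabilityMeasure (X × S)) ∈ K :=
    ⟨hl₂, key b a _ _ hb' ha' hb (by rwa [add_comm]) (hmin m₂ hl₂) (hmin m₁ hl₁)
      (by rwa [add_comm])⟩
  exact congrArg (fun p : ProbabilityMeasure (X × S) ↦ (p : Measure (X × S)))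
    (hext _ hK₁ _ hK₂ a b ha hb hab hm.symm)

end IsContinuousSkewProduct

end SkewProduct

end WeakLimits

/-! ### The negative logarithm with values in `[0, ∞]`. -/

section NegLog

open scoped ENNReal

/-- `-log t` for `t ≤ 1`, with `-log 0 = ∞`. -/
noncomputable def negLog (t : ℝ) : ℝ≥0∞ := (-extLog t).toENNReal

lemma continuous_negLog : Continuous negLog := by
  unfold negLog extLog
  exact EReal.continuous_toENNReal.comp
    (continuous_neg.comp (ENNReal.continuous_log.comp ENNReal.continuous_ofReal))

lemma negLog_anti {s t : ℝ} (h : s ≤ t) : negLog t ≤ negLog s := by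
  unfold negLog extLog
  refine EReal.toENNReal_le_toENNReal (EReal.neg_le_neg_iff.2 ?_)
  exact ENNReal.log_monotone (ENNReal.ofReal_le_ofReal h)

lemma extLog_nonpos {t : ℝ} (h : t ≤ 1) : extLog t ≤ 0 := by
  rw [extLog, ENNReal.log_le_zero_iff, ENNReal.ofReal_le_one]
  exact h

lemma extLog_mul {s : ℝ} (hs : 0 ≤ s) (t : ℝ) : extLog (s * t) = extLog s + extLog t := by
  rw [extLog, ENNReal.ofReal_mul hs, ENNReal.log_mul_add]
  rfl

lemma extLog_exp (a : ℝ) : extLog (Real.exp a) = a := by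
  rw [extLog, ENNReal.log_ofReal_of_pos (Real.exp_pos a), Real.log_exp]

lemma coe_negLog {t : ℝ} (h : t ≤ 1) : (negLog t : EReal) = -extLog t := by
  rw [negLog, EReal.coe_toENNReal]
  rw [EReal.neg_nonneg]
  exact extLog_nonpos h

/-- The bounds by `1` matter: `negLog` is truncated to zero above `1` and is not additive there. -/
lemma negLog_mul {s t : ℝ} (hs : 0 ≤ s) (hs1 : s ≤ 1) (ht1 : t ≤ 1) :
    negLog (s * t) = negLog s + negLog t := by
  have h1 := extLog_nonpos hs1
  have h2 := extLog_nonpos ht1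
  rw [negLog, extLog_mul hs, EReal.neg_add, sub_eq_add_neg,
    EReal.toENNReal_add (EReal.neg_nonneg.2 h1) (EReal.neg_nonneg.2 h2)]
  · rfl
  · exact .inr (ne_top_of_le_ne_top EReal.zero_ne_top h2)
  · exact .inl (ne_top_of_le_ne_top EReal.zero_ne_top h1)

@[simp] lemma negLog_zero : negLog 0 = ⊤ := by simp [negLog, extLog]

@[simp] lemma negLog_one : negLog 1 = 0 := by simp [negLog, extLog]

lemma negLog_eq_top_iff {t : ℝ} : negLog t = ⊤ ↔ t ≤ 0 := by
  simp [negLog, extLog, EReal.neg_eq_top_iff]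

/-- The logarithm of `t ≤ e^a` in terms of the nonnegative quantity `-log (t e^{-a})`. -/
lemma extLog_eq_sub_negLog {t a : ℝ} (ha : 0 ≤ a) (ht : t ≤ Real.exp a) :
    extLog t = (ENNReal.ofReal a : EReal) - (negLog (t * Real.exp (-a)) : EReal) := by
  have h1 : t * Real.exp (-a) ≤ 1 := by
    rw [Real.exp_neg, ← div_eq_mul_inv]
    exact (div_le_one (Real.exp_pos a)).2 ht
  rw [coe_negLog h1, mul_comm, extLog_mul (Real.exp_pos _).le, extLog_exp, EReal.coe_ennreal_ofReal,
    max_eq_left ha, sub_eq_add_neg, neg_neg, ← add_assoc, ← EReal.coe_add, add_neg_cancel,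
    EReal.coe_zero, zero_add]

lemma negLog_prod {ι : Type*} (s : Finset ι) {t : ι → ℝ} (h0 : ∀ i ∈ s, 0 ≤ t i)
    (h1 : ∀ i ∈ s, t i ≤ 1) : negLog (∏ i ∈ s, t i) = ∑ i ∈ s, negLog (t i) := by
  classical
  induction s using Finset.induction_on with
  | empty => simp
  | insert a s ha ih =>
    rw [Finset.prod_insert ha, Finset.sum_insert ha]
    have h0' : ∀ i ∈ s, 0 ≤ t i := fun i hi ↦ h0 i (Finset.mem_insert_of_mem hi)
    have h1' : ∀ i ∈ s, t i ≤ 1 := fun i hi ↦ h1 i (Finset.mem_insert_of_mem hi)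
    rw [negLog_mul (h0 a (Finset.mem_insert_self a s)) (h1 a (Finset.mem_insert_self a s))
      (Finset.prod_le_one h0' h1'), ih h0' h1']

end NegLog

/-! ### Integrals of differences of nonnegative functions. -/

section ExtIntegral

open scoped ENNReal

lemma EReal.tendsto_coe_sub_coe {ι : Type*} {l : Filter ι} {a b : ι → ℝ≥0∞} {a₀ b₀ : ℝ≥0∞}
    (ha : Tendsto a l (𝓝 a₀)) (hb : Tendsto b l (𝓝 b₀)) (h : a₀ ≠ ⊤) :
    Tendsto (fun i ↦ (a i : EReal) - (b i : EReal)) l (𝓝 ((a₀ : EReal) - (b₀ : EReal))) := by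
  simp only [sub_eq_add_neg]
  refine Tendsto.comp (f := fun i ↦ ((a i : EReal), -(b i : EReal)))
    (EReal.continuousAt_add (.inl ?_) (.inl ?_)) (Tendsto.prodMk_nhds ?_ ?_)
  · exact EReal.coe_ennreal_eq_top_iff.not.2 h
  · exact EReal.coe_ennreal_ne_bot _
  · exact (continuous_coe_ennreal_ereal.tendsto _).comp ha
  · exact (continuous_neg.tendsto _).comp ((continuous_coe_ennreal_ereal.tendsto _).comp hb)

/-- `a` and `b` need not be the positive and negative parts of `φ`. The identity `(a - b)⁺ + b = (b
- a)⁺ + a` is integrated and rearranged; finiteness of `∫ a` excludes `∞ - ∞`. -/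
lemma extIntegral_eq_sub {α : Type u} [MeasurableSpace α] {ν : Measure α} {φ : α → EReal}
    {a b : α → ℝ≥0∞} (ha : Measurable a) (hb : Measurable b) (hai : ∫⁻ x, a x ∂ν ≠ ⊤)
    (h : ∀ᵐ x ∂ν, φ x = (a x : EReal) - (b x : EReal)) :
    extIntegral ν φ = ((∫⁻ x, a x ∂ν : ℝ≥0∞) : EReal) - ((∫⁻ x, b x ∂ν : ℝ≥0∞) : EReal) := by
  have h1 : ∫⁻ x, (φ x).toENNReal ∂ν = ∫⁻ x, (a x - b x) ∂ν := by
    refine lintegral_congr_ae ?_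
    filter_upwards [h] with x hx
    rw [hx, EReal.toENNReal_sub (EReal.coe_ennreal_nonneg _), EReal.toENNReal_coe,
      EReal.toENNReal_coe]
  have h2 : ∫⁻ x, (-φ x).toENNReal ∂ν = ∫⁻ x, (b x - a x) ∂ν := by
    refine lintegral_congr_ae ?_
    filter_upwards [h, ae_lt_top ha hai] with x hx hfin
    rw [hx, EReal.neg_sub (.inl (EReal.coe_ennreal_ne_bot _))
      (.inl (EReal.coe_ennreal_eq_top_iff.not.2 hfin.ne)), add_comm, ← sub_eq_add_neg,
      EReal.toENNReal_sub (EReal.coe_ennreal_nonneg _), EReal.toENNReal_coe,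
      EReal.toENNReal_coe]
  rw [extIntegral, h1, h2]
  set p := ∫⁻ x, (a x - b x) ∂ν
  set q := ∫⁻ x, (b x - a x) ∂ν
  set A := ∫⁻ x, a x ∂ν
  set B := ∫⁻ x, b x ∂ν
  have hsum : p + B = q + A := by
    rw [← lintegral_add_right _ hb, ← lintegral_add_right _ ha]
    refine lintegral_congr fun x ↦ ?_
    rw [tsub_add_eq_max, tsub_add_eq_max, max_comm]
  have hp : p ≠ ⊤ := ne_top_of_le_ne_top hai (lintegral_mono fun x ↦ tsub_le_self)
  clear_value p q A B
  clear h1 h2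
  rcases eq_or_ne B ⊤ with hB | hB
  · have hq : q = ⊤ := by
      rw [hB, add_top] at hsum
      exact (ENNReal.add_eq_top.1 hsum.symm).resolve_right hai
    rw [hq, hB]
    lift p to NNReal using hp
    lift A to NNReal using hai
    rfl
  · have hq : q ≠ ⊤ := fun hq ↦ by
      rw [hq, top_add] at hsum
      exact ENNReal.add_ne_top.2 ⟨hp, hB⟩ hsum
    lift p to NNReal using hp
    lift q to NNReal using hq
    lift A to NNReal using hai
    lift B to NNReal using hB
    have hsum' : (p : ℝ) + B = q + A := by exact_mod_cast hsum
    have : (p : ℝ) - q = A - B := by linarith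
    simp only [EReal.coe_nnreal_eq_coe_real]
    exact_mod_cast congrArg (fun t : ℝ ↦ (t : EReal)) this

end ExtIntegral

/-! ### Constancy of growth rates over an ergodic base. -/

section ErgodicLimit

open scoped ENNReal

/-- The limsup does not increase along orbits, and its truncations have the same finite integral
before and after composition with `f`; hence it is invariant almost everywhere. -/
lemma Ergodic.ae_eq_lintegral_of_tendsto {X : Type*} [MeasurableSpace X] {f : X → X}
    {μ : Measure X} [IsProbabilityMeasure μ] (hf : Ergodic f μ) {h : ℕ → X → ℝ≥0∞}
    (hh : IsSuperadditive f h) (hm : ∀ n, Measurable (h n)) {H : X → ℝ≥0∞}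
    (hH : ∀ᵐ x ∂μ, Tendsto (fun n ↦ h n x / n) atTop (𝓝 (H x))) :
    ∀ᵐ x ∂μ, H x = ∫⁻ x, H x ∂μ := by
  set G : X → ℝ≥0∞ := fun x ↦ limsup (fun n ↦ h n x / n) atTop with hG
  have hmG : Measurable G := .limsup fun n ↦ (hm n).div_const _
  have hle : ∀ x, G (f x) ≤ G x := hh.limsup_comp_le
  have hinv : ∀ M : ℕ, ∀ᵐ x ∂μ, min (G (f x)) M = min (G x) M := by
    intro M
    have hmM : Measurable fun x ↦ min (G x) M := hmG.min measurable_const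
    have hint : ∫⁻ x, min (G (f x)) M ∂μ = ∫⁻ x, min (G x) M ∂μ :=
      hf.toMeasurePreserving.lintegral_comp hmM
    refine ae_eq_of_ae_le_of_lintegral_le (.of_forall fun x ↦ min_le_min_right _ (hle x)) ?_
      hmM.aemeasurable hint.ge
    rw [hint]
    refine ne_top_of_le_ne_top (ENNReal.natCast_ne_top M) ?_
    calc _ ≤ ∫⁻ _, (M : ℝ≥0∞) ∂μ := lintegral_mono fun x ↦ min_le_right _ _
      _ = M := by simp
  have hcomp : G ∘ f =ᵐ[μ] G := by
    filter_upwards [ae_all_iff.2 hinv] with x hx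
    calc G (f x) = ⨆ M : ℕ, min (G (f x)) M := by
          rw [← inf_iSup_eq, ENNReal.iSup_natCast, inf_top_eq]
      _ = ⨆ M : ℕ, min (G x) M := by simp_rw [hx]
      _ = G x := by rw [← inf_iSup_eq, ENNReal.iSup_natCast, inf_top_eq]
  obtain ⟨c, hc⟩ := hf.ae_eq_const_of_ae_eq_comp₀ hmG.nullMeasurable hcomp
  have hHc : ∀ᵐ x ∂μ, H x = c := by
    filter_upwards [hc, hH] with x hx hlim
    rw [← hlim.limsup_eq]
    exact hx
  have : ∫⁻ x, H x ∂μ = c := by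
    rw [lintegral_congr_ae hHc]
    simp
  rw [this]
  exact hHc

end ErgodicLimit

/-! ### From growth rates of partial sums to those of the terms. -/

section Sequences

open scoped ENNReal

/-- If the partial sums of a monotone family of nonnegative sequences have growth rates, then so
have the individual sequences. -/
lemma exists_tendsto_div_of_tendsto_sum_div {d : ℕ} {a : ℕ → ℕ → ℝ≥0∞} (ha : Monotone a)
    {H : ℕ → ℝ≥0∞}
    (h : ∀ k ≤ d, Tendsto (fun n : ℕ ↦ (∑ i ∈ Finset.range k, a i n) / n) atTop (𝓝 (H k))) :
    (∀ i < d, Tendsto (fun n : ℕ ↦ a i n / n) atTop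
      (𝓝 (if H i = ⊤ then ⊤ else H (i + 1) - H i))) ∧
    ∀ k ≤ d, ∑ i ∈ Finset.range k, (if H i = ⊤ then ⊤ else H (i + 1) - H i) = H k := by
  have h0 : H 0 = 0 := by
    have := h 0 (Nat.zero_le d)
    simp only [Finset.range_zero, Finset.sum_empty, ENNReal.zero_div] at this
    exact tendsto_nhds_unique this tendsto_const_nhds
  have hmono : ∀ i < d, H i ≤ H (i + 1) := fun i hi ↦
    le_of_tendsto_of_tendsto' (h i hi.le) (h (i + 1) hi) fun n ↦ by
      rw [Finset.sum_range_succ]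
      gcongr
      exact le_self_add
  constructor
  · intro i hi
    split_ifs with hHi
    -- Once the first `i` terms together grow superlinearly, so does the next one, being at least
    -- their mean. The difference `H (i + 1) - H i` would be `⊤ - ⊤ = 0` here, hence the case
    -- distinction.
    · have hi0 : i ≠ 0 := by
        rintro rfl
        simp [h0] at hHi
      have h1 := h i hi.le
      rw [hHi] at h1
      have h2 := ENNReal.Tendsto.div_const (b := (i : ℝ≥0∞)) h1 (.inl ENNReal.top_ne_zero)
      rw [ENNReal.top_div_of_ne_top (ENNReal.natCast_ne_top i)] at h2
      refine tendsto_nhds_top_mono h2 (.of_forall fun n ↦ ?_)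
      have h3 : ∑ j ∈ Finset.range i, a j n ≤ i * a i n := by
        calc ∑ j ∈ Finset.range i, a j n ≤ ∑ _j ∈ Finset.range i, a i n :=
              Finset.sum_le_sum fun j hj ↦ ha (Finset.mem_range.1 hj).le n
          _ = i * a i n := by simp
      calc (∑ j ∈ Finset.range i, a j n) / n / i ≤ i * a i n / n / i := by gcongr
        _ = i * (a i n / n) / i := by rw [mul_div_assoc]
        _ = a i n / n := ENNReal.natCast_mul_div_cancel_left (Nat.pos_of_ne_zero hi0)
    · have h1 := ENNReal.Tendsto.sub (h (i + 1) hi) (h i hi.le) (.inr hHi)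
      refine h1.congr' ?_
      filter_upwards [(h i hi.le).eventually_lt_const (lt_top_iff_ne_top.2 hHi)] with n hn
      rw [Finset.sum_range_succ, add_comm, ENNReal.add_div]
      exact ENNReal.add_sub_cancel_right hn.ne
  · intro k hk
    induction k with
    | zero => simp [h0]
    | succ k ih =>
      rw [Finset.sum_range_succ, ih (by omega)]
      split_ifs with hHk
      · rw [add_top, eq_comm, ← top_le_iff, ← hHk]
        exact hmono k hk
      · exact add_tsub_cancel_of_le (hmono k hk)

end Sequences

/-! ### Existence of the Lyapunov exponents and the value of their sums. -/

section Growth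

open scoped ENNReal
open Module

variable {X : Type u} {E : X → Type v}
  [∀ x, NormedAddCommGroup (E x)] [∀ x, InnerProductSpace ℝ (E x)]
  {f : X → X} (F : ∀ x, E x →L[ℝ] E (f x))

/-- Stated in a sigma type because the two targets are fibres over points that are only
propositionally equal. -/
lemma bundleIterate_add (m n : ℕ) (x : X) :
    (⟨f^[m + n] x, bundleIterate F (m + n) x⟩ : Σ y, E x →L[ℝ] E y) =
      ⟨f^[n] (f^[m] x), (bundleIterate F n (f^[m] x)).comp (bundleIterate F m x)⟩ := by
  induction m generalizing x with
  | zero =>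
    rw [Nat.zero_add]
    rfl
  | succ m ih =>
    have h1 : (⟨f^[m + 1 + n] x, bundleIterate F (m + 1 + n) x⟩ : Σ y, E x →L[ℝ] E y) =
        ⟨f^[m + n + 1] x, bundleIterate F (m + n + 1) x⟩ := by
      rw [Nat.add_right_comm]
    rw [h1]
    exact congrArg (fun p : Σ y, E (f x) →L[ℝ] E y ↦
      (⟨p.1, p.2.comp (F x)⟩ : Σ y, E x →L[ℝ] E y)) (ih (f x))

/-- The Birkhoff sums of `log⁺ ‖F‖`, which bound the logarithmic growth of the iterates. -/
noncomputable def logNormSum (n : ℕ) (x : X) : ℝ := birkhoffSum f (fun x ↦ Real.posLog ‖F x‖) n x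

lemma logNormSum_nonneg (n : ℕ) (x : X) : 0 ≤ logNormSum F n x := by
  unfold logNormSum birkhoffSum
  exact Finset.sum_nonneg fun _ _ ↦ Real.posLog_nonneg

lemma logNormSum_add (m n : ℕ) (x : X) :
    logNormSum F (m + n) x = logNormSum F m x + logNormSum F n (f^[m] x) :=
  birkhoffSum_add ..

lemma logNormSum_succ (n : ℕ) (x : X) :
    logNormSum F (n + 1) x = Real.posLog ‖F x‖ + logNormSum F n (f x) :=
  birkhoffSum_succ' ..

lemma le_exp_posLog {t : ℝ} (ht : 0 ≤ t) : t ≤ Real.exp (Real.posLog t) := by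
  rcases ht.eq_or_lt with rfl | h
  · positivity
  · calc t = Real.exp (Real.log t) := (Real.exp_log h).symm
      _ ≤ _ := Real.exp_le_exp.2 (le_max_right _ _)

lemma norm_bundleIterate_le (n : ℕ) (x : X) :
    ‖bundleIterate F n x‖ ≤ Real.exp (logNormSum F n x) := by
  induction n generalizing x with
  | zero =>
    simp only [logNormSum, birkhoffSum_zero, Real.exp_zero]
    exact ContinuousLinearMap.norm_id_le
  | succ n ih =>
    rw [logNormSum_succ, Real.exp_add, mul_comm]
    exact (ContinuousLinearMap.opNorm_comp_le _ _).trans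
      (mul_le_mul (ih (f x)) (le_exp_posLog (norm_nonneg _)) (norm_nonneg _) (Real.exp_pos _).le)

lemma mul_exp_neg_le_one {t a : ℝ} (h : t ≤ Real.exp a) : t * Real.exp (-a) ≤ 1 := by
  rw [Real.exp_neg, ← div_eq_mul_inv]
  exact (div_le_one (Real.exp_pos a)).2 h

lemma measurable_logNormSum [MeasurableSpace X] (hf : Measurable f)
    (hr : Measurable fun x ↦ ‖F x‖) (n : ℕ) :
    Measurable (logNormSum F n) := by
  have : Measurable fun x ↦ Real.posLog ‖F x‖ := Real.continuous_posLog.measurable.comp hr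
  unfold logNormSum birkhoffSum
  exact Finset.measurable_fun_sum _ fun j _ ↦ this.comp (hf.iterate j)

variable [∀ x, FiniteDimensional ℝ (E x)]

/-- `k log ‖F‖ - log ‖⋀^k F^n‖`, up to replacing `log ‖F‖` with a Birkhoff sum. -/
noncomputable def wedgeCost (k n : ℕ) (x : X) : ℝ≥0∞ :=
  negLog (wedgeNorm k (bundleIterate F n x : E x →ₗ[ℝ] E (f^[n] x)) *
    Real.exp (-(k * logNormSum F n x)))

/-- The normalized negative logarithm of the singular values of `F^n`. -/
noncomputable def singularCost (i n : ℕ) (x : X) : ℝ≥0∞ :=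
  negLog ((bundleIterate F n x : E x →ₗ[ℝ] E (f^[n] x)).singularValues i *
    Real.exp (-logNormSum F n x))

lemma wedgeNorm_bundleIterate_le (k n : ℕ) (x : X) :
    wedgeNorm k (bundleIterate F n x : E x →ₗ[ℝ] E (f^[n] x)) ≤
      Real.exp (k * logNormSum F n x) := by
  rw [Real.exp_nat_mul]
  exact (wedgeNorm_le_opNorm_pow k _).trans
    (pow_le_pow_left₀ (norm_nonneg _) (norm_bundleIterate_le F n x) k)

lemma wedgeNorm_bundleIterate_add_le (k m n : ℕ) (x : X) :
    wedgeNorm k (bundleIterate F (m + n) x : E x →ₗ[ℝ] E (f^[m + n] x)) ≤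
      wedgeNorm k (bundleIterate F n (f^[m] x) : E (f^[m] x) →ₗ[ℝ] E (f^[n] (f^[m] x))) *
        wedgeNorm k (bundleIterate F m x : E x →ₗ[ℝ] E (f^[m] x)) := by
  have := congrArg (fun p : Σ y, E x →L[ℝ] E y ↦ wedgeNorm k (p.2 : E x →ₗ[ℝ] E p.1))
    (bundleIterate_add F m n x)
  dsimp only at this
  rw [this]
  exact wedgeNorm_comp_le k _ _

/-- Submultiplicativity of `‖⋀^k ·‖`, with an additive normalization that keeps each factor at most
`1`, so that `negLog` is additive. -/
lemma isSuperadditive_wedgeCost (k : ℕ) : IsSuperadditive f (wedgeCost F k) := by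
  intro m n x
  unfold wedgeCost
  rw [← negLog_mul (mul_nonneg (wedgeNorm_nonneg _ _) (Real.exp_pos _).le)
    (mul_exp_neg_le_one (wedgeNorm_bundleIterate_le F k m x))
    (mul_exp_neg_le_one (wedgeNorm_bundleIterate_le F k n _))]
  refine negLog_anti ?_
  have h1 : Real.exp (-(k * logNormSum F (m + n) x)) =
      Real.exp (-(k * logNormSum F m x)) * Real.exp (-(k * logNormSum F n (f^[m] x))) := by
    rw [logNormSum_add, ← Real.exp_add]
    ring_nf
  rw [h1, mul_mul_mul_comm]
  refine mul_le_mul_of_nonneg_right ?_ (by positivity)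
  rw [mul_comm (wedgeNorm _ _)]
  exact wedgeNorm_bundleIterate_add_le F k m n x

lemma singularCost_mono : Monotone (singularCost F) := fun _ _ hij n x ↦
  negLog_anti (mul_le_mul_of_nonneg_right
    (LinearMap.singularValues_antitone (bundleIterate F n x : E x →ₗ[ℝ] E (f^[n] x)) hij)
    (Real.exp_pos _).le)

lemma wedgeCost_eq_sum {k : ℕ} (n : ℕ) {x : X} (hk : k ≤ finrank ℝ (E x)) :
    wedgeCost F k n x = ∑ i ∈ Finset.range k, singularCost F i n x := by
  unfold wedgeCost singularCost
  rw [wedgeNorm_eq_prod_singularValues hk, ← negLog_prod]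
  · rw [Finset.prod_mul_distrib, Finset.prod_const, Finset.card_range, ← Real.exp_nat_mul]
    ring_nf
  · exact fun i _ ↦ mul_nonneg (LinearMap.singularValues_nonneg _ _) (Real.exp_pos _).le
  · exact fun i _ ↦ mul_exp_neg_le_one
      ((singularValues_le_opNorm _ i).trans (norm_bundleIterate_le F n x))

/-- Writes the growth as a difference of two nonnegative sequences that converge separately; the
first has a finite limit almost everywhere when `log⁺ ‖F‖` is integrable, so the difference
converges. -/
lemma singularGrowth_eq (i : ℕ) {n : ℕ} (hn : 0 < n) (x : X) :
    singularGrowth F i n x = ((ENNReal.ofReal (logNormSum F n x) / n : ℝ≥0∞) : EReal) -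
      ((singularCost F i n x / n : ℝ≥0∞) : EReal) := by
  have hn' : ((n : ℝ≥0∞)⁻¹ : ℝ≥0∞) = ENNReal.ofReal (n : ℝ)⁻¹ := by
    rw [ENNReal.ofReal_inv_of_pos (by positivity), ENNReal.ofReal_natCast]
  have hc : (((n : ℝ≥0∞)⁻¹ : ℝ≥0∞) : EReal) = ((n : ℝ)⁻¹ : ℝ) := by
    rw [hn', EReal.coe_ennreal_ofReal, max_eq_left (by positivity)]
  have hpos : (0 : EReal) ≤ (((n : ℝ≥0∞)⁻¹ : ℝ≥0∞) : EReal) := EReal.coe_ennreal_nonneg _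
  have hfin : (((n : ℝ≥0∞)⁻¹ : ℝ≥0∞) : EReal) ≠ ⊤ := by
    rw [hc]
    exact EReal.coe_ne_top _
  rw [singularGrowth, ← hc, extLog_eq_sub_negLog (logNormSum_nonneg F n x)
    ((singularValues_le_opNorm _ i).trans (norm_bundleIterate_le F n x)), sub_eq_add_neg,
    EReal.left_distrib_of_nonneg_of_ne_top hpos hfin, mul_neg, ← EReal.coe_ennreal_mul,
    ← EReal.coe_ennreal_mul, mul_comm, mul_comm (n : ℝ≥0∞)⁻¹]
  rfl

lemma tendsto_singularGrowth {i : ℕ} {x : X} {a s : ℝ≥0∞} (ha : a ≠ ⊤)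
    (h1 : Tendsto (fun n : ℕ ↦ ENNReal.ofReal (logNormSum F n x) / n) atTop (𝓝 a))
    (h2 : Tendsto (fun n : ℕ ↦ singularCost F i n x / n) atTop (𝓝 s)) :
    Tendsto (fun n ↦ singularGrowth F i n x) atTop (𝓝 ((a : EReal) - s)) := by
  refine (EReal.tendsto_coe_sub_coe h1 h2 ha).congr' ?_
  filter_upwards [eventually_gt_atTop 0] with n hn
  exact (singularGrowth_eq F i hn x).symm

variable [MeasurableSpace X] {μ : Measure X} [IsProbabilityMeasure μ]

lemma measurable_wedgeCost (hf : Measurable f) (hr : Measurable fun x ↦ ‖F x‖) {k n : ℕ}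
    (hm : Measurable fun x ↦ wedgeNorm k (bundleIterate F n x : E x →ₗ[ℝ] E (f^[n] x))) :
    Measurable (wedgeCost F k n) :=
  continuous_negLog.measurable.comp (hm.mul
    (Real.measurable_exp.comp ((measurable_logNormSum F hf hr n).const_mul _).neg))

/-- The growth rates of the singular values of the iterates. -/
theorem exists_growthRates {d : ℕ} (hd : ∀ x, finrank ℝ (E x) = d) (hf : MeasurePreserving f μ μ)
    (hr : Measurable fun x ↦ ‖F x‖)
    (hm : ∀ k n, Measurable fun x ↦
      wedgeNorm k (bundleIterate F n x : E x →ₗ[ℝ] E (f^[n] x))) :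
    ∃ (a : X → ℝ≥0∞) (s : ℕ → X → ℝ≥0∞), Measurable a ∧ (∀ i, Measurable (s i)) ∧
      ∫⁻ x, a x ∂μ = ∫⁻ x, ENNReal.ofReal (Real.posLog ‖F x‖) ∂μ ∧
      (∀ k ≤ d, ∑ i ∈ Finset.range k, ∫⁻ x, s i x ∂μ = IsSuperadditive.rate μ (wedgeCost F k)) ∧
      (∀ᵐ x ∂μ, Tendsto (fun n : ℕ ↦ ENNReal.ofReal (logNormSum F n x) / n) atTop (𝓝 (a x))) ∧
      (∀ᵐ x ∂μ, ∀ i < d, Tendsto (fun n : ℕ ↦ singularCost F i n x / n) atTop (𝓝 (s i x))) ∧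
      (Ergodic f μ → ∀ᵐ x ∂μ, a x = ∫⁻ x, a x ∂μ ∧ ∀ i < d, s i x = ∫⁻ x, s i x ∂μ) := by
  have hsr : IsSuperadditive f fun n x ↦ ENNReal.ofReal (logNormSum F n x) := fun m n x ↦ by
    dsimp only
    rw [logNormSum_add, ENNReal.ofReal_add (logNormSum_nonneg F m x) (logNormSum_nonneg F n _)]
  have hmr : ∀ n, Measurable fun x ↦ ENNReal.ofReal (logNormSum F n x) := fun n ↦
    ENNReal.measurable_ofReal.comp (measurable_logNormSum F hf.measurable hr n)
  have hmw : ∀ k n, Measurable (wedgeCost F k n) := fun k n ↦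
    measurable_wedgeCost F hf.measurable hr (hm k n)
  obtain ⟨a, ha, hlim, hint⟩ := hsr.exists_tendsto hf hmr
  choose H hHm hH hHi using fun k ↦ (isSuperadditive_wedgeCost F k).exists_tendsto hf (hmw k)
  set s : ℕ → X → ℝ≥0∞ := fun i x ↦ if H i x = ⊤ then ⊤ else H (i + 1) x - H i x with hs
  have hsm : ∀ i, Measurable (s i) := fun i ↦
    Measurable.ite (hHm i (measurableSet_singleton ⊤)) measurable_const
      ((hHm (i + 1)).sub (hHm i))
  have hae : ∀ᵐ x ∂μ, (∀ i < d, Tendsto (fun n : ℕ ↦ singularCost F i n x / n) atTop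
      (𝓝 (s i x))) ∧ ∀ k ≤ d, ∑ i ∈ Finset.range k, s i x = H k x := by
    filter_upwards [ae_all_iff.2 hH] with x hx
    refine exists_tendsto_div_of_tendsto_sum_div (a := fun i n ↦ singularCost F i n x)
      (H := fun k ↦ H k x) (fun i j hij n ↦ singularCost_mono F hij n x) fun k hk ↦ ?_
    refine (hx k).congr fun n ↦ ?_
    rw [wedgeCost_eq_sum F n (hk.trans (hd x).ge)]
  refine ⟨a, s, ha, hsm, ?_, fun k hk ↦ ?_, hlim, hae.mono fun x hx ↦ hx.1, fun herg ↦ ?_⟩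
  · rw [hint]
    have : ∀ n : ℕ, ∫⁻ x, ENNReal.ofReal (logNormSum F n x) ∂μ =
        n * ∫⁻ x, ENNReal.ofReal (Real.posLog ‖F x‖) ∂μ := fun n ↦ by
      rw [← hf.lintegral_sum_range (w := fun x ↦ ENNReal.ofReal (Real.posLog ‖F x‖))
        (ENNReal.measurable_ofReal.comp (Real.continuous_posLog.measurable.comp hr)) n]
      refine lintegral_congr fun x ↦ ?_
      rw [logNormSum, birkhoffSum, ENNReal.ofReal_sum_of_nonneg fun _ _ ↦ Real.posLog_nonneg]
    simp only [IsSuperadditive.rate, this]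
    simp only [ENNReal.natCast_mul_div_cancel_left (Nat.succ_pos _), ciSup_const]
  · rw [← hHi, ← lintegral_finsetSum _ fun i _ ↦ hsm i]
    exact lintegral_congr_ae (hae.mono fun x hx ↦ hx.2 k hk)
  · have h1 := herg.ae_eq_lintegral_of_tendsto hsr hmr hlim
    have h2 := fun k ↦ herg.ae_eq_lintegral_of_tendsto (isSuperadditive_wedgeCost F k) (hmw k)
      (hH k)
    -- `s i` is a pointwise function of `H i` and `H (i + 1)`, which are constant almost everywhere.
    have h3 : ∀ i, ∀ᵐ x ∂μ, s i x = ∫⁻ x, s i x ∂μ := fun i ↦ by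
      have : ∀ᵐ x ∂μ, s i x = if ∫⁻ x, H i x ∂μ = ⊤ then ⊤ else
          ∫⁻ x, H (i + 1) x ∂μ - ∫⁻ x, H i x ∂μ := by
        filter_upwards [h2 i, h2 (i + 1)] with x hx hx'
        simp only [hs]
        rw [← hx, ← hx']
      have hc : ∫⁻ x, s i x ∂μ = if ∫⁻ x, H i x ∂μ = ⊤ then ⊤ else
          ∫⁻ x, H (i + 1) x ∂μ - ∫⁻ x, H i x ∂μ := by
        rw [lintegral_congr_ae this]
        simp
      rw [hc]
      exact this
    filter_upwards [h1, ae_all_iff.2 h3] with x hx hx' using ⟨hx, fun i _ ↦ hx' i⟩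

lemma EReal.sum_coe_sub_coe (a : ℝ≥0∞) (s : ℕ → ℝ≥0∞) (k : ℕ) :
    ∑ i ∈ Finset.range k, ((a : EReal) - s i) =
      ((k * a : ℝ≥0∞) : EReal) - ((∑ i ∈ Finset.range k, s i : ℝ≥0∞) : EReal) := by
  induction k with
  | zero => simp
  | succ k ih =>
    have h1 : ∀ x : ℝ≥0∞, (x : EReal) ≠ ⊥ := EReal.coe_ennreal_ne_bot
    rw [Finset.sum_range_succ, Finset.sum_range_succ, ih, EReal.coe_ennreal_add, sub_eq_add_neg,
      sub_eq_add_neg, sub_eq_add_neg, EReal.neg_add (.inl (h1 _)) (.inr (h1 _)), sub_eq_add_neg,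
      add_add_add_comm, ← EReal.coe_ennreal_add, Nat.cast_succ, add_mul, one_mul]

/-- The existence of the Lyapunov exponents, and the value of their sums. -/
theorem lyapunovExponent_spec {d : ℕ} (hd : ∀ x, finrank ℝ (E x) = d)
    (hf : MeasurePreserving f μ μ) (hr : Measurable fun x ↦ ‖F x‖)
    (hm : ∀ k n, Measurable fun x ↦
      wedgeNorm k (bundleIterate F n x : E x →ₗ[ℝ] E (f^[n] x)))
    (hint : ∫⁻ x, ENNReal.ofReal (Real.posLog ‖F x‖) ∂μ ≠ ⊤) :
    (∀ i < d, ∀ᵐ x ∂μ,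
      Tendsto (fun n ↦ singularGrowth F i n x) atTop (𝓝 (pointwiseExponent F i x))) ∧
    (Ergodic f μ → ∀ i < d, ∀ᵐ x ∂μ,
      Tendsto (fun n ↦ singularGrowth F i n x) atTop (𝓝 (lyapunovExponent F μ i))) ∧
    ∀ k ≤ d, ∑ i ∈ Finset.range k, lyapunovExponent F μ i =
      ((k * ∫⁻ x, ENNReal.ofReal (Real.posLog ‖F x‖) ∂μ : ℝ≥0∞) : EReal) -
        ((IsSuperadditive.rate μ (wedgeCost F k) : ℝ≥0∞) : EReal) := by
  obtain ⟨a, s, ham, hsm, hai, hsi, hlima, hlims, herg⟩ := exists_growthRates F hd hf hr hm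
  have hai' : ∫⁻ x, a x ∂μ ≠ ⊤ := hai ▸ hint
  have hlim : ∀ i < d, ∀ᵐ x ∂μ, Tendsto (fun n ↦ singularGrowth F i n x) atTop
      (𝓝 ((a x : EReal) - s i x)) := fun i hi ↦ by
    filter_upwards [hlima, hlims, ae_lt_top ham hai'] with x h1 h2 h3
    exact tendsto_singularGrowth F h3.ne h1 (h2 i hi)
  have hpt : ∀ i < d, ∀ᵐ x ∂μ, pointwiseExponent F i x = (a x : EReal) - s i x := fun i hi ↦
    (hlim i hi).mono fun x hx ↦ hx.limsup_eq
  have hly : ∀ i < d, lyapunovExponent F μ i =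
      ((∫⁻ x, a x ∂μ : ℝ≥0∞) : EReal) - ((∫⁻ x, s i x ∂μ : ℝ≥0∞) : EReal) := fun i hi ↦
    extIntegral_eq_sub ham (hsm i) hai' (hpt i hi)
  refine ⟨fun i hi ↦ ?_, fun he i hi ↦ ?_, fun k hk ↦ ?_⟩
  · filter_upwards [hlim i hi, hpt i hi] with x h1 h2
    rwa [h2]
  · filter_upwards [hlim i hi, herg he] with x h1 h2
    rwa [hly i hi, ← h2.1, ← h2.2 i hi]
  · rw [← hsi k hk, ← hai, ← EReal.sum_coe_sub_coe]
    exact Finset.sum_congr rfl fun i hi ↦ hly i ((Finset.mem_range.1 hi).trans_le hk)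

end Growth

/-! ### The Gram–Schmidt recursion. -/

section GramSchmidt

open InnerProductSpace

lemma gramSchmidt_eq_sub_sum {V : Type*} [NormedAddCommGroup V] [InnerProductSpace ℝ V] {k : ℕ}
    (v : Fin k → V) (j : Fin k) :
    gramSchmidt ℝ v j = v j - ∑ i ∈ Finset.Iio j,
      (inner ℝ (gramSchmidt ℝ v i) (v j) / ‖gramSchmidt ℝ v i‖ ^ 2) • gramSchmidt ℝ v i := by
  rw [eq_sub_iff_add_eq]
  exact (gramSchmidt_def'' ℝ v j).symm

end GramSchmidt

/-! ### Measurable orthonormal trivializations. -/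

section Trivialization

open Module InnerProductSpace

variable {X : Type u} [MeasurableSpace X] {E : X → Type v}
  [∀ x, NormedAddCommGroup (E x)] [∀ x, InnerProductSpace ℝ (E x)]
  [MeasurableSpace (BundleTotal E)] {d : ℕ}

/-- A global linear trivialization, not necessarily isometric. -/
lemma IsMeasurableEuclideanBundle.exists_measurableEmbedding
    (hE : IsMeasurableEuclideanBundle E d) :
    ∃ e : ∀ x, E x ≃ₗ[ℝ] (Fin d → ℝ), MeasurableEmbedding fun p : X × (Fin d → ℝ) ↦
      (⟨p.1, (e p.1).symm p.2⟩ : BundleTotal E) := by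
  classical
  obtain ⟨U, e, hU, hcover, he⟩ := hE.exists_trivialization
  have hex : ∀ x, ∃ n, x ∈ U n := fun x ↦ Set.mem_iUnion.1 (hcover ▸ Set.mem_univ x)
  -- The charts are glued by using at each point the first one that contains it.
  set N : X → ℕ := fun x ↦ Nat.find (hex x) with hN
  have hNU : ∀ x, x ∈ U (N x) := fun x ↦ Nat.find_spec (hex x)
  have hNm : Measurable N := measurable_find hex hU
  have hNs : ∀ n, MeasurableSet {p : X × (Fin d → ℝ) | N p.1 = n} := fun n ↦
    (hNm.comp measurable_fst) (measurableSet_singleton n)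
  let e' : ∀ x, E x ≃ₗ[ℝ] (Fin d → ℝ) := fun x ↦ e (N x) ⟨x, hNU x⟩
  have he' : ∀ n x (hx : x ∈ U n), N x = n → e' x = e n ⟨x, hx⟩ := by
    rintro _ x hx rfl
    rfl
  let j : ∀ n, U n × (Fin d → ℝ) → X × (Fin d → ℝ) := fun n ↦ Prod.map Subtype.val id
  have hj : ∀ n, MeasurableEmbedding (j n) := fun n ↦
    (MeasurableEmbedding.subtype_coe (hU n)).prodMap .id
  refine ⟨e', ?_, fun s hs ↦ ?_, fun {t} ht ↦ ?_⟩
  · rintro ⟨x, v⟩ ⟨y, w⟩ h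
    simp only [BundleTotal.mk.injEq] at h
    obtain ⟨rfl, h⟩ := h
    rw [heq_eq_eq, EmbeddingLike.apply_eq_iff_eq] at h
    rw [h]
  · have : (fun p : X × (Fin d → ℝ) ↦ (⟨p.1, (e' p.1).symm p.2⟩ : BundleTotal E)) ⁻¹' s =
        ⋃ n, {p : X × (Fin d → ℝ) | N p.1 = n} ∩ j n '' ((fun p : U n × (Fin d → ℝ) ↦
          (⟨p.1, (e n p.1).symm p.2⟩ : BundleTotal E)) ⁻¹' s) := by
      ext ⟨x, v⟩
      simp only [Set.mem_preimage, Set.mem_iUnion, Set.mem_inter_iff, Set.mem_ofPred_eq,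
        Set.mem_image]
      constructor
      · intro h
        exact ⟨N x, rfl, ⟨⟨x, hNU x⟩, v⟩, h, rfl⟩
      · rintro ⟨n, hn, ⟨⟨y, hy⟩, w⟩, h, heq⟩
        obtain ⟨rfl, rfl⟩ : y = x ∧ w = v := Prod.mk.inj heq
        rwa [he' n y hy hn]
    rw [this]
    exact .iUnion fun n ↦ (hNs n).inter ((hj n).measurableSet_image.2 ((he n).measurable hs))
  · have : (fun p : X × (Fin d → ℝ) ↦ (⟨p.1, (e' p.1).symm p.2⟩ : BundleTotal E)) '' t =
        ⋃ n, (fun p : U n × (Fin d → ℝ) ↦ (⟨p.1, (e n p.1).symm p.2⟩ : BundleTotal E)) ''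
          (j n ⁻¹' (t ∩ {p : X × (Fin d → ℝ) | N p.1 = n})) := by
      ext q
      simp only [Set.mem_iUnion, Set.mem_image, Set.mem_preimage, Set.mem_inter_iff,
        Set.mem_ofPred_eq]
      constructor
      · rintro ⟨⟨x, v⟩, h, rfl⟩
        exact ⟨N x, ⟨⟨x, hNU x⟩, v⟩, ⟨h, rfl⟩, rfl⟩
      · rintro ⟨n, ⟨⟨y, hy⟩, w⟩, ⟨h, hn⟩, rfl⟩
        refine ⟨⟨y, w⟩, h, ?_⟩
        dsimp only
        rw [he' n y hy hn]
    rw [this]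
    exact .iUnion fun n ↦ (he n).measurableSet_image.2 ((hj n).measurable (ht.inter (hNs n)))

variable [∀ x, FiniteDimensional ℝ (E x)]

/-- A measurable orthonormal frame. -/
theorem IsMeasurableEuclideanBundle.exists_linearIsometryEquiv
    (hE : IsMeasurableEuclideanBundle E d) :
    ∃ B : ∀ x, EuclideanSpace ℝ (Fin d) ≃ₗᵢ[ℝ] E x,
      Measurable (fun p : X × EuclideanSpace ℝ (Fin d) ↦ (⟨p.1, B p.1 p.2⟩ : BundleTotal E)) ∧
      Measurable fun p : BundleTotal E ↦ (p.base, (B p.base).symm p.vec) := by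
  obtain ⟨e, he⟩ := hE.exists_measurableEmbedding
  have hinv : Measurable fun p : BundleTotal E ↦ (p.base, e p.base p.vec) := by
    rw [← he.measurable_comp_iff]
    convert measurable_id using 1
    funext p
    simp
  have hnorm : Measurable fun q : X × (Fin d → ℝ) ↦ ‖(e q.1).symm q.2‖ :=
    hE.measurable_norm.comp he.measurable
  -- Only the norm is given as measurable; polarization in the linear trivialization yields the
  -- inner product.
  have hinner : Measurable fun q : X × (Fin d → ℝ) × (Fin d → ℝ) ↦
      (inner ℝ ((e q.1).symm q.2.1) ((e q.1).symm q.2.2) : ℝ) := by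
    simp only [real_inner_eq_norm_add_mul_self_sub_norm_mul_self_sub_norm_mul_self_div_two,
      ← map_add]
    have h1 := hnorm.comp (g := fun q : X × (Fin d → ℝ) ↦ ‖(e q.1).symm q.2‖)
      (f := fun q : X × (Fin d → ℝ) × (Fin d → ℝ) ↦ (q.1, q.2.1 + q.2.2)) (by fun_prop)
    have h2 := hnorm.comp (g := fun q : X × (Fin d → ℝ) ↦ ‖(e q.1).symm q.2‖)
      (f := fun q : X × (Fin d → ℝ) × (Fin d → ℝ) ↦ (q.1, q.2.1)) (by fun_prop)
    have h3 := hnorm.comp (g := fun q : X × (Fin d → ℝ) ↦ ‖(e q.1).symm q.2‖)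
      (f := fun q : X × (Fin d → ℝ) × (Fin d → ℝ) ↦ (q.1, q.2.2)) (by fun_prop)
    exact (((h1.mul h1).sub (h2.mul h2)).sub (h3.mul h3)).div_const 2
  let b : ∀ x, Fin d → E x := fun x i ↦ (e x).symm (Pi.single i 1)
  have hb : ∀ x, LinearIndependent ℝ (b x) := fun x ↦ by
    convert ((Pi.basisFun ℝ (Fin d)).map (e x).symm).linearIndependent using 1
    funext i
    simp [b]
  have hdim : ∀ x, finrank ℝ (E x) = Fintype.card (Fin d) := fun x ↦ by
    rw [(e x).finrank_eq, finrank_fintype_fun_eq_card]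
  -- Gram–Schmidt is applied to the standard basis of the trivialization; its coordinates are
  -- measurable by induction on the recursion.
  have hG : ∀ j, Measurable fun x ↦ e x (gramSchmidt ℝ (b x) j) := by
    intro j
    induction j using WellFoundedLT.induction with
    | _ j ih =>
      have h2 : ∀ x, e x (gramSchmidt ℝ (b x) j) = Pi.single j 1 - ∑ i ∈ Finset.Iio j,
          (inner ℝ (gramSchmidt ℝ (b x) i) (b x j) / ‖gramSchmidt ℝ (b x) i‖ ^ 2) •
            e x (gramSchmidt ℝ (b x) i) := fun x ↦ by
        conv_lhs => rw [gramSchmidt_eq_sub_sum]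
        simp [b]
      simp only [h2]
      refine measurable_const.sub (Finset.measurable_fun_sum _ fun i hi ↦ ?_)
      have hi' := ih i (Finset.mem_Iio.1 hi)
      have hn : Measurable fun x ↦ ‖gramSchmidt ℝ (b x) i‖ := by
        have := hnorm.comp (measurable_id.prodMk hi')
        simpa [Function.comp_def] using this
      refine Measurable.smul (Measurable.div ?_ (hn.pow_const 2)) hi'
      convert hinner.comp (measurable_id.prodMk (hi'.prodMk (measurable_const (a :=
        (Pi.single j 1 : Fin d → ℝ))))) using 1
      funext x
      simp [b]
  have hGn : ∀ j, Measurable fun x ↦ ‖gramSchmidt ℝ (b x) j‖ := fun j ↦ by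
    have := hnorm.comp (measurable_id.prodMk (hG j))
    simpa [Function.comp_def] using this
  let o : ∀ x, OrthonormalBasis (Fin d) ℝ (E x) := fun x ↦
    gramSchmidtOrthonormalBasis (hdim x) (b x)
  have ho : ∀ x j, o x j = ‖gramSchmidt ℝ (b x) j‖⁻¹ • gramSchmidt ℝ (b x) j := fun x j ↦
    gramSchmidtOrthonormalBasis_apply (hdim x) fun h0 ↦ by
      have := gramSchmidtNormed_unit_length (𝕜 := ℝ) j (hb x)
      rw [h0, norm_zero] at this
      exact zero_ne_one this
  have hO : ∀ j, Measurable fun x ↦ e x (o x j) := fun j ↦ by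
    simp only [ho, map_smul]
    exact (hGn j).inv.smul (hG j)
  refine ⟨fun x ↦ (o x).repr.symm, ?_, ?_⟩
  · have h1 : Measurable fun p : X × EuclideanSpace ℝ (Fin d) ↦
        (p.1, ∑ j, p.2 j • e p.1 (o p.1 j)) := by
      refine measurable_fst.prodMk (Finset.measurable_fun_sum _ fun j _ ↦ ?_)
      exact (by fun_prop : Measurable fun p : X × EuclideanSpace ℝ (Fin d) ↦ p.2 j).smul
        ((hO j).comp measurable_fst)
    convert he.measurable.comp h1 using 1
    funext p
    simp only [Function.comp_apply, map_sum, map_smul, LinearEquiv.symm_apply_apply,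
      ← OrthonormalBasis.sum_repr_symm]
  · have hbase : Measurable fun p : BundleTotal E ↦ p.base := hinv.fst
    refine hbase.prodMk ?_
    refine (WithLp.measurable_toLp 2 (Fin d → ℝ)).comp
      (f := fun p : BundleTotal E ↦ ((o p.base).repr p.vec).ofLp)
      (measurable_pi_lambda _ fun j ↦ ?_)
    simp only [OrthonormalBasis.repr_apply_apply]
    convert hinner.comp (hbase.prodMk (((hO j).comp hbase).prodMk hinv.snd)) using 1
    funext p
    simp

end Trivialization

/-! ### Orthonormal frames and the action of linear maps on them. -/

section Stiefel

open Module InnerProductSpace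

variable {V : Type v} [NormedAddCommGroup V] [InnerProductSpace ℝ V] {k : ℕ}

variable (V k) in
/-- The Stiefel manifold of orthonormal `k`-frames. -/
abbrev Stiefel : Type v := {v : Fin k → V // Orthonormal ℝ v}

lemma continuousOn_gramSchmidt (j : Fin k) :
    ContinuousOn (fun v : Fin k → V ↦ gramSchmidt ℝ v j) {v | LinearIndependent ℝ v} := by
  induction j using WellFoundedLT.induction with
  | _ j ih =>
    simp only [gramSchmidt_eq_sub_sum _ j]
    refine ContinuousOn.sub (by fun_prop) (continuousOn_finsetSum _ fun i hi ↦ ?_)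
    have hi' := ih i (Finset.mem_Iio.1 hi)
    refine ContinuousOn.smul (ContinuousOn.div (hi'.inner (by fun_prop)) (hi'.norm.pow 2) ?_) hi'
    intro v hv
    exact pow_ne_zero 2 (norm_ne_zero_iff.2 (gramSchmidt_ne_zero i hv))

lemma continuousOn_gramSchmidtNormed :
    ContinuousOn (fun v : Fin k → V ↦ gramSchmidtNormed ℝ v) {v | LinearIndependent ℝ v} := by
  refine continuousOn_pi.2 fun j ↦ ?_
  have h := continuousOn_gramSchmidt (V := V) j
  refine ContinuousOn.smul (ContinuousOn.inv₀ h.norm ?_) h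
  intro v hv
  exact norm_ne_zero_iff.2 (gramSchmidt_ne_zero j hv)

lemma mem_span_gramSchmidtNormed (v : Fin k → V) (i : Fin k) :
    v i ∈ Submodule.span ℝ (Set.range (gramSchmidtNormed ℝ v)) := by
  rw [span_gramSchmidtNormed_range, span_gramSchmidt]
  exact Submodule.subset_span (Set.mem_range_self i)

/-- The parameters of the action on frames: a linear map and a normalization of its Jacobian. -/
abbrev FrameParam (V : Type v) [NormedAddCommGroup V] [InnerProductSpace ℝ V] : Type v :=
  (V →L[ℝ] V) × ℝ

lemma continuous_image_frame :
    Continuous fun z : FrameParam V × Stiefel V k ↦ (z.1.1 ∘ z.2.1 : Fin k → V) :=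
  continuous_pi fun i ↦ (continuous_fst.comp continuous_fst).clm_apply
    ((continuous_apply i).comp (continuous_subtype_val.comp continuous_snd))

open Classical in
/-- The action of a linear map on orthonormal frames by Gram–Schmidt orthonormalization. -/
noncomputable def frameAction (z : FrameParam V × Stiefel V k) : Stiefel V k :=
  if h : LinearIndependent ℝ (z.1.1 ∘ z.2.1) then
    ⟨gramSchmidtNormed ℝ (z.1.1 ∘ z.2.1), gramSchmidtNormed_orthonormal h⟩
  else z.2

variable (V k) in
/-- The nondegenerate parameters. -/
def regularFrames : Set (FrameParam V × Stiefel V k) := {z | LinearIndependent ℝ (z.1.1 ∘ z.2.1)}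

lemma continuousOn_frameAction : ContinuousOn (frameAction (V := V) (k := k))
    (regularFrames V k) := by
  refine (Topology.IsInducing.subtypeVal
    (t := {v : Fin k → V | Orthonormal ℝ v})).continuousOn_iff.2 ?_
  refine (continuousOn_gramSchmidtNormed.comp continuous_image_frame.continuousOn
    fun z hz ↦ hz).congr fun z hz ↦ ?_
  have hz' : LinearIndependent ℝ (z.1.1 ∘ z.2.1) := hz
  simp [frameAction, hz']

variable [FiniteDimensional ℝ V]

lemma continuous_wedgeVolume : Continuous (wedgeVolume : (Fin k → V) → ℝ) := by
  have : (wedgeVolume : (Fin k → V) → ℝ) = fun v ↦ √(Matrix.gram ℝ v).det :=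
    funext wedgeVolume_eq_sqrt
  rw [this]
  refine Real.continuous_sqrt.comp (Continuous.matrix_det ?_)
  refine continuous_matrix fun i j ↦ ?_
  simp only [Matrix.gram_apply]
  fun_prop

instance : CompactSpace (Stiefel V k) := by
  suffices IsCompact {v : Fin k → V | Orthonormal ℝ v} from isCompact_iff_compactSpace.1 this
  refine Metric.isCompact_of_isClosed_isBounded ?_ ?_
  · have : {v : Fin k → V | Orthonormal ℝ v} =
        ⋂ i, ⋂ j, {v : Fin k → V | inner ℝ (v i) (v j) = if i = j then (1 : ℝ) else 0} := by
      ext v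
      simp only [Set.mem_iInter]
      exact orthonormal_iff_ite
    rw [this]
    exact isClosed_iInter fun i ↦ isClosed_iInter fun j ↦
      isClosed_eq (by fun_prop) continuous_const
  · refine (Metric.isBounded_closedBall (x := (0 : Fin k → V)) (r := 1)).subset fun v hv ↦ ?_
    rw [mem_closedBall_zero_iff, pi_norm_le_iff_of_nonneg zero_le_one]
    exact fun i ↦ (hv.1 i).le

lemma nonempty_stiefel (hk : k ≤ finrank ℝ V) : Nonempty (Stiefel V k) :=
  let ⟨v, hv, _⟩ := exists_orthonormal_wedgeVolume_comp_eq hk (LinearMap.id : V →ₗ[ℝ] V)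
  ⟨⟨v, hv⟩⟩

section Action

/-- The normalized negative logarithm of the Jacobian. -/
noncomputable def frameCost (z : FrameParam V × Stiefel V k) : ENNReal :=
  negLog (wedgeVolume (z.1.1 ∘ z.2.1) * Real.exp (-z.1.2))

lemma isOpen_regularFrames : IsOpen (regularFrames V k) := by
  have : regularFrames V k =
      (fun z : FrameParam V × Stiefel V k ↦ wedgeVolume (z.1.1 ∘ z.2.1)) ⁻¹' Set.Ioi 0 := by
    ext z
    exact wedgeVolume_pos_iff.symm
  rw [this]
  exact isOpen_Ioi.preimage (continuous_wedgeVolume.comp continuous_image_frame)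

lemma continuous_frameCost : Continuous (frameCost (V := V) (k := k)) :=
  continuous_negLog.comp ((continuous_wedgeVolume.comp continuous_image_frame).mul
    (by fun_prop))

/-- The discontinuities of `frameAction` can only occur where the cost is infinite, so they are null
for any measure of finite cost. -/
lemma frameCost_eq_top {z : FrameParam V × Stiefel V k} (hz : z ∉ regularFrames V k) :
    frameCost z = ⊤ := by
  have : wedgeVolume (z.1.1 ∘ z.2.1) = 0 := by
    by_contra h
    exact hz (wedgeVolume_ne_zero_iff.1 h)
  rw [frameCost, this, zero_mul, negLog_zero]

/-- The action is continuous on the open set of nondegenerate parameters; elsewhere its arbitrary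
default value is the frame itself, a continuous function too. -/
lemma measurable_frameAction [MeasurableSpace V] [BorelSpace V] :
    Measurable (frameAction (V := V) (k := k)) := by
  classical
  have : frameAction (V := V) (k := k) = (regularFrames V k).piecewise frameAction Prod.snd := by
    funext z
    by_cases hz : z ∈ regularFrames V k
    · rw [Set.piecewise_eq_of_mem _ _ _ hz]
    · rw [Set.piecewise_eq_of_notMem _ _ _ hz]
      exact dif_neg hz
  rw [this]
  exact continuousOn_frameAction.measurable_piecewise continuous_snd.continuousOn
    isOpen_regularFrames.measurableSet

end Action

/-- The norm is attained at singular vectors, and continuity moves the maximum to a dense sequence.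
The countable supremum serves for measurability and for measurable selection. -/
lemma isLUB_wedgeVolume {q : ℕ → Stiefel V k} (hq : DenseRange q) (hk : k ≤ finrank ℝ V)
    (L : V →L[ℝ] V) :
    IsLUB (Set.range fun n ↦ wedgeVolume (L ∘ (q n).1)) (wedgeNorm k (L : V →ₗ[ℝ] V)) := by
  refine ⟨?_, fun b hb ↦ ?_⟩
  · rintro _ ⟨n, rfl⟩
    have := wedgeVolume_comp_le (L : V →ₗ[ℝ] V) (q n).1
    rwa [(q n).2.wedgeVolume_eq_one, mul_one] at this
  · obtain ⟨v, hv, hvL⟩ := exists_orthonormal_wedgeVolume_comp_eq hk (L : V →ₗ[ℝ] V)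
    rw [wedgeNorm_eq_prod_singularValues hk, ← hvL]
    have hcont : Continuous fun s : Stiefel V k ↦ wedgeVolume (L ∘ s.1) :=
      continuous_wedgeVolume.comp (continuous_pi fun i ↦ L.continuous.comp
        ((continuous_apply i).comp continuous_subtype_val))
    by_contra! hlt
    obtain ⟨n, hn⟩ := hq.exists_mem_open (isOpen_lt continuous_const hcont) ⟨⟨v, hv⟩, hlt⟩
    exact absurd (hb ⟨n, rfl⟩) (not_le.2 hn)

lemma measurable_wedgeVolume_comp [MeasurableSpace V] [BorelSpace V] (v : Fin k → V) :
    Measurable fun L : V →L[ℝ] V ↦ wedgeVolume (L ∘ v) :=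
  (continuous_wedgeVolume.comp (continuous_pi fun _ ↦ by
    exact continuous_id.clm_apply continuous_const)).measurable

lemma measurable_wedgeNorm [MeasurableSpace V] [BorelSpace V] (k : ℕ) :
    Measurable fun L : V →L[ℝ] V ↦ wedgeNorm k (L : V →ₗ[ℝ] V) := by
  rcases le_or_gt k (finrank ℝ V) with hk | hk
  · have := nonempty_stiefel hk
    exact Measurable.isLUB (fun n ↦ measurable_wedgeVolume_comp _)
      (isLUB_wedgeVolume (TopologicalSpace.denseRange_denseSeq (Stiefel V k)) hk)
  · have : ∀ L : V →L[ℝ] V, wedgeNorm k (L : V →ₗ[ℝ] V) = 0 := fun L ↦ by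
      refine le_antisymm ((wedgeNorm_le_prod_singularValues k _).trans_eq ?_) (wedgeNorm_nonneg _ _)
      exact Finset.prod_eq_zero (Finset.mem_range.2 hk)
        (LinearMap.singularValues_of_finrank_le _ le_rfl)
    simp only [this, measurable_const]

end Stiefel

/-! ### Averages along orbits. -/

section EmpiricalMeasures

open scoped ENNReal

variable {X Z : Type*} [MeasurableSpace X] [MeasurableSpace Z]

/-- The averages of the push-forwards of a measure under the first iterates of a map. -/
noncomputable def empiricalMeasure (T : Z → Z) (κ : Measure Z) (n : ℕ) : Measure Z :=
  ((n : ℝ≥0∞)⁻¹) • ∑ j ∈ Finset.range n, κ.map T^[j]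

variable {T : Z → Z} {κ : Measure Z}

lemma lintegral_empiricalMeasure (hT : Measurable T) {g : Z → ℝ≥0∞} (hg : Measurable g) (n : ℕ) :
    ∫⁻ z, g z ∂(empiricalMeasure T κ n) =
      (∫⁻ z, ∑ j ∈ Finset.range n, g (T^[j] z) ∂κ) / n := by
  rw [empiricalMeasure, lintegral_smul_measure, lintegral_finsetSum_measure,
    lintegral_finsetSum (f := fun j z ↦ g (T^[j] z)) _ fun j _ ↦ hg.comp (hT.iterate j),
    smul_eq_mul, mul_comm, div_eq_mul_inv]
  congr 1
  exact Finset.sum_congr rfl fun j _ ↦ lintegral_map hg (hT.iterate j)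

lemma empiricalMeasure_apply (hT : Measurable T) {s : Set Z} (hs : MeasurableSet s) (n : ℕ) :
    empiricalMeasure T κ n s = (∑ j ∈ Finset.range n, κ (T^[j] ⁻¹' s)) / n := by
  rw [empiricalMeasure, Measure.smul_apply, Measure.finsetSum_apply, smul_eq_mul, mul_comm,
    div_eq_mul_inv]
  congr 1
  exact Finset.sum_congr rfl fun j _ ↦ Measure.map_apply (hT.iterate j) hs

/-- The two sums differ only in their end terms, each at most `1`. -/
lemma empiricalMeasure_le_preimage_add [IsProbabilityMeasure κ] (hT : Measurable T) {s : Set Z}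
    (hs : MeasurableSet s) (n : ℕ) :
    empiricalMeasure T κ n s ≤ empiricalMeasure T κ n (T ⁻¹' s) + (n : ℝ≥0∞)⁻¹ := by
  rw [empiricalMeasure_apply hT hs, empiricalMeasure_apply hT (hT hs), ← one_div, ← ENNReal.add_div]
  gcongr
  calc ∑ j ∈ Finset.range n, κ (T^[j] ⁻¹' s) ≤ ∑ j ∈ Finset.range (n + 1), κ (T^[j] ⁻¹' s) :=
        Finset.sum_le_sum_of_subset (Finset.range_mono n.le_succ)
    _ = ∑ j ∈ Finset.range n, κ (T^[j + 1] ⁻¹' s) + κ (T^[0] ⁻¹' s) := Finset.sum_range_succ' _ _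
    _ ≤ ∑ j ∈ Finset.range n, κ (T^[j] ⁻¹' (T ⁻¹' s)) + 1 := by
        refine add_le_add (le_of_eq (Finset.sum_congr rfl fun j _ ↦ ?_)) prob_le_one
        rw [Function.iterate_succ', Set.preimage_comp]

lemma measurePreserving_empiricalMeasure (hT : Measurable T) {f : X → X} {p : Z → X}
    {μ : Measure X} (hf : MeasurePreserving f μ μ) (hp : MeasurePreserving p κ μ)
    (hpT : ∀ z, p (T z) = f (p z)) {n : ℕ} (hn : 0 < n) :
    MeasurePreserving p (empiricalMeasure T κ n) μ := by
  have hsemi : Function.Semiconj p T f := hpT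
  refine ⟨hp.measurable, Measure.ext fun s hs ↦ ?_⟩
  rw [Measure.map_apply hp.measurable hs, empiricalMeasure_apply hT (hp.measurable hs)]
  have : ∀ j, κ (T^[j] ⁻¹' (p ⁻¹' s)) = μ s := fun j ↦ by
    rw [← Set.preimage_comp, (hsemi.iterate_right j).comp_eq]
    exact ((hf.iterate j).comp hp).measure_preimage hs.nullMeasurableSet
  simp only [this, Finset.sum_const, Finset.card_range, nsmul_eq_mul]
  exact ENNReal.natCast_mul_div_cancel_left hn

/-- The cost of an invariant measure dominates the growth rate of lower bounds for its sums. -/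
lemma IsSuperadditive.rate_le_lintegral {μ : Measure X} {m : Measure Z}
    (hT : MeasurePreserving T m m) {p : Z → X} (hp : MeasurePreserving p m μ) {g : Z → ℝ≥0∞}
    (hg : Measurable g) {h : ℕ → X → ℝ≥0∞} (hm : ∀ n, Measurable (h n))
    (hle : ∀ n z, h (n + 1) (p z) ≤ ∑ j ∈ Finset.range (n + 1), g (T^[j] z)) :
    IsSuperadditive.rate μ h ≤ ∫⁻ z, g z ∂m := by
  refine iSup_le fun n ↦ ?_
  rw [← hp.lintegral_comp (hm _)]
  calc (∫⁻ z, h (n + 1) (p z) ∂m) / ((n + 1 : ℕ) : ℝ≥0∞)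
      ≤ (∫⁻ z, ∑ j ∈ Finset.range (n + 1), g (T^[j] z) ∂m) / ((n + 1 : ℕ) : ℝ≥0∞) := by
        gcongr with z
        exact hle _ z
    _ = ∫⁻ z, g z ∂m := by
        rw [hT.lintegral_sum_range hg, ENNReal.natCast_mul_div_cancel_left n.succ_pos]

end EmpiricalMeasures

/-! ### Minimizing invariant measures on frames for a cocycle on a trivial bundle. -/

section MatrixCocycle

open scoped ENNReal
open Module InnerProductSpace

variable {X : Type u} {V : Type v} [NormedAddCommGroup V] [InnerProductSpace ℝ V]
  {k : ℕ} (f : X → X) (A : X → V →L[ℝ] V)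

/-- The parameters of the action of a cocycle on frames. -/
noncomputable def frameParam (k : ℕ) (x : X) : FrameParam V := (A x, k * Real.posLog ‖A x‖)

lemma measurable_frameParam [MeasurableSpace X] {A : X → V →L[ℝ] V} (hA : Measurable A) :
    Measurable (frameParam A k) :=
  hA.prodMk ((Real.continuous_posLog.measurable.comp hA.norm).const_mul _)

variable [FiniteDimensional ℝ V]

/-- The iterates of a cocycle on a trivial bundle. -/
noncomputable abbrev cocycle (n : ℕ) (x : X) : V →L[ℝ] V :=
  bundleIterate (E := fun _ : X ↦ V) (f := f) A n x

/-- The action of a cocycle on orthonormal frames. -/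
noncomputable def frameMap : X × Stiefel V k → X × Stiefel V k :=
  skewMap f (frameParam A k) frameAction

/-- The cost of a frame. -/
noncomputable def cocycleCost (z : X × Stiefel V k) : ℝ≥0∞ :=
  frameCost (frameParam A k z.1, z.2)

/-- The normalized negative logarithm of `‖⋀^k A^n‖`. -/
noncomputable abbrev cocycleWedgeCost (k n : ℕ) (x : X) : ℝ≥0∞ :=
  wedgeCost (E := fun _ : X ↦ V) (f := f) A k n x

/-- The chain rule for Jacobians: after one step the image frame may be replaced by its
orthonormalization, which spans the same subspace. If the image degenerates, both sides vanish
whatever the default value of the action. -/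
lemma wedgeVolume_cocycle_succ (n : ℕ) (x : X) (s : Stiefel V k) :
    wedgeVolume (cocycle f A (n + 1) x ∘ s.1) =
      wedgeVolume (A x ∘ s.1) * wedgeVolume (cocycle f A n (f x) ∘ (frameMap f A (x, s)).2.1) := by
  have h0 : cocycle f A (n + 1) x ∘ s.1 = (cocycle f A n (f x) : V →ₗ[ℝ] V) ∘ (A x ∘ s.1) := rfl
  rw [h0]
  by_cases h : LinearIndependent ℝ (A x ∘ s.1)
  · have h1 : (frameMap f A (x, s)).2.1 = gramSchmidtNormed ℝ (A x ∘ s.1) := by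
      simp [frameMap, skewMap, frameAction, frameParam, h]
    have h2 := wedgeVolume_comp_mul (mem_span_gramSchmidtNormed (A x ∘ s.1))
      (cocycle f A n (f x) : V →ₗ[ℝ] V)
    rw [(gramSchmidtNormed_orthonormal h).wedgeVolume_eq_one, mul_one] at h2
    rw [h2, h1, mul_comm]
    rfl
  · have h1 : wedgeVolume (A x ∘ s.1) = 0 := by
      by_contra h'
      exact h (wedgeVolume_ne_zero_iff.1 h')
    rw [h1, zero_mul]
    have := wedgeVolume_comp_le (cocycle f A n (f x) : V →ₗ[ℝ] V) (A x ∘ s.1)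
    rw [h1, mul_zero] at this
    exact le_antisymm this (wedgeVolume_nonneg _)

lemma wedgeVolume_cocycle_le (n : ℕ) (x : X) (s : Stiefel V k) :
    wedgeVolume (cocycle f A n x ∘ s.1) ≤ wedgeNorm k (cocycle f A n x : V →ₗ[ℝ] V) := by
  have := wedgeVolume_comp_le (cocycle f A n x : V →ₗ[ℝ] V) s.1
  rwa [s.2.wedgeVolume_eq_one, mul_one] at this

/-- The chain rule turns the product of one-step volumes into the volume after `n` steps, and
`negLog` turns the product into a sum. -/
lemma sum_cocycleCost (n : ℕ) (z : X × Stiefel V k) :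
    ∑ j ∈ Finset.range n, cocycleCost A ((frameMap f A)^[j] z) =
      negLog (wedgeVolume (cocycle f A n z.1 ∘ z.2.1) *
        Real.exp (-(k * logNormSum (E := fun _ : X ↦ V) (f := f) A n z.1))) := by
  induction n generalizing z with
  | zero =>
    have : wedgeVolume (cocycle f A 0 z.1 ∘ z.2.1) = 1 := z.2.2.wedgeVolume_eq_one
    rw [this]
    simp [logNormSum]
  | succ n ih =>
    have hle : ∀ (n : ℕ) (z : X × Stiefel V k), wedgeVolume (cocycle f A n z.1 ∘ z.2.1) *
        Real.exp (-(k * logNormSum (E := fun _ : X ↦ V) (f := f) A n z.1)) ≤ 1 := fun n z ↦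
      mul_exp_neg_le_one ((wedgeVolume_cocycle_le f A n z.1 z.2).trans
        (wedgeNorm_bundleIterate_le (E := fun _ : X ↦ V) (f := f) A k n z.1))
    have h1 : wedgeVolume (A z.1 ∘ z.2.1) * Real.exp (-(k * Real.posLog ‖A z.1‖)) ≤ 1 := by
      have := hle 1 z
      rwa [logNormSum, birkhoffSum_one] at this
    rw [Finset.sum_range_succ']
    simp only [Function.iterate_succ_apply, ih]
    rw [wedgeVolume_cocycle_succ, logNormSum_succ, mul_add, neg_add, Real.exp_add,
      mul_mul_mul_comm]
    refine .trans ?_ (negLog_mul (mul_nonneg (wedgeVolume_nonneg _) (Real.exp_pos _).le) h1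
      (hle n (frameMap f A z))).symm
    rw [add_comm]
    rfl

lemma cocycleWedgeCost_le_sum (n : ℕ) (z : X × Stiefel V k) :
    cocycleWedgeCost f A k n z.1 ≤ ∑ j ∈ Finset.range n, cocycleCost A ((frameMap f A)^[j] z) := by
  rw [sum_cocycleCost]
  exact negLog_anti (mul_le_mul_of_nonneg_right (wedgeVolume_cocycle_le f A n z.1 z.2)
    (Real.exp_pos _).le)

variable [MeasurableSpace X] {f A}

lemma measurable_cocycle (hf : Measurable f) (hA : Measurable A) (n : ℕ) :
    Measurable (cocycle f A n) := by
  induction n with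
  | zero => exact measurable_const
  | succ n ih =>
    have hc : Continuous fun p : (V →L[ℝ] V) × (V →L[ℝ] V) ↦ p.1.comp p.2 :=
      continuous_fst.clm_comp continuous_snd
    exact hc.measurable.comp ((ih.comp hf).prodMk hA)

variable [MeasurableSpace V] [BorelSpace V]

lemma measurable_cocycleWedgeCost (hf : Measurable f) (hA : Measurable A) (n : ℕ) :
    Measurable (cocycleWedgeCost f A k n) :=
  measurable_wedgeCost (E := fun _ : X ↦ V) A hf hA.norm
    ((measurable_wedgeNorm k).comp (measurable_cocycle hf hA n))

lemma isContinuousSkewProduct_frameMap (hf : Measurable f) (hA : Measurable A) :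
    IsContinuousSkewProduct f (frameParam A k) frameAction (regularFrames V k) frameCost where
  measurable_base := hf
  measurable_param := measurable_frameParam hA
  measurable_fiber := measurable_frameAction
  isOpen := isOpen_regularFrames
  continuousOn := continuousOn_frameAction
  continuous_cost := continuous_frameCost
  cost_eq_top _ hz := frameCost_eq_top hz

lemma measurable_cocycleCost (hA : Measurable A) : Measurable (cocycleCost (k := k) A) :=
  continuous_frameCost.measurable.comp
    (((measurable_frameParam hA).comp measurable_fst).prodMk measurable_snd)

variable {μ : Measure X}

lemma rate_le_lintegral_cocycleCost (hf : Measurable f) (hA : Measurable A)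
    {m : Measure (X × Stiefel V k)} (hm : m ∈ invariantLifts μ (frameMap f A)) :
    IsSuperadditive.rate μ (cocycleWedgeCost f A k) ≤ ∫⁻ z, cocycleCost A z ∂m :=
  IsSuperadditive.rate_le_lintegral hm.1 hm.2 (measurable_cocycleCost hA)
    (measurable_cocycleWedgeCost hf hA) fun n ↦ cocycleWedgeCost_le_sum f A (n + 1)

variable [IsProbabilityMeasure μ]

/-- Measurable families of frames that are almost maximally expanded. -/
lemma exists_measurable_frame (hk : k ≤ finrank ℝ V) (hf : Measurable f) (hA : Measurable A)
    (n : ℕ) : ∃ s : X → Stiefel V k, Measurable s ∧ ∀ x,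
      wedgeNorm k (cocycle f A n x : V →ₗ[ℝ] V) / 2 ≤ wedgeVolume (cocycle f A n x ∘ (s x).1) := by
  classical
  have := nonempty_stiefel hk
  set q := TopologicalSpace.denseSeq (Stiefel V k)
  have hq : DenseRange q := TopologicalSpace.denseRange_denseSeq _
  have hex : ∀ x, ∃ i, wedgeNorm k (cocycle f A n x : V →ₗ[ℝ] V) / 2 ≤
      wedgeVolume (cocycle f A n x ∘ (q i).1) := fun x ↦ by
    by_contra! h
    -- If every frame of the dense sequence expanded by less than half the norm, the norm would be
    -- at most its own half, although `h 0` makes it positive.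
    have hub : wedgeNorm k (cocycle f A n x : V →ₗ[ℝ] V) ≤
        wedgeNorm k (cocycle f A n x : V →ₗ[ℝ] V) / 2 :=
      (isLUB_wedgeVolume hq hk (cocycle f A n x)).2 (by
        rintro _ ⟨i, rfl⟩
        exact (h i).le)
    have h0 := (wedgeVolume_nonneg _).trans_lt (h 0)
    linarith
  have hA' := measurable_cocycle hf hA n
  refine ⟨fun x ↦ q (Nat.find (hex x)), Measurable.find (f := fun i _ ↦ q i)
    (fun i ↦ measurable_const) (fun i ↦ measurableSet_le
      (((measurable_wedgeNorm k).comp hA').div_const 2)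
      ((measurable_wedgeVolume_comp (q i).1).comp hA')) hex, fun x ↦ Nat.find_spec (hex x)⟩

/-- Krylov–Bogoliubov from almost optimal frames: averaging over `n` steps gives mean cost at most
`(1/n) ∫ wedgeCostₙ + (log 2)/n`, hence at most `rate` in the limit. -/
lemma exists_lintegral_cocycleCost_le [StandardBorelSpace X] (hk : k ≤ finrank ℝ V)
    (hf : MeasurePreserving f μ μ) (hA : Measurable A)
    (hfin : IsSuperadditive.rate μ (cocycleWedgeCost f A k) ≠ ⊤ ∨ ∀ x, Function.Injective (A x)) :
    ∃ m ∈ invariantLifts μ (frameMap (k := k) f A),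
      ∫⁻ z, cocycleCost A z ∂m ≤ IsSuperadditive.rate μ (cocycleWedgeCost f A k) := by
  have hS := isContinuousSkewProduct_frameMap (k := k) hf.measurable hA
  have hT : Measurable (frameMap (k := k) f A) := hS.measurable_skewMap
  choose s hs hsle using fun n ↦ exists_measurable_frame hk hf.measurable hA n
  set κ : ℕ → Measure (X × Stiefel V k) := fun n ↦ μ.map fun x ↦ (x, s n x) with hκ
  have hκm : ∀ n, Measurable fun x ↦ (x, s n x) := fun n ↦ measurable_id.prodMk (hs n)
  have hκp : ∀ n, IsProbabilityMeasure (κ n) := fun n ↦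
    Measure.isProbabilityMeasure_map (hκm n).aemeasurable
  have hκfst : ∀ n, MeasurePreserving Prod.fst (κ n) μ := fun n ↦
    ⟨measurable_fst, by rw [hκ, Measure.map_map measurable_fst (hκm n)]; exact Measure.map_id⟩
  have hC : negLog (1 / 2) ≠ ⊤ := by
    rw [Ne, negLog_eq_top_iff]
    norm_num
  have hinv : Tendsto (fun n : ℕ ↦ ((n + 1 : ℕ) : ℝ≥0∞)⁻¹) atTop (𝓝 0) :=
    ENNReal.tendsto_inv_nat_nhds_zero.comp (tendsto_add_atTop_nat 1)
  -- The starting frames and the averaging time change together. The summand `negLog (1 / 2)` pays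
  -- for the factor lost in choosing the frames and disappears after division by the time.
  refine hS.exists_invariantLift (m := fun n ↦ empiricalMeasure (frameMap f A) (κ (n + 1)) (n + 1))
    (ε := fun n ↦ ((n + 1 : ℕ) : ℝ≥0∞)⁻¹)
    (H := fun n ↦ IsSuperadditive.rate μ (cocycleWedgeCost f A k) +
      negLog (1 / 2) * ((n + 1 : ℕ) : ℝ≥0∞)⁻¹) (fun n ↦ ?_) hinv (fun n t ht ↦ ?_) ?_
    (fun n ↦ ?_) ?_
  · exact measurePreserving_empiricalMeasure hT hf (hκfst _) (fun z ↦ rfl) n.succ_pos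
  · exact empiricalMeasure_le_preimage_add hT ht _
  · have := ENNReal.Tendsto.const_mul hinv (.inr hC)
    simpa using tendsto_const_nhds.add this
  · have h1 : ∫⁻ z, cocycleCost A z ∂(empiricalMeasure (frameMap f A) (κ (n + 1)) (n + 1)) ≤
        (∫⁻ x, (cocycleWedgeCost f A k (n + 1) x + negLog (1 / 2)) ∂μ) / (n + 1 : ℕ) := by
      have hsum : Measurable fun z ↦ ∑ j ∈ Finset.range (n + 1),
          cocycleCost A ((frameMap (k := k) f A)^[j] z) :=
        Finset.measurable_fun_sum _ fun j _ ↦ (measurable_cocycleCost hA).comp (hT.iterate j)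
      rw [lintegral_empiricalMeasure hT (measurable_cocycleCost hA), hκ,
        lintegral_map hsum (hκm _)]
      gcongr with x
      rw [sum_cocycleCost]
      refine le_of_le_of_eq ?_ (add_comm _ _)
      rw [cocycleWedgeCost, wedgeCost,
        ← negLog_mul (s := 1 / 2) (by norm_num) (by norm_num) (mul_exp_neg_le_one
          (wedgeNorm_bundleIterate_le (E := fun _ : X ↦ V) (f := f) A k (n + 1) x))]
      refine negLog_anti ?_
      rw [← mul_assoc]
      refine mul_le_mul_of_nonneg_right ?_ (Real.exp_pos _).le
      rw [one_div_mul_eq_div]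
      exact hsle (n + 1) x
    refine h1.trans ?_
    rw [lintegral_add_right _ measurable_const, lintegral_const, measure_univ, mul_one,
      ENNReal.add_div, div_eq_mul_inv (negLog _)]
    gcongr
    rw [ENNReal.div_le_iff_le_mul (by simp) (by simp), mul_comm]
    exact IsSuperadditive.lintegral_le_mul_rate _ n.succ_pos
  · exact hfin.imp_right fun h z ↦ z.2.2.linearIndependent.map'
      (A z.1 : V →ₗ[ℝ] V) (LinearMap.ker_eq_bot.2 (h z.1))

lemma exists_ergodic_lintegral_cocycleCost_le [StandardBorelSpace X] (hk : k ≤ finrank ℝ V)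
    (hf : Ergodic f μ) (hA : Measurable A)
    (hfin : IsSuperadditive.rate μ (cocycleWedgeCost f A k) ≠ ⊤ ∨ ∀ x, Function.Injective (A x)) :
    ∃ m ∈ invariantLifts μ (frameMap (k := k) f A), Ergodic (frameMap f A) m ∧
      ∫⁻ z, cocycleCost A z ∂m ≤ IsSuperadditive.rate μ (cocycleWedgeCost f A k) :=
  (isContinuousSkewProduct_frameMap (k := k) hf.measurable hA).exists_ergodic_invariantLift hf
    (fun _ hm ↦ rate_le_lintegral_cocycleCost hf.measurable hA hm)
    (hfin.imp_right fun h z ↦ z.2.2.linearIndependent.map'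
      (A z.1 : V →ₗ[ℝ] V) (LinearMap.ker_eq_bot.2 (h z.1)))
    (exists_lintegral_cocycleCost_le hk hf.toMeasurePreserving hA hfin)

end MatrixCocycle

/-! ### Invariance of volumes and exterior norms under isometries. -/

section WedgeNormIsometry

variable {V : Type*} [NormedAddCommGroup V] [InnerProductSpace ℝ V] [FiniteDimensional ℝ V]
  {V' : Type*} [NormedAddCommGroup V'] [InnerProductSpace ℝ V'] [FiniteDimensional ℝ V']
  {W : Type*} [NormedAddCommGroup W] [InnerProductSpace ℝ W] [FiniteDimensional ℝ W]
  {W' : Type*} [NormedAddCommGroup W'] [InnerProductSpace ℝ W'] [FiniteDimensional ℝ W']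

lemma LinearIsometry.wedgeNorm_le_one (k : ℕ) (e : V →ₗᵢ[ℝ] V') :
    wedgeNorm k (e.toContinuousLinearMap : V →ₗ[ℝ] V') ≤ 1 :=
  (wedgeNorm_le_opNorm_pow k _).trans
    (pow_le_one₀ (norm_nonneg _) e.norm_toContinuousLinearMap_le)

/-- `L` is `L'` composed on both sides with isometries, whose exterior norms are at most `1`. -/
lemma wedgeNorm_le_of_forall_eq {k : ℕ} {L : V →ₗ[ℝ] V'} {L' : W →ₗ[ℝ] W'} (a : V ≃ₗᵢ[ℝ] W)
    (b : V' ≃ₗᵢ[ℝ] W') (h : ∀ v, b (L v) = L' (a v)) : wedgeNorm k L ≤ wedgeNorm k L' := by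
  have h1 : L = ((b.symm.toLinearIsometry.toContinuousLinearMap : W' →L[ℝ] V') : W' →ₗ[ℝ] V') ∘ₗ
      (L' ∘ₗ ((a.toLinearIsometry.toContinuousLinearMap : V →L[ℝ] W) : V →ₗ[ℝ] W)) := by
    ext v
    change L v = b.symm (L' (a v))
    rw [← h, LinearIsometryEquiv.symm_apply_apply]
  rw [h1]
  calc _ ≤ _ * (_ * _) := (wedgeNorm_comp_le k _ _).trans
        (mul_le_mul_of_nonneg_left (wedgeNorm_comp_le k _ _) (wedgeNorm_nonneg _ _))
    _ ≤ 1 * (wedgeNorm k L' * 1) :=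
        mul_le_mul (LinearIsometry.wedgeNorm_le_one k _)
          (mul_le_mul_of_nonneg_left (LinearIsometry.wedgeNorm_le_one k _) (wedgeNorm_nonneg _ _))
          (mul_nonneg (wedgeNorm_nonneg _ _) (wedgeNorm_nonneg _ _)) zero_le_one
    _ = _ := by ring

lemma wedgeNorm_eq_of_forall_eq {k : ℕ} {L : V →ₗ[ℝ] V'} {L' : W →ₗ[ℝ] W'} (a : V ≃ₗᵢ[ℝ] W)
    (b : V' ≃ₗᵢ[ℝ] W') (h : ∀ v, b (L v) = L' (a v)) : wedgeNorm k L = wedgeNorm k L' :=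
  le_antisymm (wedgeNorm_le_of_forall_eq a b h) (wedgeNorm_le_of_forall_eq a.symm b.symm fun w ↦ by
    rw [LinearIsometryEquiv.symm_apply_eq, h, LinearIsometryEquiv.apply_symm_apply])

lemma LinearIsometryEquiv.wedgeVolume_comp {k : ℕ} (e : V ≃ₗᵢ[ℝ] W) (v : Fin k → V) :
    wedgeVolume (e ∘ v) = wedgeVolume v :=
  wedgeVolume_congr fun _ _ ↦ e.inner_map_map _ _

lemma exists_orthonormal_span_eq {k : ℕ} {U : Submodule ℝ V} (hU : Module.finrank ℝ U = k) :
    ∃ v : Fin k → V, Orthonormal ℝ v ∧ Submodule.span ℝ (Set.range v) = U := by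
  subst hU
  let b := stdOrthonormalBasis ℝ U
  refine ⟨U.subtypeₗᵢ ∘ b, b.orthonormal.comp_linearIsometry _, ?_⟩
  rw [Set.range_comp]
  have := Submodule.map_span U.subtype (Set.range b)
  rw [← OrthonormalBasis.coe_toBasis, b.toBasis.span_eq, Submodule.map_top,
    Submodule.range_subtype] at this
  exact this.symm

end WedgeNormIsometry

/-! ### Bundle morphisms as matrix cocycles. -/

section MeasurableFrame

open Module

variable {X : Type u} {E : X → Type v}
  [∀ x, NormedAddCommGroup (E x)] [∀ x, InnerProductSpace ℝ (E x)]
  {V : Type*} [NormedAddCommGroup V] [InnerProductSpace ℝ V]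

variable {f : X → X} (F : ∀ x, E x →L[ℝ] E (f x)) (B : ∀ x, V ≃ₗᵢ[ℝ] E x)

/-- A bundle morphism in a frame. -/
noncomputable def frameMatrix (x : X) : V →L[ℝ] V :=
  ((B (f x)).symm.toLinearIsometry.toContinuousLinearMap).comp
    ((F x).comp (B x).toLinearIsometry.toContinuousLinearMap)

lemma apply_frameMatrix (x : X) (v : V) : B (f x) (frameMatrix F B x v) = F x (B x v) :=
  (B (f x)).apply_symm_apply _

lemma norm_frameMatrix (x : X) : ‖frameMatrix F B x‖ = ‖F x‖ := by
  rw [frameMatrix, LinearIsometry.norm_toContinuousLinearMap_comp]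
  exact ContinuousLinearMap.opNorm_comp_linearIsometryEquiv (F x) (B x)

lemma apply_cocycle_frameMatrix (n : ℕ) (x : X) (v : V) :
    B (f^[n] x) (cocycle f (frameMatrix F B) n x v) = bundleIterate F n x (B x v) := by
  induction n generalizing x v with
  | zero => rfl
  | succ n ih =>
    refine (ih (f x) (frameMatrix F B x v)).trans ?_
    rw [apply_frameMatrix]
    rfl

lemma logNormSum_frameMatrix (n : ℕ) (x : X) :
    logNormSum (E := fun _ : X ↦ V) (f := f) (frameMatrix F B) n x = logNormSum F n x := by
  simp only [logNormSum, norm_frameMatrix]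

variable [FiniteDimensional ℝ V]

section

variable [∀ x, FiniteDimensional ℝ (E x)]

lemma wedgeNorm_cocycle_frameMatrix (k n : ℕ) (x : X) :
    wedgeNorm k (cocycle f (frameMatrix F B) n x : V →ₗ[ℝ] V) =
      wedgeNorm k (bundleIterate F n x : E x →ₗ[ℝ] E (f^[n] x)) :=
  wedgeNorm_eq_of_forall_eq (B x) (B (f^[n] x)) (apply_cocycle_frameMatrix F B n x)

lemma cocycleWedgeCost_frameMatrix (k n : ℕ) (x : X) :
    cocycleWedgeCost f (frameMatrix F B) k n x = wedgeCost F k n x := by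
  unfold cocycleWedgeCost wedgeCost
  rw [logNormSum_frameMatrix]
  rw [← wedgeNorm_cocycle_frameMatrix F B]

end

/-- A measurable isometric trivialization of a bundle. -/
structure IsMeasurableFrame [MeasurableSpace X] [MeasurableSpace V]
    [MeasurableSpace (BundleTotal E)] (B : ∀ x, V ≃ₗᵢ[ℝ] E x) :
    Prop where
  measurable_apply : Measurable fun p : X × V ↦ (⟨p.1, B p.1 p.2⟩ : BundleTotal E)
  measurable_symm : Measurable fun p : BundleTotal E ↦ (p.base, (B p.base).symm p.vec)

variable [MeasurableSpace X] [MeasurableSpace V] [BorelSpace V]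

/-- An operator is the sum of rank-one operators depending continuously on its columns. -/
lemma measurable_of_forall_apply {A : X → V →L[ℝ] V} (h : ∀ v, Measurable fun x ↦ A x v) :
    Measurable A := by
  let b := stdOrthonormalBasis ℝ V
  have : A = fun x ↦ ∑ j, (innerSL ℝ (b j)).smulRight (A x (b j)) := by
    funext x
    ext v
    conv_lhs => rw [← b.sum_repr' v]
    simp
  rw [this]
  refine Finset.measurable_fun_sum _ fun j _ ↦ ?_
  have hc : Continuous fun w : V ↦ (innerSL ℝ (b j)).smulRight w :=
    (ContinuousLinearMap.smulRightL ℝ V V (innerSL ℝ (b j))).continuous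
  exact hc.measurable.comp (h (b j))

variable {F B} [MeasurableSpace (BundleTotal E)]

lemma IsMeasurableFrame.measurable_frameMatrix (hB : IsMeasurableFrame B)
    (hF : Measurable fun p : BundleTotal E ↦ (⟨f p.base, F p.base p.vec⟩ : BundleTotal E)) :
    Measurable (frameMatrix F B) := by
  refine measurable_of_forall_apply fun v ↦ ?_
  exact (hB.measurable_symm.comp (hF.comp (hB.measurable_apply.comp
    (measurable_id.prodMk measurable_const)))).snd

end MeasurableFrame

/-! ### The measurable structure of the Grassmann bundle. -/

section GrassmannMeasurable

open scoped ENNReal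
open Module

variable {X : Type u} [MeasurableSpace X] {E : X → Type v}
  [∀ x, NormedAddCommGroup (E x)] [∀ x, InnerProductSpace ℝ (E x)]
  [MeasurableSpace (BundleTotal E)] {k : ℕ}

lemma FrameBundle.measurable_base : Measurable (FrameBundle.base : FrameBundle E k → X) :=
  measurable_iff_comap_le.2 le_sup_left

lemma FrameBundle.measurable_vec (i : Fin k) :
    Measurable fun p : FrameBundle E k ↦ (⟨p.base, p.vec i⟩ : BundleTotal E) :=
  measurable_iff_comap_le.2 (le_sup_of_le_right (le_iSup (fun i : Fin k ↦ MeasurableSpace.comap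
    (fun p : FrameBundle E k ↦ (⟨p.base, p.vec i⟩ : BundleTotal E)) inferInstance) i))

lemma FrameBundle.measurable_of {Ω : Type*} [MeasurableSpace Ω] {g : Ω → FrameBundle E k}
    (h1 : Measurable fun ω ↦ (g ω).base)
    (h2 : ∀ i, Measurable fun ω ↦ (⟨(g ω).base, (g ω).vec i⟩ : BundleTotal E)) :
    Measurable g := by
  rw [measurable_iff_comap_le, FrameBundle.instMeasurableSpace, MeasurableSpace.comap_sup,
    MeasurableSpace.comap_iSup, MeasurableSpace.comap_comp]
  refine sup_le (measurable_iff_comap_le.1 h1) (iSup_le fun i ↦ ?_)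
  rw [MeasurableSpace.comap_comp]
  exact measurable_iff_comap_le.1 (h2 i)

namespace GrassmannBundle

lemma measurable_span : Measurable (FrameBundle.span : FrameBundle E k → GrassmannBundle E k) :=
  measurable_iff_le_map.2 inf_le_left

lemma measurable_cemetery : Measurable (cemetery : X → GrassmannBundle E k) :=
  measurable_iff_le_map.2 inf_le_right

/-- The universal property of the quotient structure: it suffices to test on frames and on the
cemetery section. -/
lemma measurable_of {Y : Type*} [MeasurableSpace Y] {g : GrassmannBundle E k → Y}
    (h1 : Measurable fun p : FrameBundle E k ↦ g p.span)
    (h2 : Measurable fun x : X ↦ g (cemetery x)) : Measurable g :=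
  fun _ hs ↦ ⟨h1 hs, h2 hs⟩

lemma measurable_base : Measurable (base : GrassmannBundle E k → X) :=
  measurable_of FrameBundle.measurable_base measurable_id

lemma measurableSet_range_cemetery :
    MeasurableSet (Set.range (cemetery : X → GrassmannBundle E k)) := by
  constructor
  · have : (FrameBundle.span : FrameBundle E k → GrassmannBundle E k) ⁻¹'
        Set.range cemetery = ∅ := by
      ext p
      simp [FrameBundle.span]
    exact (congrArg MeasurableSet this).mpr .empty
  · have : (cemetery : X → GrassmannBundle E k) ⁻¹' Set.range cemetery = Set.univ := by
      ext x
      simp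
    exact (congrArg MeasurableSet this).mpr .univ

end GrassmannBundle

end GrassmannMeasurable

/-! ### Comparison of the dynamics on subspaces and on frames. -/

section GrassmannDynamics

open scoped ENNReal
open Module

variable {X : Type u} {E : X → Type v}
  [∀ x, NormedAddCommGroup (E x)] [∀ x, InnerProductSpace ℝ (E x)]
  {k : ℕ} {f : X → X} (F : ∀ x, E x →L[ℝ] E (f x))

lemma GrassmannBundle.subspace_congr {x : X} {W W' : Submodule ℝ (E x)} (h : W = W')
    {hW : finrank ℝ W = k} {hW' : finrank ℝ W' = k} : subspace x W hW = subspace x W' hW' := by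
  subst h
  rfl

lemma finrank_map_span_eq_iff {x : X} {v : Fin k → E x} :
    finrank ℝ ((Submodule.span ℝ (Set.range v)).map (F x : E x →ₗ[ℝ] E (f x))) = k ↔
      LinearIndependent ℝ (F x ∘ v) := by
  rw [linearIndependent_iff_card_eq_finrank_span, Submodule.map_span, ← Set.range_comp,
    Fintype.card_fin, eq_comm]
  rfl

lemma comp_frame_eq {V : Type*} [NormedAddCommGroup V] [InnerProductSpace ℝ V]
    (B : ∀ x, V ≃ₗᵢ[ℝ] E x) (x : X) (s : Fin k → V) :
    F x ∘ B x ∘ s = B (f x) ∘ frameMatrix F B x ∘ s := by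
  funext i
  exact (apply_frameMatrix F B x (s i)).symm

lemma grassmannMap_span {p : FrameBundle E k} (h : LinearIndependent ℝ (F p.base ∘ p.vec)) :
    grassmannMap F p.span = FrameBundle.span ⟨f p.base, F p.base ∘ p.vec, h⟩ := by
  rw [FrameBundle.span, grassmannMap, dif_pos ((finrank_map_span_eq_iff F).2 h)]
  refine GrassmannBundle.subspace_congr ?_
  rw [Submodule.map_span, ← Set.range_comp]
  rfl

lemma grassmannMap_span_of_not {p : FrameBundle E k}
    (h : ¬ LinearIndependent ℝ (F p.base ∘ p.vec)) :
    grassmannMap F p.span = .cemetery (f p.base) :=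
  dif_neg ((finrank_map_span_eq_iff F).not.2 h)

variable [∀ x, FiniteDimensional ℝ (E x)]

/-- The normalized negative logarithm of the Jacobian. -/
noncomputable def grassmannCost : GrassmannBundle E k → ℝ≥0∞
  | .subspace x W _ => negLog (jacobian k (F x : E x →ₗ[ℝ] E (f x)) W *
      Real.exp (-(k * Real.posLog ‖F x‖)))
  | .cemetery _ => ⊤

lemma Orthonormal.jacobian_span {x : X} {v : Fin k → E x} (hv : Orthonormal ℝ v) :
    jacobian k (F x : E x →ₗ[ℝ] E (f x)) (Submodule.span ℝ (Set.range v)) =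
      wedgeVolume (F x ∘ v) := by
  have := jacobian_mul_wedgeVolume (F x : E x →ₗ[ℝ] E (f x)) hv.linearIndependent
  rwa [hv.wedgeVolume_eq_one, mul_one] at this

lemma jacobian_le_exp {x : X} {W : Submodule ℝ (E x)} (hW : finrank ℝ W = k) :
    jacobian k (F x : E x →ₗ[ℝ] E (f x)) W ≤ Real.exp (k * Real.posLog ‖F x‖) := by
  obtain ⟨v, hv, rfl⟩ := exists_orthonormal_span_eq hW
  rw [hv.jacobian_span]
  have h1 := wedgeVolume_comp_le (F x : E x →ₗ[ℝ] E (f x)) v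
  rw [hv.wedgeVolume_eq_one, mul_one] at h1
  rw [Real.exp_nat_mul]
  exact h1.trans ((wedgeNorm_le_opNorm_pow k _).trans
    (pow_le_pow_left₀ (norm_nonneg _) (le_exp_posLog (norm_nonneg _)) k))

/-- Splits the potential into a function of the base point, whose integral is the same for all
lifts, and a nonnegative cost. On the cemetery both sides are `⊥`. -/
lemma grassmannPotential_eq (p : GrassmannBundle E k) :
    grassmannPotential F p = ((ENNReal.ofReal (k * Real.posLog ‖F p.base‖) : ℝ≥0∞) : EReal) -
      (grassmannCost F p : EReal) := by
  cases p with
  | subspace x W hW =>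
    exact extLog_eq_sub_negLog (mul_nonneg k.cast_nonneg Real.posLog_nonneg)
      (jacobian_le_exp F hW)
  | cemetery x =>
    change ⊥ = _ - ((⊤ : ℝ≥0∞) : EReal)
    rw [EReal.coe_ennreal_top, EReal.sub_top]

variable {V : Type*} [NormedAddCommGroup V] [InnerProductSpace ℝ V]
  (B : ∀ x, V ≃ₗᵢ[ℝ] E x)

/-- The subspace spanned by a frame of the model space. -/
def frameSpan (z : X × Stiefel V k) : GrassmannBundle E k :=
  FrameBundle.span ⟨z.1, B z.1 ∘ z.2.1, (z.2.2.comp_linearIsometryEquiv (B z.1)).linearIndependent⟩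

lemma exists_frameSpan_eq (x : X) (W : Submodule ℝ (E x)) (hW : finrank ℝ W = k) :
    ∃ s : Stiefel V k, frameSpan B (x, s) = .subspace x W hW := by
  obtain ⟨v, hv, hspan⟩ := exists_orthonormal_span_eq hW
  refine ⟨⟨(B x).symm ∘ v, hv.comp_linearIsometryEquiv _⟩, ?_⟩
  refine GrassmannBundle.subspace_congr ?_
  dsimp only
  rw [← hspan]
  congr 2
  funext i
  simp

variable [FiniteDimensional ℝ V]

lemma grassmannCost_frameSpan (z : X × Stiefel V k) :
    grassmannCost F (frameSpan B z) = cocycleCost (frameMatrix F B) z := by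
  change negLog (jacobian k (F z.1 : E z.1 →ₗ[ℝ] E (f z.1))
    (Submodule.span ℝ (Set.range (B z.1 ∘ z.2.1))) * _) = _
  rw [(z.2.2.comp_linearIsometryEquiv (B z.1)).jacobian_span, comp_frame_eq,
    LinearIsometryEquiv.wedgeVolume_comp, cocycleCost, frameCost, frameParam, norm_frameMatrix]

lemma linearIndependent_comp_frame_iff (x : X) (s : Fin k → V) :
    LinearIndependent ℝ (F x ∘ B x ∘ s) ↔ LinearIndependent ℝ (frameMatrix F B x ∘ s) := by
  rw [comp_frame_eq, ← wedgeVolume_pos_iff, LinearIsometryEquiv.wedgeVolume_comp,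
    wedgeVolume_pos_iff]

/-- Gram–Schmidt preserves spans. Nondegeneracy is essential: degenerate subspaces go to the
cemetery, while the action on frames never leaves the frames. -/
lemma grassmannMap_frameSpan {z : X × Stiefel V k}
    (h : LinearIndependent ℝ (frameMatrix F B z.1 ∘ z.2.1)) :
    grassmannMap F (frameSpan B z) = frameSpan B (frameMap f (frameMatrix F B) z) := by
  have h' := (linearIndependent_comp_frame_iff F B z.1 z.2.1).2 h
  rw [frameSpan, grassmannMap_span F h']
  have h1 : (frameMap f (frameMatrix F B) z).2.1 =
      InnerProductSpace.gramSchmidtNormed ℝ (frameMatrix F B z.1 ∘ z.2.1) := by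
    simp [frameMap, skewMap, frameAction, frameParam, h]
  refine GrassmannBundle.subspace_congr (x := f z.1) ?_
  change Submodule.span ℝ (Set.range (F z.1 ∘ B z.1 ∘ z.2.1)) =
    Submodule.span ℝ (Set.range (B (f z.1) ∘ (frameMap f (frameMatrix F B) z).2.1))
  have key : ∀ v : Fin k → V, Submodule.span ℝ (Set.range (B (f z.1) ∘ v)) =
      (Submodule.span ℝ (Set.range v)).map ((B (f z.1)).toLinearEquiv : V →ₗ[ℝ] E (f z.1)) :=
    fun v ↦ by
      rw [Submodule.map_span, ← Set.range_comp]
      rfl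
  rw [comp_frame_eq, h1, key, key, InnerProductSpace.span_gramSchmidtNormed_range,
    InnerProductSpace.span_gramSchmidt]

lemma grassmannCost_eq_top {z : X × Stiefel V k}
    (h : ¬ LinearIndependent ℝ (frameMatrix F B z.1 ∘ z.2.1)) :
    grassmannCost F (frameSpan B z) = ⊤ := by
  rw [grassmannCost_frameSpan]
  exact frameCost_eq_top h

/-- The two sums agree term by term until the first degenerate frame, where the right-hand side
becomes infinite. -/
lemma sum_cocycleCost_le (n : ℕ) (z : X × Stiefel V k) :
    ∑ j ∈ Finset.range n, cocycleCost (frameMatrix F B) ((frameMap f (frameMatrix F B))^[j] z) ≤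
      ∑ j ∈ Finset.range n, grassmannCost F ((grassmannMap F)^[j] (frameSpan B z)) := by
  induction n generalizing z with
  | zero => simp
  | succ n ih =>
    rw [Finset.sum_range_succ', Finset.sum_range_succ' _ n]
    by_cases h : LinearIndependent ℝ (frameMatrix F B z.1 ∘ z.2.1)
    · simp only [Function.iterate_succ_apply, Function.iterate_zero_apply,
        grassmannMap_frameSpan F B h, grassmannCost_frameSpan]
      exact add_le_add (ih _) le_rfl
    · simp only [Function.iterate_zero_apply, grassmannCost_eq_top F B h, add_top, le_top]

lemma wedgeCost_le_sum_grassmannCost (B : ∀ x, V ≃ₗᵢ[ℝ] E x) (n : ℕ) (p : GrassmannBundle E k) :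
    wedgeCost F k (n + 1) p.base ≤
      ∑ j ∈ Finset.range (n + 1), grassmannCost F ((grassmannMap F)^[j] p) := by
  cases p with
  | subspace x W hW =>
    obtain ⟨s, hs⟩ := exists_frameSpan_eq B x W hW
    rw [← hs]
    refine le_trans ?_ (sum_cocycleCost_le F B (n + 1) (x, s))
    rw [← cocycleWedgeCost_frameMatrix F B]
    exact cocycleWedgeCost_le_sum f (frameMatrix F B) (n + 1) (x, s)
  | cemetery x =>
    -- The sum has at least one term, and the term at time zero is already infinite on the cemetery.
    rw [Finset.sum_range_succ']
    change _ ≤ _ + (⊤ : ℝ≥0∞)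
    rw [add_top]
    exact le_top

end GrassmannDynamics

/-! ### Transport of invariance and ergodicity along almost everywhere semiconjugacies. -/

section Semiconj

variable {Z Y : Type*} [MeasurableSpace Z] [MeasurableSpace Y] {T : Z → Z} {S : Y → Y}
  {ι : Z → Y} {m : Measure Z}

lemma MeasureTheory.MeasurePreserving.map_of_ae_semiconj (hT : MeasurePreserving T m m)
    (hS : Measurable S) (hι : Measurable ι) (h : S ∘ ι =ᵐ[m] ι ∘ T) :
    MeasurePreserving S (m.map ι) (m.map ι) := by
  refine ⟨hS, ?_⟩
  rw [Measure.map_map hS hι, Measure.map_congr h, ← Measure.map_map hι hT.measurable, hT.map_eq]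

/-- The preimage of an invariant set is invariant up to a null set, which is enough for ergodicity
upstairs to apply. -/
lemma Ergodic.map_of_ae_semiconj (hT : Ergodic T m) (hS : Measurable S) (hι : Measurable ι)
    (h : S ∘ ι =ᵐ[m] ι ∘ T) : Ergodic S (m.map ι) := by
  refine ⟨hT.toMeasurePreserving.map_of_ae_semiconj hS hι h, ⟨fun s hs hinv ↦ ?_⟩⟩
  rw [← (MeasurePreserving.mk hι rfl).aeconst_preimage hs.nullMeasurableSet]
  refine hT.quasiErgodic.aeconst_set₀ (hι hs).nullMeasurableSet ?_
  conv_rhs => rw [← hinv]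
  filter_upwards [h] with z hz
  have : (T ⁻¹' (ι ⁻¹' s)) z = (ι ⁻¹' (S ⁻¹' s)) z := by
    change s (ι (T z)) = s (S (ι z))
    rw [show ι (T z) = S (ι z) from hz.symm]
  exact this

end Semiconj

/-! ### Invariant lifts on the Grassmann bundle. -/

section GrassmannLifts

open scoped ENNReal
open Module

variable {X : Type u} [MeasurableSpace X] {E : X → Type v}
  [∀ x, NormedAddCommGroup (E x)] [∀ x, InnerProductSpace ℝ (E x)]
  [MeasurableSpace (BundleTotal E)] {k : ℕ} {f : X → X} {F : ∀ x, E x →L[ℝ] E (f x)}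
  {V : Type*} [NormedAddCommGroup V] [InnerProductSpace ℝ V] [MeasurableSpace V]
  {B : ∀ x, V ≃ₗᵢ[ℝ] E x}

namespace IsMeasurableFrame

lemma measurable_frameSpan (hB : IsMeasurableFrame B) :
    Measurable (frameSpan (k := k) B) := by
  refine GrassmannBundle.measurable_span.comp (FrameBundle.measurable_of measurable_fst fun i ↦ ?_)
  exact hB.measurable_apply.comp (measurable_fst.prodMk
    ((measurable_pi_apply i).comp (measurable_subtype_coe.comp measurable_snd)))

lemma map_frameSpan_range_cemetery (hB : IsMeasurableFrame B) (m : Measure (X × Stiefel V k)) :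
    m.map (frameSpan B) (Set.range GrassmannBundle.cemetery) = 0 := by
  rw [Measure.map_apply hB.measurable_frameSpan GrassmannBundle.measurableSet_range_cemetery]
  convert measure_empty (μ := m)
  ext z
  simp [frameSpan, FrameBundle.span]

variable [FiniteDimensional ℝ V] [BorelSpace V]

lemma measurable_norm (hB : IsMeasurableFrame B)
    (hF : Measurable fun p : BundleTotal E ↦ (⟨f p.base, F p.base p.vec⟩ : BundleTotal E)) :
    Measurable fun x ↦ ‖F x‖ := by
  simpa only [norm_frameMatrix] using (hB.measurable_frameMatrix hF).norm

variable [∀ x, FiniteDimensional ℝ (E x)]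

lemma measurable_wedgeVolume (hB : IsMeasurableFrame B) :
    Measurable fun p : FrameBundle E k ↦ wedgeVolume p.vec := by
  have : Measurable fun p : FrameBundle E k ↦ fun i ↦ (B p.base).symm (p.vec i) :=
    measurable_pi_lambda _ fun i ↦ (hB.measurable_symm.comp (FrameBundle.measurable_vec i)).snd
  convert (continuous_wedgeVolume (V := V) (k := k)).measurable.comp this using 1
  funext p
  exact ((B p.base).symm.wedgeVolume_comp p.vec).symm

lemma measurable_wedgeVolume_comp (hB : IsMeasurableFrame B)
    (hF : Measurable fun p : BundleTotal E ↦ (⟨f p.base, F p.base p.vec⟩ : BundleTotal E)) :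
    Measurable fun p : FrameBundle E k ↦ wedgeVolume (F p.base ∘ p.vec) := by
  have : Measurable fun p : FrameBundle E k ↦ fun i ↦
      (B (f p.base)).symm (F p.base (p.vec i)) :=
    measurable_pi_lambda _ fun i ↦
      (hB.measurable_symm.comp (hF.comp (FrameBundle.measurable_vec i))).snd
  convert (continuous_wedgeVolume (V := V) (k := k)).measurable.comp this using 1
  funext p
  exact ((B (f p.base)).symm.wedgeVolume_comp (F p.base ∘ p.vec)).symm

lemma measurable_grassmannCost (hB : IsMeasurableFrame B)
    (hF : Measurable fun p : BundleTotal E ↦ (⟨f p.base, F p.base p.vec⟩ : BundleTotal E)) :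
    Measurable (grassmannCost (k := k) F) := by
  refine GrassmannBundle.measurable_of ?_ measurable_const
  -- Measurability is tested on all frames, not only orthonormal ones, so the Jacobian is expressed
  -- as a ratio of volumes.
  have h1 : ∀ p : FrameBundle E k, grassmannCost F p.span =
      negLog (wedgeVolume (F p.base ∘ p.vec) / wedgeVolume p.vec *
        Real.exp (-(k * Real.posLog ‖F p.base‖))) := fun p ↦ by
    have := jacobian_mul_wedgeVolume (F p.base : E p.base →ₗ[ℝ] E (f p.base)) p.linearIndependent
    rw [← eq_div_iff (wedgeVolume_ne_zero_iff.2 p.linearIndependent)] at this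
    exact congrArg (fun t ↦ negLog (t * Real.exp (-(k * Real.posLog ‖F p.base‖)))) this
  simp only [h1]
  refine continuous_negLog.measurable.comp
    (((hB.measurable_wedgeVolume_comp hF).div hB.measurable_wedgeVolume).mul
      (Real.measurable_exp.comp (Measurable.neg (Measurable.const_mul ?_ _))))
  exact (Real.continuous_posLog.measurable.comp (hB.measurable_norm hF)).comp
    FrameBundle.measurable_base

lemma measurable_grassmannMap (hB : IsMeasurableFrame B) (hf : Measurable f)
    (hF : Measurable fun p : BundleTotal E ↦ (⟨f p.base, F p.base p.vec⟩ : BundleTotal E)) :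
    Measurable (grassmannMap (k := k) F) := by
  refine GrassmannBundle.measurable_of ?_ (GrassmannBundle.measurable_cemetery.comp hf)
  set D : Set (FrameBundle E k) := {p | LinearIndependent ℝ (F p.base ∘ p.vec)} with hD
  have hDm : MeasurableSet D := by
    have : D = {p : FrameBundle E k | 0 < wedgeVolume (F p.base ∘ p.vec)} := by
      ext p
      exact wedgeVolume_pos_iff.symm
    rw [this]
    exact measurableSet_lt measurable_const (hB.measurable_wedgeVolume_comp hF)
  refine measurable_of_restrict_of_restrict_compl hDm ?_ ?_
  · have h1 : D.domRestrict (fun p ↦ grassmannMap F p.span) = fun p : D ↦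
        FrameBundle.span ⟨f p.1.base, F p.1.base ∘ p.1.vec, p.2⟩ :=
      funext fun p ↦ grassmannMap_span F p.2
    rw [h1]
    refine GrassmannBundle.measurable_span.comp (FrameBundle.measurable_of ?_ fun i ↦ ?_)
    · exact hf.comp (FrameBundle.measurable_base.comp measurable_subtype_coe)
    · exact hF.comp ((FrameBundle.measurable_vec i).comp measurable_subtype_coe)
  · have h1 : Dᶜ.domRestrict (fun p ↦ grassmannMap F p.span) = fun p : (Dᶜ : Set _) ↦
        GrassmannBundle.cemetery (f p.1.base) :=
      funext fun p ↦ grassmannMap_span_of_not F p.2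
    rw [h1]
    exact GrassmannBundle.measurable_cemetery.comp
      (hf.comp (FrameBundle.measurable_base.comp measurable_subtype_coe))

lemma measurable_wedgeNorm_bundleIterate (hB : IsMeasurableFrame B) (hf : Measurable f)
    (hF : Measurable fun p : BundleTotal E ↦ (⟨f p.base, F p.base p.vec⟩ : BundleTotal E))
    (k n : ℕ) :
    Measurable fun x ↦ wedgeNorm k (bundleIterate F n x : E x →ₗ[ℝ] E (f^[n] x)) := by
  simp only [← wedgeNorm_cocycle_frameMatrix F B]
  exact (measurable_wedgeNorm k).comp (measurable_cocycle hf (hB.measurable_frameMatrix hF) n)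

variable {μ : Measure X}

lemma rate_le_lintegral_grassmannCost (hB : IsMeasurableFrame B) (hf : Measurable f)
    (hF : Measurable fun p : BundleTotal E ↦ (⟨f p.base, F p.base p.vec⟩ : BundleTotal E))
    {ν : Measure (GrassmannBundle E k)} (hν : IsInvariantLift F μ ν) :
    IsSuperadditive.rate μ (wedgeCost F k) ≤ ∫⁻ p, grassmannCost F p ∂ν :=
  IsSuperadditive.rate_le_lintegral hν.invariant hν.lifts (hB.measurable_grassmannCost hF)
    (fun n ↦ measurable_wedgeCost F hf (hB.measurable_norm hF)
      (hB.measurable_wedgeNorm_bundleIterate hf hF k n))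
    (wedgeCost_le_sum_grassmannCost F B)

lemma extIntegral_grassmannPotential (hB : IsMeasurableFrame B)
    (hF : Measurable fun p : BundleTotal E ↦ (⟨f p.base, F p.base p.vec⟩ : BundleTotal E))
    (hint : ∫⁻ x, ENNReal.ofReal (Real.posLog ‖F x‖) ∂μ ≠ ⊤)
    {ν : Measure (GrassmannBundle E k)} (hν : MeasurePreserving GrassmannBundle.base ν μ) :
    extIntegral ν (grassmannPotential F) =
      ((k * ∫⁻ x, ENNReal.ofReal (Real.posLog ‖F x‖) ∂μ : ℝ≥0∞) : EReal) -
        ((∫⁻ p, grassmannCost F p ∂ν : ℝ≥0∞) : EReal) := by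
  have hm : Measurable fun x ↦ ENNReal.ofReal (k * Real.posLog ‖F x‖) :=
    ENNReal.measurable_ofReal.comp
      ((Real.continuous_posLog.measurable.comp (hB.measurable_norm hF)).const_mul _)
  have h1 : ∫⁻ p : GrassmannBundle E k, ENNReal.ofReal (k * Real.posLog ‖F p.base‖) ∂ν =
      k * ∫⁻ x, ENNReal.ofReal (Real.posLog ‖F x‖) ∂μ := by
    rw [hν.lintegral_comp hm, ← lintegral_const_mul' _ _ (ENNReal.natCast_ne_top k)]
    refine lintegral_congr fun x ↦ ?_
    rw [ENNReal.ofReal_mul k.cast_nonneg, ENNReal.ofReal_natCast]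
  rw [← h1]
  refine extIntegral_eq_sub (hm.comp hν.measurable) (hB.measurable_grassmannCost hF) ?_
    (.of_forall (grassmannPotential_eq F))
  change ∫⁻ p : GrassmannBundle E k, ENNReal.ofReal (k * Real.posLog ‖F p.base‖) ∂ν ≠ ⊤
  rw [h1]
  exact ENNReal.mul_ne_top (ENNReal.natCast_ne_top k) hint

/-- The semiconjugacy can fail only at degenerate frames; these have infinite cost, so they are null
if the cost is integrable, and they do not exist if `F` is injective. -/
lemma ae_semiconj_frameSpan (hB : IsMeasurableFrame B)
    (hF : Measurable fun p : BundleTotal E ↦ (⟨f p.base, F p.base p.vec⟩ : BundleTotal E))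
    {m : Measure (X × Stiefel V k)}
    (hfin : ∫⁻ z, cocycleCost (frameMatrix F B) z ∂m ≠ ⊤ ∨ ∀ x, Function.Injective (F x)) :
    grassmannMap F ∘ frameSpan B =ᵐ[m] frameSpan B ∘ frameMap f (frameMatrix F B) := by
  rcases hfin with hfin | hinj
  · filter_upwards [ae_lt_top (measurable_cocycleCost (hB.measurable_frameMatrix hF)) hfin]
      with z hz
    refine grassmannMap_frameSpan F B ?_
    by_contra h
    exact hz.ne (frameCost_eq_top h)
  · refine .of_forall fun z ↦ grassmannMap_frameSpan F B ?_
    rw [← linearIndependent_comp_frame_iff]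
    exact (z.2.2.comp_linearIsometryEquiv (B z.1)).linearIndependent.map'
      (F z.1 : E z.1 →ₗ[ℝ] E (f z.1)) (LinearMap.ker_eq_bot.2 (hinj z.1))

/-- The lift of a measure on frames to the Grassmann bundle. -/
lemma isInvariantLift_map_frameSpan (hB : IsMeasurableFrame B) (hf : Measurable f)
    (hF : Measurable fun p : BundleTotal E ↦ (⟨f p.base, F p.base p.vec⟩ : BundleTotal E))
    {m : Measure (X × Stiefel V k)} (hm : m ∈ invariantLifts μ (frameMap f (frameMatrix F B)))
    (hsemi : grassmannMap F ∘ frameSpan B =ᵐ[m] frameSpan B ∘ frameMap f (frameMatrix F B)) :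
    IsInvariantLift F μ (m.map (frameSpan B)) where
  invariant := hm.1.map_of_ae_semiconj (hB.measurable_grassmannMap hf hF)
    hB.measurable_frameSpan hsemi
  lifts := ⟨GrassmannBundle.measurable_base, by
    rw [Measure.map_map GrassmannBundle.measurable_base hB.measurable_frameSpan]
    exact hm.2.map_eq⟩

/-- This lift has infinite cost; it is the optimal one when `rate` is infinite. -/
lemma isInvariantLift_map_cemetery (hB : IsMeasurableFrame B) (hf : MeasurePreserving f μ μ)
    (hF : Measurable fun p : BundleTotal E ↦ (⟨f p.base, F p.base p.vec⟩ : BundleTotal E)) :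
    IsInvariantLift (k := k) F μ (μ.map GrassmannBundle.cemetery) where
  invariant := hf.map_of_ae_semiconj (hB.measurable_grassmannMap hf.measurable hF)
    GrassmannBundle.measurable_cemetery .rfl
  lifts := ⟨GrassmannBundle.measurable_base, by
    rw [Measure.map_map GrassmannBundle.measurable_base GrassmannBundle.measurable_cemetery]
    exact Measure.map_id⟩

/-- The maximizing lifts. -/
theorem exists_lift [StandardBorelSpace X] [IsProbabilityMeasure μ] (hB : IsMeasurableFrame B)
    (hk : k ≤ finrank ℝ V) (hf : MeasurePreserving f μ μ)
    (hF : Measurable fun p : BundleTotal E ↦ (⟨f p.base, F p.base p.vec⟩ : BundleTotal E)) :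
    ∃ ν : Measure (GrassmannBundle E k), IsInvariantLift F μ ν ∧
      (Ergodic f μ → Ergodic (grassmannMap F) ν) ∧
      ∫⁻ p, grassmannCost F p ∂ν = IsSuperadditive.rate μ (wedgeCost F k) ∧
      ((∀ x, Function.Injective (F x)) → ν (Set.range GrassmannBundle.cemetery) = 0) := by
  have hA := hB.measurable_frameMatrix hF
  have hrate : cocycleWedgeCost f (frameMatrix F B) k = wedgeCost F k :=
    funext₂ fun n x ↦ cocycleWedgeCost_frameMatrix F B k n x
  -- In this case degenerate frames are negligible and frames provide the lift. Otherwise `rate = ∞`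
  -- and some `F x` is singular, so the cemetery lift is allowed and has the right cost.
  by_cases hfin : IsSuperadditive.rate μ (wedgeCost F k) ≠ ⊤ ∨ ∀ x, Function.Injective (F x)
  · have hfin' : IsSuperadditive.rate μ (cocycleWedgeCost f (frameMatrix F B) k) ≠ ⊤ ∨
        ∀ x, Function.Injective (frameMatrix F B x) := by
      rw [hrate]
      exact hfin.imp_right fun h x ↦ (B (f x)).symm.injective.comp ((h x).comp (B x).injective)
    obtain ⟨m, hm, herg, hle⟩ : ∃ m ∈ invariantLifts μ (frameMap (k := k) f (frameMatrix F B)),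
        (Ergodic f μ → Ergodic (frameMap f (frameMatrix F B)) m) ∧
        ∫⁻ z, cocycleCost (frameMatrix F B) z ∂m ≤
          IsSuperadditive.rate μ (cocycleWedgeCost f (frameMatrix F B) k) := by
      by_cases he : Ergodic f μ
      · obtain ⟨m, hm, hme, hle⟩ := exists_ergodic_lintegral_cocycleCost_le hk he hA hfin'
        exact ⟨m, hm, fun _ ↦ hme, hle⟩
      · obtain ⟨m, hm, hle⟩ := exists_lintegral_cocycleCost_le hk hf hA hfin'
        exact ⟨m, hm, fun h ↦ absurd h he, hle⟩
    rw [hrate] at hle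
    have hsemi := hB.ae_semiconj_frameSpan hF (m := m)
      (hfin.imp_left fun h ↦ ne_top_of_le_ne_top h hle)
    have hlift := hB.isInvariantLift_map_frameSpan hf.measurable hF hm hsemi
    refine ⟨m.map (frameSpan B), hlift, fun he ↦ (herg he).map_of_ae_semiconj
      (hB.measurable_grassmannMap hf.measurable hF) hB.measurable_frameSpan hsemi, ?_,
      fun _ ↦ hB.map_frameSpan_range_cemetery m⟩
    refine le_antisymm ?_ (hB.rate_le_lintegral_grassmannCost hf.measurable hF hlift)
    rw [lintegral_map (hB.measurable_grassmannCost hF) hB.measurable_frameSpan]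
    simpa only [grassmannCost_frameSpan] using hle
  · push Not at hfin
    refine ⟨μ.map GrassmannBundle.cemetery, hB.isInvariantLift_map_cemetery hf hF,
      fun he ↦ he.map_of_ae_semiconj (hB.measurable_grassmannMap hf.measurable hF)
        GrassmannBundle.measurable_cemetery .rfl, ?_, fun hinj ↦ ?_⟩
    · rw [hfin.1, lintegral_map (hB.measurable_grassmannCost hF)
        GrassmannBundle.measurable_cemetery]
      simp [grassmannCost]
    · obtain ⟨x, hx⟩ := hfin.2
      exact absurd (hinj x) hx

end IsMeasurableFrame

end GrassmannLifts

/-- Both the sum of exponents and the integral over a lift equal `k ∫ log⁺ ‖F‖` minus a nonnegative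
term, so maximizing the potential is minimizing the cost, and one lift from `exists_lift` serves all
claims. Since every fibre has dimension `d`, injectivity of `F x` is the same as invertibility. -/
theorem mainTheorem8 {X : Type u} [MeasurableSpace X] [StandardBorelSpace X]
    (μ : Measure X) [IsProbabilityMeasure μ] (d : ℕ) (E : X → Type v)
    [∀ x, NormedAddCommGroup (E x)] [∀ x, InnerProductSpace ℝ (E x)]
    [∀ x, FiniteDimensional ℝ (E x)] [MeasurableSpace (BundleTotal E)]
    (hE : IsMeasurableEuclideanBundle E d)
    (f : X → X) (hf : MeasurePreserving f μ μ)
    (F : ∀ x, E x →L[ℝ] E (f x))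
    (hF : Measurable fun p : BundleTotal E ↦
      (⟨f p.base, F p.base p.vec⟩ : BundleTotal E))
    (hint : Integrable (fun x ↦ Real.posLog ‖F x‖) μ) :
    -- the Lyapunov exponents exist as limits
    (∀ i < d, ∀ᵐ x ∂μ,
      Tendsto (fun n ↦ singularGrowth F i n x) atTop (𝓝 (pointwiseExponent F i x))) ∧
    (Ergodic f μ → ∀ i < d, ∀ᵐ x ∂μ,
      Tendsto (fun n ↦ singularGrowth F i n x) atTop (𝓝 (lyapunovExponent F μ i))) ∧
    ∀ k, 1 ≤ k → k ≤ d →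
      -- the variational formula
      (∑ i ∈ Finset.range k, lyapunovExponent F μ i =
        sSup {I : EReal | ∃ ν : Measure (GrassmannBundle E k),
          IsInvariantLift F μ ν ∧ extIntegral ν (grassmannPotential F) = I}) ∧
      -- the supremum is attained; if `F` is not singular, off the cemetery section
      (∃ ν : Measure (GrassmannBundle E k), IsInvariantLift F μ ν ∧
        extIntegral ν (grassmannPotential F) = ∑ i ∈ Finset.range k, lyapunovExponent F μ i ∧
        ((∀ x, Function.Injective (F x)) → ν (Set.range GrassmannBundle.cemetery) = 0)) ∧
      -- if `f` is ergodic, it is attained on an ergodic lift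
      (Ergodic f μ →
        ∃ ν : Measure (GrassmannBundle E k), IsInvariantLift F μ ν ∧
          Ergodic (grassmannMap F) ν ∧
          extIntegral ν (grassmannPotential F) = ∑ i ∈ Finset.range k, lyapunovExponent F μ i ∧
          ((∀ x, Function.Injective (F x)) → ν (Set.range GrassmannBundle.cemetery) = 0)) := by
  obtain ⟨B, hB1, hB2⟩ := hE.exists_linearIsometryEquiv
  have hB : IsMeasurableFrame B := ⟨hB1, hB2⟩
  have hd : ∀ x, Module.finrank ℝ (E x) = d := fun x ↦ by
    rw [← (B x).toLinearEquiv.finrank_eq, finrank_euclideanSpace_fin]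
  have hint' := hint.lintegral_lt_top.ne
  obtain ⟨hlim, herg, hsum⟩ := lyapunovExponent_spec F hd hf (hB.measurable_norm hF)
    (hB.measurable_wedgeNorm_bundleIterate hf.measurable hF) hint'
  refine ⟨hlim, herg, fun k _ hk ↦ ?_⟩
  obtain ⟨ν, hν, hνe, hνc, hν0⟩ := hB.exists_lift (k := k)
    (by rwa [finrank_euclideanSpace_fin]) hf hF
  have hval : extIntegral ν (grassmannPotential F) =
      ∑ i ∈ Finset.range k, lyapunovExponent F μ i := by
    rw [hsum k hk, hB.extIntegral_grassmannPotential hF hint' hν.lifts, hνc]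
  refine ⟨le_antisymm (le_sSup ⟨ν, hν, hval⟩) (sSup_le ?_), ⟨ν, hν, hval, hν0⟩,
    fun he ↦ ⟨ν, hν, hνe he, hval, hν0⟩⟩
  rintro _ ⟨ν', hν', rfl⟩
  rw [hsum k hk, hB.extIntegral_grassmannPotential hF hint' hν'.lifts]
  exact EReal.sub_le_sub le_rfl (EReal.coe_ennreal_le_coe_ennreal_iff.2
    (hB.rate_le_lintegral_grassmannCost hf.measurable hF hν'))
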